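/- Let $\Omega$ be a bounded discrete domain of the square lattice: finite sets of vertices, faces, interior edges and boundary half-edges such that the edges and vertices of each face of $\Omega$ belong to $\Omega$, each vertex of $\Omega$ is incident to exactly four edges or half-edges of $\Omega$, each vertex incident to an edge or half-edge of $\Omega$ belongs to $\Omega$, each interior edge is incident to at least one face of $\Omega$, and the graph of vertices and interior edges is connected. Its boundary components correspond to the connected components of the complement; all but the outer one surround holes. Let $a=a_0,a_1,\dots,a_{2n},a_{2n+1}=b$ ($n\ge 0$) be distinct boundary half-edges, placed anywhere on the boundary, and $A=\{a_1,\dots,a_{2n}\}$. Let $\mathrm{Conf}_{a,A,b}$ be the set of all $S$ consisting of interior edges together with exactly the half-edges $a_0,\dots,a_{2n+1}$ such that each vertex is incident to $0$, $2$ or $4$ elements of $S$; let $|S|$ be the number of edges and half-edges in $S$, $x=\sqrt2-1$, and $$Z_{a,A,b}=\sum_{S\in \mathrm{Conf}_{a,A,b}}x^{|S|}.$$ A double cover $\varpi$ of $\Omega$ is a two-to-one local graph isomorphism onto $\Omega$ for which the contour of each face of $\Omega$ lifts to a closed contour; it branches around a hole if a loop surrounding only this hole does not lift to a loop. Fix a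 double cover $\varpi$, lifts of $a$ and $b$ to it, and artificial arcs $\nu_1,\dots,\nu_n$, where $\nu_s$ connects $a_{2s-1}$ to $a_{2s}$ and is given by its winding (compatible with the directions of the two half-edges) and the way it lifts to the double cover. Decompose $S\in\mathrm{Conf}_{a,A,b}$ at its vertices without transversal intersections; together with $\nu_1,\dots,\nu_n$ it becomes a curve $\gamma$ from $a$ to $b$ and a collection of loops. For such a decomposition put $$W_\varpi(b,S)=e^{-\frac i2\mathrm{wind}(\gamma)}(-1)^{l(S)}s(b,\gamma)(-1)^{I(S)},$$ where $\mathrm{wind}(\gamma)$ is the total turning of the tangent, $l(S)$ is the number of loops that do not lift to closed loops, $I(S)$ is the number of loops with zero winding modulo $4\pi$, and $s(b,\gamma)=1$ if $\gamma$ lifts to a curve from the chosen lift of $a$ to the chosen lift of $b$, and $s(b,\gamma)=-1$ otherwise. For a half-edge $y$, viewed as a complex number oriented outwards, let $\eta_y=(iy/|y|)^{-1/2}$ with some fixed choice of the sign. The multi-source observable is $$F_\varpi(a,A;b)=i\eta_a\sum_{S\in \mathrm{Conf}_{a,A,b}}W_\varpi(b,S)\,x^{|S|}.$$ Proposition. Let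 $\varpi=\varpi_Z$ branch around exactly those holes whose boundary component carries an odd number of the marked points $a_0,\dots,a_{2n+1}$. Then there is a sign $\varepsilon\in\{1,-1\}$ such that $i\eta_a W_{\varpi_Z}(b,S)=\varepsilon\,\eta_b$ for every $S\in \mathrm{Conf}_{a,A,b}$ and every decomposition of $S$ as above, and consequently $$F_{\varpi_Z}(a,A;b)=\varepsilon\,\eta_b\,Z_{a,A,b}.$$ -/

import Mathlib

open scoped Classical

noncomputable section

namespace IsingSpinor

/-! ### The square lattice

Everything below depends on the mesh only through rescaling, so the lattice is `ℤ²`.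
Directions are numbered `0, 1, 2, 3` = east, north, west, south (arithmetic in `Fin 4` is modulo 4). -/

/-- The unit lattice vector in direction `d`. -/
def step (d : Fin 4) : ℤ × ℤ := ![(1, 0), (0, 1), (-1, 0), (0, -1)] d

/-- The unit lattice vector in direction `d`, as a complex number. -/
def dirC (d : Fin 4) : ℂ := ![1, Complex.I, -1, -Complex.I] d

/-- `(v, d)` is the half-edge issuing from the lattice vertex `v` in direction `d`. -/
abbrev Dart := (ℤ × ℤ) × Fin 4

/-- The lattice neighbour of the base vertex in the direction of the dart. -/
def Dart.target (x : Dart) : ℤ × ℤ := x.1 + step x.2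

/-- The full lattice edge containing a half-edge. -/
def Dart.edge (x : Dart) : Sym2 (ℤ × ℤ) := s(x.1, x.target)

/-- The other half of the same lattice edge. -/
def Dart.rev (x : Dart) : Dart := (x.target, x.2 + 2)

/-- Faces of the lattice are indexed by their lower-left corner.
This is the face to the left of the dart. -/
def Dart.leftFace (x : Dart) : ℤ × ℤ := x.1 + ![(0, 0), (-1, 0), (-1, -1), (0, -1)] x.2

/-- The face to the right of the dart. -/
def Dart.rightFace (x : Dart) : ℤ × ℤ := Dart.leftFace (x.1, x.2 + 3)

/-! ### Discrete domains -/

/-- A (bounded) discrete domain: finite sets of vertices, faces, interior edges and boundary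
half-edges. -/
structure DiscreteDomain where
  verts : Finset (ℤ × ℤ)
  faces : Finset (ℤ × ℤ)
  innerEdges : Finset (Sym2 (ℤ × ℤ))
  halfEdges : Finset Dart
  /-- interior edges are edges of the lattice -/
  innerEdges_lattice : ∀ e ∈ innerEdges, ∃ x : Dart, e = x.edge
  /-- the four edges incident to a face of the domain belong to the domain -/
  edge_of_face : ∀ x : Dart, x.leftFace ∈ faces → x.edge ∈ innerEdges
  /-- the four vertices incident to a face of the domain belong to the domain -/
  vert_of_face : ∀ x : Dart, x.leftFace ∈ faces → x.1 ∈ verts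
  /-- each vertex is incident to exactly four edges or half-edges: in each of the four directions
  there is either an interior edge or a boundary half-edge -/
  four_incident : ∀ x : Dart, x.1 ∈ verts → Xor (x.edge ∈ innerEdges) (x ∈ halfEdges)
  /-- vertices incident to an interior edge belong to the domain -/
  vert_of_edge : ∀ x : Dart, x.edge ∈ innerEdges → x.1 ∈ verts
  /-- the vertex incident to a boundary half-edge belongs to the domain -/
  vert_of_halfEdge : ∀ x ∈ halfEdges, x.1 ∈ verts
  /-- at least one of the two faces incident to an interior edge belongs to the domain -/
  face_of_edge : ∀ x : Dart, x.edge ∈ innerEdges → x.leftFace ∈ faces ∨ x.rightFace ∈ faces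
  nonempty : verts.Nonempty
  connected : ∀ v ∈ verts, ∀ w ∈ verts,
    (SimpleGraph.fromEdgeSet (innerEdges : Set (Sym2 (ℤ × ℤ)))).Reachable v w

namespace DiscreteDomain

variable (Ω : DiscreteDomain)

/-- The graph formed by the vertices and interior edges (lattice points outside the domain are
isolated). -/
def graph : SimpleGraph (ℤ × ℤ) := SimpleGraph.fromEdgeSet (Ω.innerEdges : Set (Sym2 (ℤ × ℤ)))

/-- Two lattice faces outside the domain are neighbours if they share a lattice edge. (Such an edge
is never an interior edge of the domain.) -/
def complementGraph : SimpleGraph {f : ℤ × ℤ // f ∉ Ω.faces} :=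
  SimpleGraph.fromRel fun f g => ∃ x : Dart, x.leftFace = f ∧ x.rightFace = g

/-- Boundary components of the domain correspond to the connected components of its complement,
which are made of the lattice faces outside the domain. -/
abbrev BoundaryComponent := Ω.complementGraph.ConnectedComponent

variable {Ω}

/-- A boundary component is inner (the boundary of a hole) if it encloses finitely many faces; the
only other one is the outer boundary. -/
def BoundaryComponent.IsInner (K : Ω.BoundaryComponent) : Prop := K.supp.Finite

/-- The lattice face `f` lies in the complementary component `K`. -/
def BoundaryComponent.HasFace (K : Ω.BoundaryComponent) (f : ℤ × ℤ) : Prop :=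
  ∃ h : f ∉ Ω.faces, (⟨f, h⟩ : {f : ℤ × ℤ // f ∉ Ω.faces}) ∈ K.supp

/-- The boundary half-edge `x` lies on `K`: it sticks out into that component of the complement.
(Both lattice faces next to a boundary half-edge are outside the domain, and they are adjacent.) -/
def BoundaryComponent.Carries (K : Ω.BoundaryComponent) (x : Dart) : Prop := K.HasFace x.leftFace

/-- The number of times a walk crosses the horizontal ray from the centre of the face `f` to the
east. For a closed walk its parity is the winding number around `f` modulo 2. -/
def rayCrossings {v w : ℤ × ℤ} (p : Ω.graph.Walk v w) (f : ℤ × ℤ) : ℕ :=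
  (p.edges.filter fun e => decide (∃ m : ℤ, f.1 < m ∧ e = s((m, f.2), (m, f.2 + 1)))).length

/-- The closed walk `p` surrounds the hole `K` and no other hole (modulo 2). -/
def BoundaryComponent.SurroundedBy (K : Ω.BoundaryComponent) {v : ℤ × ℤ}
    (p : Ω.graph.Walk v v) : Prop :=
  ∀ f : ℤ × ℤ, f ∉ Ω.faces → (Odd (rayCrossings p f) ↔ K.HasFace f)

end DiscreteDomain

/-! ### Double covers -/

/-- A double cover of a discrete domain: a graph with a two-to-one local graph isomorphism onto the
graph of the domain, such that the contour of each face of the domain lifts to a closed contour. The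
cover of a half-edge `(v, d)` consists of the half-edges in direction `d` at the two points over
`v`. -/
structure DoubleCover (Ω : DiscreteDomain) where
  Vert : Type*
  graph : SimpleGraph Vert
  proj : Vert → ℤ × ℤ
  proj_mem : ∀ w, proj w ∈ Ω.verts
  two_to_one : ∀ v ∈ Ω.verts, {w | proj w = v}.ncard = 2
  proj_adj : ∀ w w', graph.Adj w w' → Ω.graph.Adj (proj w) (proj w')
  local_iso : ∀ w v, Ω.graph.Adj (proj w) v → ∃! w', graph.Adj w w' ∧ proj w' = v
  face_lifts : ∀ f ∈ Ω.faces, ∀ w₀ w₁ w₂ w₃ w₄, graph.Adj w₀ w₁ → graph.Adj w₁ w₂ →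
    graph.Adj w₂ w₃ → graph.Adj w₃ w₄ → proj w₀ = f → proj w₁ = f + (1, 0) →
    proj w₂ = f + (1, 1) → proj w₃ = f + (0, 1) → proj w₄ = f → w₄ = w₀

namespace DoubleCover

variable {Ω : DiscreteDomain} (C : DoubleCover Ω)

/-- A closed walk in the domain lifts to closed walks (as opposed to walks connecting different
sheets). -/
def LiftsToLoop {v : ℤ × ℤ} (p : Ω.graph.Walk v v) : Prop :=
  ∀ (w w' : C.Vert) (q : C.graph.Walk w w'), q.support.map C.proj = p.support → w = w'

/-- The cover branches around the hole `K`: a loop surrounding `K` alone does not lift to a loop. -/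
def BranchesAround (K : Ω.BoundaryComponent) : Prop :=
  ∃ (v : ℤ × ℤ) (p : Ω.graph.Walk v v), K.SurroundedBy p ∧ ¬ C.LiftsToLoop p

end DoubleCover

/-! ### Configurations -/

/-- A set of interior edges together with a set of boundary half-edges. -/
abbrev Config := Finset (Sym2 (ℤ × ℤ)) × Finset Dart

namespace Config

/-- The dart `x` is (one half of) an edge of `S`, or a half-edge of `S`. -/
def Occupied (S : Config) (x : Dart) : Prop := x.edge ∈ S.1 ∨ x ∈ S.2

/-- `|S|`: the total number of edges and half-edges. -/
def size (S : Config) : ℕ := S.1.card + S.2.card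

end Config

/-- The critical value `x = √2 - 1`. -/
def xCrit : ℝ := Real.sqrt 2 - 1

/-- `Conf(Ω)`: sets of interior edges and boundary half-edges such that each vertex is incident to
`0`, `2` or `4` of them. -/
def DiscreteDomain.conf (Ω : DiscreteDomain) : Finset Config :=
  (Ω.innerEdges.powerset ×ˢ Ω.halfEdges.powerset).filter fun S =>
    ∀ v ∈ Ω.verts, Even (Finset.univ.filter fun d : Fin 4 => S.Occupied (v, d)).card

/-- `2n + 2` distinct marked boundary half-edges `a = a₀, a₁, …, a₂ₙ, a₂ₙ₊₁ = b`. -/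
structure MarkedPoints (Ω : DiscreteDomain) (n : ℕ) where
  pt : Fin (2 * n + 2) → Dart
  pt_mem : ∀ i, pt i ∈ Ω.halfEdges
  pt_injective : Function.Injective pt

namespace MarkedPoints

variable {Ω : DiscreteDomain} {n : ℕ} (P : MarkedPoints Ω n)

/-- The marked point `a = a₀`. -/
def a : Dart := P.pt 0

/-- The marked point `b = a₂ₙ₊₁`. -/
def b : Dart := P.pt (Fin.last _)

/-- The starting point `a₁, a₃, …, a₂ₙ₋₁` of the artificial arc number `s`, where `s` runs over
`0, …, n - 1`. -/
def arcStart (s : Fin n) : Dart := P.pt ⟨2 * s + 1, by omega⟩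

/-- The end point `a₂, a₄, …, a₂ₙ` of the artificial arc number `s`. -/
def arcEnd (s : Fin n) : Dart := P.pt ⟨2 * s + 2, by omega⟩

/-- The number of marked points on a boundary component. -/
def countOn (K : Ω.BoundaryComponent) : ℕ := (Finset.univ.filter fun i => K.Carries (P.pt i)).card

/-- `Conf_{a, A, b}(Ω)`: configurations whose boundary is the set of marked points. -/
def conf : Finset Config := Ω.conf.filter fun S => S.2 = Finset.univ.image P.pt

/-- The partition function `Z_{a, A, b}`. -/
def Z : ℝ := ∑ S ∈ P.conf, xCrit ^ S.size

end MarkedPoints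

/-! ### Artificial arcs and curves -/

/-- An artificial arc from (the outer end of) the half-edge `p` to that of the half-edge `q`. It
leaves in the direction of `p` and arrives against the direction of `q`. What matters about it is
its winding modulo `4π` and the way it lifts to the double cover; accordingly the arc is recorded by
* its winding `turns * (π / 2)`, which must be compatible with the directions at the two ends;
* one of its lifts, running from the half-edge over `p` at the point `src` to the half-edge over `q`
  at the point `dst` (the other lift then connects the two other points). -/
structure ArtificialArc {Ω : DiscreteDomain} (C : DoubleCover Ω) (p q : Dart) where
  turns : ℤ
  turns_spec : (p.2.val : ℤ) + turns ≡ (q.2.val : ℤ) + 2 [ZMOD 4]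
  src : C.Vert
  dst : C.Vert
  proj_src : C.proj src = p.1
  proj_dst : C.proj dst = q.1

/-- The arc has a lift from the point `w` over (the vertex of) `p` to the point `w'` over `q`. -/
def ArtificialArc.Lifts {Ω : DiscreteDomain} {C : DoubleCover Ω} {p q : Dart}
    (ν : ArtificialArc C p q) (w w' : C.Vert) : Prop :=
  C.proj w = p.1 ∧ C.proj w' = q.1 ∧ (w = ν.src ↔ w' = ν.dst)

/-- A choice of the artificial arcs `ν₁, …, νₙ` connecting `a₁` to `a₂`, …, `a₂ₙ₋₁` to `a₂ₙ`. -/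
abbrev Arcs {Ω : DiscreteDomain} (C : DoubleCover Ω) {n : ℕ} (P : MarkedPoints Ω n) :=
  ∀ s : Fin n, ArtificialArc C (P.arcStart s) (P.arcEnd s)

/-- A passage of an oriented curve through the vertex `vert`: it arrives along the half-edge
`(vert, din)` (hence travelling in direction `din + 2`) and leaves along `(vert, dout)`. -/
structure Visit where
  vert : ℤ × ℤ
  din : Fin 4
  dout : Fin 4

namespace Visit

/-- The half-edge of arrival. -/
def inDart (x : Visit) : Dart := (x.vert, x.din)

/-- The half-edge of departure. -/
def outDart (x : Visit) : Dart := (x.vert, x.dout)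

/-- The turn at the vertex in units of `π / 2`: `1` to the left, `-1` to the right, `0` straight. -/
def turn (x : Visit) : ℤ :=
  if x.dout = x.din + 3 then 1 else if x.dout = x.din + 1 then -1 else 0

end Visit

section Curves

variable {Ω : DiscreteDomain} {C : DoubleCover Ω} {n : ℕ} {P : MarkedPoints Ω n}

/-- A curve leaving a vertex along `o` next arrives at a vertex along `i`: either `o`, `i` are the
two halves of an edge of `S`, or they are connected by an artificial arc (run in either
direction). -/
def Linked (P : MarkedPoints Ω n) (S : Config) (o i : Dart) : Prop :=
  (o.edge ∈ S.1 ∧ i = o.rev) ∨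
    ∃ s, (o = P.arcStart s ∧ i = P.arcEnd s) ∨ (o = P.arcEnd s ∧ i = P.arcStart s)

/-- The winding, in units of `π / 2`, of the piece of curve from `o` to `i`. -/
def linkTurns (ν : Arcs C P) (o i : Dart) : ℤ :=
  ∑ s, if o = P.arcStart s ∧ i = P.arcEnd s then (ν s).turns
    else if o = P.arcEnd s ∧ i = P.arcStart s then -(ν s).turns else 0

/-- The piece of curve from `o` to `i` lifts to one from the point `w` of the double cover (over the
vertex of `o`) to the point `w'` (over the vertex of `i`). -/
def LinkLifts (ν : Arcs C P) (o i : Dart) (w w' : C.Vert) : Prop :=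
  (i = o.rev ∧ C.proj w = o.1 ∧ C.proj w' = i.1 ∧ C.graph.Adj w w') ∨
    ∃ s, (o = P.arcStart s ∧ i = P.arcEnd s ∧ (ν s).Lifts w w') ∨
      (o = P.arcEnd s ∧ i = P.arcStart s ∧ (ν s).Lifts w' w)

/-- The winding, in units of `π / 2`, of the curve making the given sequence of visits. -/
def curveTurns (ν : Arcs C P) : List Visit → ℤ
  | [] => 0
  | [x] => x.turn
  | x :: y :: l => x.turn + linkTurns ν x.outDart y.inDart + curveTurns ν (y :: l)

/-- The curve making the given sequence of visits lifts to a curve from `w` to `w'`. -/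
def CurveLifts (ν : Arcs C P) : List Visit → C.Vert → C.Vert → Prop
  | [], _, _ => False
  | [x], w, w' => w = w' ∧ C.proj w = x.vert
  | x :: y :: l, w, w' =>
      C.proj w = x.vert ∧ ∃ u, LinkLifts ν x.outDart y.inDart w u ∧ CurveLifts ν (y :: l) u w'

/-- The winding, in units of `π / 2`, of the closed curve making cyclically the given sequence of
visits. -/
def loopTurns (ν : Arcs C P) : List Visit → ℤ
  | [] => 0
  | x :: l => curveTurns ν (x :: l) +
      linkTurns ν ((x :: l).getLast (List.cons_ne_nil x l)).outDart x.inDart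

/-- The closed curve making cyclically the given sequence of visits is non-trivial: it does not lift
to a closed curve. -/
def LoopNontrivial (ν : Arcs C P) : List Visit → Prop
  | [] => False
  | x :: l => ¬ ∃ w, CurveLifts ν (x :: (l ++ [x])) w w

/-- A decomposition of `S`, with the artificial arcs added, into a curve from `a` to `b` and a
collection of loops, without transversal (self-)intersections of the curves constituting `S`. -/
structure Decomposition (P : MarkedPoints Ω n) (S : Config) where
  path : List Visit
  loops : List (List Visit)
  /-- each half of an edge of `S`, and each half-edge of `S`, is used exactly once -/
  darts_nodup : ((path ++ loops.flatten).flatMap fun x => [x.inDart, x.outDart]).Nodup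
  mem_darts : ∀ x : Dart,
    x ∈ (path ++ loops.flatten).flatMap (fun x => [x.inDart, x.outDart]) ↔ S.Occupied x
  /-- no transversal intersections: a curve may go straight through a vertex only if the two other
  edges at this vertex are not occupied -/
  noncrossing : ∀ x ∈ path ++ loops.flatten, x.dout = x.din + 2 →
    ¬ S.Occupied (x.vert, x.din + 1) ∧ ¬ S.Occupied (x.vert, x.din + 3)
  path_start : path.head?.map Visit.inDart = some P.a
  path_end : path.getLast?.map Visit.outDart = some P.b
  path_chain : path.IsChain fun x y => Linked P S x.outDart y.inDart
  loops_ne_nil : ∀ l ∈ loops, l ≠ []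
  loops_chain : ∀ l ∈ loops, l.IsChain fun x y => Linked P S x.outDart y.inDart
  loops_closed : ∀ l ∈ loops, ∀ x ∈ l.head?, ∀ y ∈ l.getLast?, Linked P S y.outDart x.inDart

namespace Decomposition

variable {S : Config}

/-- `l(S)`: the number of non-trivial loops. -/
def numNontrivial (D : Decomposition P S) (ν : Arcs C P) : ℕ :=
  (D.loops.filter fun l => decide (LoopNontrivial ν l)).length

/-- `I(S)`: the number of loops that have zero winding modulo `4π`. -/
def numZeroWinding (D : Decomposition P S) (ν : Arcs C P) : ℕ :=
  (D.loops.filter fun l => decide ((8 : ℤ) ∣ loopTurns ν l)).length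

/-- `s(b, γ)`: whether the lift of the path starting at `a'` ends at `b'` or on the other sheet. -/
def sheetSign (D : Decomposition P S) (ν : Arcs C P) (a' b' : C.Vert) : ℂ :=
  if CurveLifts ν D.path a' b' then 1 else -1

/-- The winding of the path `γ`. -/
def wind (D : Decomposition P S) (ν : Arcs C P) : ℝ := curveTurns ν D.path * (Real.pi / 2)

/-- The complex phase computed from the given decomposition. -/
def phase (D : Decomposition P S) (ν : Arcs C P) (a' b' : C.Vert) : ℂ :=
  Complex.exp (-(Complex.I / 2) * (D.wind ν : ℂ)) * (-1) ^ D.numNontrivial ν *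
    D.sheetSign ν a' b' * (-1) ^ D.numZeroWinding ν

end Decomposition

/-- The complex phase `W_ϖ(b, S)`, computed from some decomposition of `S`; the value would be `0`
if `S` had no decomposition. The points `a'`, `b'` of the double cover specify the sheets of the
half-edges `a` and `b`. -/
def complexPhase (ν : Arcs C P) (a' b' : C.Vert) (S : Config) : ℂ :=
  if h : Nonempty (Decomposition P S) then (Classical.choice h).phase ν a' b' else 0

/-- The multi-source observable `F_ϖ(a, A; b)`. -/
def observable (ν : Arcs C P) (a' b' : C.Vert) (ηa : ℂ) : ℂ :=
  Complex.I * ηa * ∑ S ∈ P.conf, complexPhase ν a' b' S * (xCrit : ℂ) ^ S.size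

end Curves

/-- `η` is one of the two values of `(i x / |x|) ^ (-1/2)` for the half-edge `x`, oriented
outwards. -/
def IsEta (x : Dart) (η : ℂ) : Prop := η ^ 2 = (Complex.I * dirC x.2)⁻¹

end IsingSpinor

end

noncomputable section

namespace IsingSpinor

/-! ### Darts, edges and faces of the lattice -/

/-! The proof attaches a Clifford generator `dartOp x` to every dart x. On the free ℤ-module over
finite sets of darts it adds or removes x, with the Jordan–Wigner sign of an order in which the
darts at one vertex are consecutive. Each generator squares to 1 and distinct ones anticommute.

A decomposition of S pairs the occupied darts at each vertex. With the sign `Visit.sign`, the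
quadratic operator of a visit creates its two darts with coefficient exactly 1; evenness at the
vertex and absence of transversal crossings are what this needs (`Visit.op_ket`). So the product
over all visits sends the empty set to the set of occupied darts. In the same product the out-dart
of a visit stands next to the in-dart of the following one, so it can be regrouped into pairs of
linked darts, at the price of one minus sign per loop (`prod_visit_op_all`). Link operators commute
and, with their weights, do not depend on the orientation, so their product is determined by S.
Hence so is the collected sign `totalSign` (`Decomposition.edgeProd_ket`).

This sign is the phase. Turns and windings of links equal differences of direction numbers up to ±2
modulo 8. The differences telescope along a curve, and the ±2 are recorded by `Visit.sign` and
`linkSign`; putting the sheet changes into the link weights accounts for the lifting signs. The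
minus sign per loop is why loops of zero winding modulo 4π are the ones counted. The result is
`Decomposition.phase_eq`.

To compare two configurations, note that their difference is an even set of edges, hence the
boundary of a finite set U of faces (`exists_eq_faceBoundary`). Moving by the boundary of one face
multiplies the sign by the monodromy of the cover around it and by -1 for every marked half-edge
having this face on its left (`edgeProd_symmDiff_faceBoundary`). U consists of domain faces, where
both factors are trivial, and of whole holes, where the branching hypothesis says exactly that the
factors cancel (`prod_faceMonodromy_mul`). So the total sign is the same for all configurations
(`totalSign_eq`).

The remaining constant is identified with `ηb` up to sign by squaring (`eta_sq_eq`), and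
`exists_decomposition` ensures that the observable is a sum of genuine phases. -/

theorem step_add_two (d : Fin 4) : step (d + 2) = -step d := by
  fin_cases d <;> simp [step]

theorem step_injective : Function.Injective step := by
  intro d e h
  fin_cases d <;> fin_cases e <;> simp_all [step]

theorem step_ne_zero (d : Fin 4) : step d ≠ 0 := by
  fin_cases d <;> simp [step]

namespace Dart

theorem target_rev (x : Dart) : x.rev.target = x.1 := by
  simp [rev, target, step_add_two]

theorem rev_rev (x : Dart) : x.rev.rev = x := by
  obtain ⟨v, d⟩ := x
  refine Prod.ext (target_rev (v, d)) ?_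
  show d + 2 + 2 = d
  fin_cases d <;> rfl

theorem edge_rev (x : Dart) : x.rev.edge = x.edge := by
  rw [edge, target_rev, edge, Sym2.eq_swap]; rfl

theorem rev_ne (x : Dart) : x.rev ≠ x := by
  obtain ⟨v, d⟩ := x
  intro h
  have : d + 2 = d := congrArg Prod.snd h
  revert this
  fin_cases d <;> decide

theorem target_ne (x : Dart) : x.target ≠ x.1 := by
  intro h
  exact step_ne_zero x.2 (by simpa [target] using h)

theorem edge_eq_iff {x y : Dart} : x.edge = y.edge ↔ x = y ∨ x = y.rev := by
  constructor
  · intro h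
    rcases Sym2.eq_iff.1 h with ⟨h₁, h₂⟩ | ⟨h₁, h₂⟩
    · left
      refine Prod.ext h₁ (step_injective ?_)
      simpa [target, h₁] using h₂
    · right
      refine Prod.ext h₁ (step_injective ?_)
      show step x.2 = step (y.2 + 2)
      rw [step_add_two]
      rw [target, h₁, target] at h₂
      have : y.1 + (step y.2 + step x.2) = y.1 := by rw [← add_assoc]; exact h₂
      exact (neg_eq_of_add_eq_zero_right (by simpa using this)).symm
  · rintro (rfl | rfl)
    · rfl
    · exact edge_rev y

theorem leftFace_rev (x : Dart) : x.rev.leftFace = x.rightFace := by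
  obtain ⟨v, d⟩ := x
  fin_cases d <;> simp [rev, target, leftFace, rightFace, step, Prod.ext_iff]

theorem rightFace_rev (x : Dart) : x.rev.rightFace = x.leftFace := by
  rw [← leftFace_rev, rev_rev]

theorem leftFace_ne_rightFace (x : Dart) : x.leftFace ≠ x.rightFace := by
  obtain ⟨v, d⟩ := x
  fin_cases d <;> simp [leftFace, rightFace, Prod.ext_iff]

theorem fst_mem_edge (x : Dart) : x.1 ∈ x.edge := Sym2.mem_mk_left _ _

theorem exists_edge_eq_of_mem {x : Dart} {v : ℤ × ℤ} (h : v ∈ x.edge) :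
    ∃ d : Fin 4, x.edge = edge (v, d) := by
  rcases Sym2.mem_iff.1 h with rfl | rfl
  · exact ⟨x.2, rfl⟩
  · exact ⟨x.rev.2, (edge_rev x).symm⟩

end Dart

/-- The dart in direction `d` having the face `f` on its left. -/
def faceDart (f : ℤ × ℤ) (d : Fin 4) : Dart := (f - ![(0, 0), (-1, 0), (-1, -1), (0, -1)] d, d)

theorem leftFace_faceDart (f : ℤ × ℤ) (d : Fin 4) : (faceDart f d).leftFace = f := by
  simp [faceDart, Dart.leftFace]

theorem eq_faceDart_iff {x : Dart} {f : ℤ × ℤ} : x = faceDart f x.2 ↔ x.leftFace = f := by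
  constructor
  · intro h; rw [h, leftFace_faceDart]
  · rintro rfl; simp [faceDart, Dart.leftFace]

/-- The four edges around a face. -/
def faceEdges (f : ℤ × ℤ) : Finset (Sym2 (ℤ × ℤ)) :=
  Finset.univ.image fun d : Fin 4 => (faceDart f d).edge

theorem edge_mem_faceEdges {x : Dart} {f : ℤ × ℤ} :
    x.edge ∈ faceEdges f ↔ x.leftFace = f ∨ x.rightFace = f := by
  simp only [faceEdges, Finset.mem_image, Finset.mem_univ, true_and]
  constructor
  · rintro ⟨d, hd⟩
    rcases Dart.edge_eq_iff.1 hd.symm with h | h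
    · left; rw [h, leftFace_faceDart]
    · right; rw [h, Dart.rightFace_rev, leftFace_faceDart]
  · rintro (h | h)
    · exact ⟨x.2, by rw [← eq_faceDart_iff.2 h]⟩
    · refine ⟨x.rev.2, ?_⟩
      rw [← Dart.leftFace_rev] at h
      rw [← eq_faceDart_iff.2 h, Dart.edge_rev]

/-- Edges of the square lattice. -/
def IsLatticeEdge (e : Sym2 (ℤ × ℤ)) : Prop := ∃ x : Dart, e = x.edge

theorem faceDart_edge_injective (f : ℤ × ℤ) :
    Function.Injective fun d : Fin 4 => (faceDart f d).edge := by
  intro d e h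
  rcases Dart.edge_eq_iff.1 h with h | h
  · exact congrArg Prod.snd h
  · exfalso
    have h₁ := congrArg Dart.leftFace h
    rw [Dart.leftFace_rev, leftFace_faceDart] at h₁
    exact (faceDart f e).leftFace_ne_rightFace (by rw [leftFace_faceDart, ← h₁])

theorem prod_faceEdges {M : Type*} [CommMonoid M] (g : Sym2 (ℤ × ℤ) → M) (f : ℤ × ℤ) :
    ∏ e ∈ faceEdges f, g e = ∏ d : Fin 4, g (faceDart f d).edge :=
  Finset.prod_image fun _ _ _ _ h => faceDart_edge_injective f h

/-- The edges separating a face of `U` from a face outside `U`. -/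
def faceBoundary (U : Finset (ℤ × ℤ)) : Finset (Sym2 (ℤ × ℤ)) :=
  (U.biUnion faceEdges).filter fun e => ∀ x : Dart, e = x.edge → (x.leftFace ∈ U ↔ x.rightFace ∉ U)

theorem edge_mem_faceBoundary {U : Finset (ℤ × ℤ)} {x : Dart} :
    x.edge ∈ faceBoundary U ↔ (x.leftFace ∈ U ↔ x.rightFace ∉ U) := by
  simp only [faceBoundary, Finset.mem_filter, Finset.mem_biUnion, edge_mem_faceEdges]
  constructor
  · rintro ⟨-, h⟩; exact h x rfl
  · intro h
    refine ⟨?_, ?_⟩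
    · by_cases hl : x.leftFace ∈ U
      · exact ⟨_, hl, Or.inl rfl⟩
      · exact ⟨x.rightFace, by tauto, Or.inr rfl⟩
    · intro y hy
      rcases Dart.edge_eq_iff.1 hy with rfl | rfl
      · exact h
      · rw [Dart.leftFace_rev, Dart.rightFace_rev] at h
        tauto

theorem isLatticeEdge_of_mem_faceEdges {f : ℤ × ℤ} {e : Sym2 (ℤ × ℤ)} (h : e ∈ faceEdges f) :
    IsLatticeEdge e := by
  simp only [faceEdges, Finset.mem_image, Finset.mem_univ, true_and] at h
  obtain ⟨d, rfl⟩ := h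
  exact ⟨_, rfl⟩

theorem isLatticeEdge_of_mem_faceBoundary {U : Finset (ℤ × ℤ)} {e : Sym2 (ℤ × ℤ)}
    (h : e ∈ faceBoundary U) : IsLatticeEdge e := by
  simp only [faceBoundary, Finset.mem_filter, Finset.mem_biUnion] at h
  obtain ⟨⟨f, -, hf⟩, -⟩ := h
  exact isLatticeEdge_of_mem_faceEdges hf

theorem faceBoundary_empty : faceBoundary ∅ = ∅ := by
  simp [faceBoundary]

theorem faceBoundary_insert {U : Finset (ℤ × ℤ)} {f : ℤ × ℤ} (hf : f ∉ U) :
    faceBoundary (insert f U) = symmDiff (faceBoundary U) (faceEdges f) := by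
  have key : ∀ x : Dart, x.edge ∈ faceBoundary (insert f U) ↔
      x.edge ∈ symmDiff (faceBoundary U) (faceEdges f) := by
    intro x
    have := x.leftFace_ne_rightFace
    rw [Finset.mem_symmDiff, edge_mem_faceBoundary, edge_mem_faceBoundary, edge_mem_faceEdges,
      Finset.mem_insert, Finset.mem_insert]
    by_cases h₁ : x.leftFace = f
    · subst h₁; tauto
    · by_cases h₂ : x.rightFace = f
      · subst h₂; tauto
      · tauto
  ext e
  constructor
  · intro he
    obtain ⟨x, rfl⟩ := isLatticeEdge_of_mem_faceBoundary he
    exact (key x).1 he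
  · intro he
    obtain ⟨x, rfl⟩ : IsLatticeEdge e := by
      rcases Finset.mem_symmDiff.1 he with h | h
      · exact isLatticeEdge_of_mem_faceBoundary h.1
      · exact isLatticeEdge_of_mem_faceEdges h.1
    exact (key x).2 he

/-! ### Signs -/

/-- `-1` on the elements of `X` and `1` elsewhere. -/
def ind {α : Type*} (X : Finset α) (x : α) : ℤ := if x ∈ X then -1 else 1

theorem ind_symmDiff {α : Type*} [DecidableEq α] (X Y : Finset α) (x : α) :
    ind (symmDiff X Y) x = ind X x * ind Y x := by
  simp only [ind, Finset.mem_symmDiff]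
  split_ifs <;> simp_all

theorem ind_mul_self {α : Type*} (X : Finset α) (x : α) : ind X x * ind X x = 1 := by
  simp only [ind]; split_ifs <;> rfl

theorem prod_symmDiff_of_sq {α : Type*} [DecidableEq α] (X Y : Finset α) (g : α → ℤ)
    (hg : ∀ x, g x * g x = 1) :
    ∏ x ∈ symmDiff X Y, g x = (∏ x ∈ X, g x) * ∏ x ∈ Y, g x := by
  have h₁ : ∏ x ∈ symmDiff X Y, g x = (∏ x ∈ X \ Y, g x) * ∏ x ∈ Y \ X, g x := by
    rw [symmDiff_def]
    exact Finset.prod_union (Finset.disjoint_left.2 fun a h h' => by simp_all)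
  have h₂ : (∏ x ∈ X ∩ Y, g x) * ∏ x ∈ X ∩ Y, g x = 1 := by
    rw [← Finset.prod_mul_distrib]; exact Finset.prod_eq_one fun x _ => hg x
  rw [h₁, ← Finset.prod_inter_mul_prod_sdiff X Y, ← Finset.prod_inter_mul_prod_sdiff Y X,
    Finset.inter_comm Y X]
  linear_combination (-(∏ x ∈ X \ Y, g x) * ∏ x ∈ Y \ X, g x) * h₂

/-- An edge between two faces of U occurs twice in the product over faces and cancels because g
takes values of square 1. This discrete Stokes formula is used for monodromies and for ray
crossings. -/
theorem prod_faceBoundary (U : Finset (ℤ × ℤ)) (g : Sym2 (ℤ × ℤ) → ℤ)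
    (hg : ∀ e, g e * g e = 1) :
    ∏ e ∈ faceBoundary U, g e = ∏ f ∈ U, ∏ e ∈ faceEdges f, g e := by
  induction U using Finset.induction_on with
  | empty => simp [faceBoundary_empty]
  | insert f U hf ih =>
    rw [faceBoundary_insert hf, prod_symmDiff_of_sq _ _ _ hg, ih, Finset.prod_insert hf, mul_comm]

/-- Each lattice vertex is incident to an even number of edges of `T`. -/
def EvenDegrees (T : Finset (Sym2 (ℤ × ℤ))) : Prop :=
  ∀ v, ∏ d : Fin 4, ind T (Dart.edge (v, d)) = 1

theorem ind_faceBoundary (U : Finset (ℤ × ℤ)) (x : Dart) :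
    ind (faceBoundary U) x.edge = ind U x.leftFace * ind U x.rightFace := by
  simp only [ind, edge_mem_faceBoundary]
  split_ifs <;> simp_all

/-- Going around v, each of the four faces is adjacent to two of the four edges, so its sign occurs
squared. -/
theorem evenDegrees_faceBoundary (U : Finset (ℤ × ℤ)) : EvenDegrees (faceBoundary U) := by
  intro v
  simp only [ind_faceBoundary, Fin.prod_univ_four, Dart.rightFace]
  have h0 := ind_mul_self U (Dart.leftFace (v, 0))
  have h1 := ind_mul_self U (Dart.leftFace (v, 1))
  have h2 := ind_mul_self U (Dart.leftFace (v, 2))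
  have h3 := ind_mul_self U (Dart.leftFace (v, 3))
  simp only [show (0 : Fin 4) + 3 = 3 from rfl, show (1 : Fin 4) + 3 = 0 from rfl,
    show (2 : Fin 4) + 3 = 1 from rfl, show (3 : Fin 4) + 3 = 2 from rfl]
  generalize ind U (Dart.leftFace (v, 0)) = p at *
  generalize ind U (Dart.leftFace (v, 1)) = q at *
  generalize ind U (Dart.leftFace (v, 2)) = r at *
  generalize ind U (Dart.leftFace (v, 3)) = s at *
  calc _ = (p * p) * (q * q) * (r * r) * (s * s) := by ring
    _ = 1 := by rw [h0, h1, h2, h3]; rfl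

/-! ### Signed dart operators -/

/-- The position of a dart in the lexicographic order of vertices and directions. -/
def Dart.key (x : Dart) : ℤ ×ₗ (ℤ ×ₗ Fin 4) := toLex (x.1.1, toLex (x.1.2, x.2))

theorem Dart.key_injective : Function.Injective Dart.key := by
  rintro ⟨⟨a, b⟩, d⟩ ⟨⟨a', b'⟩, d'⟩ h
  simp only [key, EmbeddingLike.apply_eq_iff_eq, Prod.mk.injEq] at h
  obtain ⟨rfl, rfl, rfl⟩ := h
  rfl

/-- `-1` if `z` precedes `x`. -/
def orderSign (x z : Dart) : ℤ := if z.key < x.key then -1 else 1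

theorem orderSign_self (x : Dart) : orderSign x x = 1 := by simp [orderSign]

theorem orderSign_swap {x z : Dart} (h : x ≠ z) : orderSign x z = -orderSign z x := by
  have : x.key ≠ z.key := fun h' => h (Dart.key_injective h')
  rcases lt_or_gt_of_ne this with h | h
  · simp [orderSign, h, h.not_gt]
  · simp [orderSign, h, h.not_gt]

theorem orderSign_sq (x z : Dart) : orderSign x z * orderSign x z = 1 := by
  simp only [orderSign]; split_ifs <;> rfl

/-- The order compares vertices first, so a dart based elsewhere precedes both darts at v or
neither; only darts of v lying between the two contribute. This makes bilinear operators at a vertex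
local. -/
theorem orderSign_mul (v : ℤ × ℤ) {d e : Fin 4} (h : d ≤ e) (z : Dart) :
    orderSign (v, d) z * orderSign (v, e) z =
      ∏ k ∈ Finset.Ico d e, if z = (v, k) then (-1 : ℤ) else 1 := by
  obtain ⟨w, k⟩ := z
  by_cases hw : w = v
  · subst hw
    simp only [orderSign, Dart.key, Prod.Lex.toLex_lt_toLex, lt_self_iff_false, true_and, false_or,
      Prod.mk.injEq]
    revert d e k
    decide
  · have h₁ : orderSign (v, d) (w, k) = orderSign (v, e) (w, k) := by
      obtain ⟨a, b⟩ := v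
      obtain ⟨a', b'⟩ := w
      have : ¬ (a' = a ∧ b' = b) := fun h => hw (Prod.ext h.1 h.2)
      have h2 : ∀ p : Prop, (a' < a ∨ a' = a ∧ (b' < b ∨ b' = b ∧ p)) ↔
        (a' < a ∨ a' = a ∧ b' < b) := by intro p; tauto
      simp only [orderSign, Dart.key, Prod.Lex.toLex_lt_toLex, h2]
    rw [h₁, orderSign_sq, eq_comm]
    exact Finset.prod_eq_one fun k' _ => if_neg fun h => hw (congrArg Prod.fst h)

/-- The sign of the number of elements of `X` preceding `x`. -/
def setSign (x : Dart) (X : Finset Dart) : ℤ := ∏ z ∈ X, orderSign x z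

theorem setSign_sq (x : Dart) (X : Finset Dart) : setSign x X * setSign x X = 1 := by
  rw [setSign, ← Finset.prod_mul_distrib]
  exact Finset.prod_eq_one fun z _ => orderSign_sq x z

theorem setSign_symmDiff (x : Dart) (X Y : Finset Dart) :
    setSign x (symmDiff X Y) = setSign x X * setSign x Y :=
  prod_symmDiff_of_sq X Y _ (orderSign_sq x)

theorem setSign_singleton (x y : Dart) : setSign x {y} = orderSign x y := by simp [setSign]

theorem ind_eq_prod {α : Type*} [DecidableEq α] (X : Finset α) (x : α) :
    ind X x = ∏ z ∈ X, if z = x then (-1 : ℤ) else 1 := by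
  rw [Finset.prod_ite_eq', ind]
  congr

theorem setSign_mul (v : ℤ × ℤ) {d e : Fin 4} (h : d ≤ e) (X : Finset Dart) :
    setSign (v, d) X * setSign (v, e) X = ∏ k ∈ Finset.Ico d e, ind X (v, k) := by
  simp only [setSign, ← Finset.prod_mul_distrib, orderSign_mul v h, ind_eq_prod]
  rw [Finset.prod_comm]

/-- The space spanned by finite sets of darts. -/
abbrev DartSpace := Finset Dart →₀ ℤ

/-- Linear operators on the space spanned by finite sets of darts. -/
abbrev DartOp := Module.End ℤ DartSpace

/-- The basis vector of a set of darts. -/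
def ket (X : Finset Dart) : DartSpace := Finsupp.single X 1

theorem smul_ket_injective (X : Finset Dart) : Function.Injective fun n : ℤ => n • ket X := by
  intro m n h
  have := DFunLike.congr_fun h X
  simpa [ket] using this

theorem dartOp_ext {A B : DartOp} (h : ∀ X, A (ket X) = B (ket X)) : A = B := by
  refine Finsupp.lhom_ext fun X n => ?_
  have : Finsupp.single X n = n • ket X := by simp [ket]
  rw [this, map_smul, map_smul, h]

/-- The signed operator adding or removing the dart `x`. -/
def dartOp (x : Dart) : DartOp :=
  Finsupp.linearCombination ℤ fun X => setSign x X • ket (symmDiff X {x})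

theorem dartOp_ket (x : Dart) (X : Finset Dart) :
    dartOp x (ket X) = setSign x X • ket (symmDiff X {x}) := by
  simp [dartOp, ket]

theorem dartOp_sq (x : Dart) : dartOp x * dartOp x = 1 := by
  refine dartOp_ext fun X => ?_
  rw [Module.End.mul_apply, dartOp_ket, map_smul, dartOp_ket, smul_smul, setSign_symmDiff,
    setSign_singleton, orderSign_self, mul_one, setSign_sq, one_smul, symmDiff_assoc,
    symmDiff_self, symmDiff_bot]
  rfl

theorem dartOp_swap {x y : Dart} (h : x ≠ y) : dartOp x * dartOp y = -(dartOp y * dartOp x) := by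
  refine dartOp_ext fun X => ?_
  rw [LinearMap.neg_apply, Module.End.mul_apply, Module.End.mul_apply, dartOp_ket, dartOp_ket,
    map_smul, map_smul, dartOp_ket, dartOp_ket, smul_smul, smul_smul, setSign_symmDiff,
    setSign_symmDiff, setSign_singleton, setSign_singleton, orderSign_swap h, symmDiff_right_comm,
    ← neg_smul]
  congr 1
  ring

/-- The product of the operators of two darts. -/
def pairOp (x y : Dart) : DartOp := dartOp x * dartOp y

theorem pairOp_swap {x y : Dart} (h : x ≠ y) : pairOp x y = -pairOp y x := dartOp_swap h

theorem pairOp_commute_dartOp {x y z : Dart} (hx : x ≠ z) (hy : y ≠ z) :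
    Commute (pairOp x y) (dartOp z) := by
  show dartOp x * dartOp y * dartOp z = dartOp z * (dartOp x * dartOp y)
  rw [mul_assoc, dartOp_swap hy, mul_neg, ← mul_assoc, dartOp_swap hx, neg_mul, neg_neg, mul_assoc]

theorem pairOp_commute {x y z w : Dart} (h₁ : x ≠ z) (h₂ : y ≠ z) (h₃ : x ≠ w) (h₄ : y ≠ w) :
    Commute (pairOp x y) (pairOp z w) :=
  (pairOp_commute_dartOp h₁ h₂).mul_right (pairOp_commute_dartOp h₃ h₄)

theorem pairOp_sq {x y : Dart} (h : x ≠ y) : pairOp x y * pairOp x y = -1 := by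
  rw [pairOp, mul_assoc, ← mul_assoc (dartOp y), dartOp_swap h.symm, neg_mul, mul_neg,
    mul_assoc (dartOp x), dartOp_sq, mul_one, dartOp_sq]

theorem pairOp_ket (x y : Dart) (X : Finset Dart) :
    pairOp x y (ket X) =
      (setSign x X * setSign y X * orderSign x y) • ket (symmDiff X (symmDiff {x} {y})) := by
  rw [pairOp, Module.End.mul_apply, dartOp_ket, map_smul, dartOp_ket, smul_smul, setSign_symmDiff,
    setSign_singleton, symmDiff_assoc, symmDiff_comm ({y} : Finset Dart)]
  congr 1
  ring

theorem orderSign_of_le (v : ℤ × ℤ) {d e : Fin 4} (h : d ≤ e) :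
    orderSign (v, d) (v, e) = 1 := by
  simp only [orderSign, Dart.key, Prod.Lex.toLex_lt_toLex, lt_self_iff_false, false_or,
    not_lt.2 h, and_false, if_false]

/-- The Jordan–Wigner string of a pair at one vertex shrinks to the directions from d up to, but
excluding, e. -/
theorem pairOp_ket_of_le (v : ℤ × ℤ) {d e : Fin 4} (h : d ≤ e) (X : Finset Dart) :
    pairOp (v, d) (v, e) (ket X) =
      (∏ k ∈ Finset.Ico d e, ind X (v, k)) • ket (symmDiff X (symmDiff {(v, d)} {(v, e)})) := by
  rw [pairOp_ket, setSign_mul v h, orderSign_of_le v h, mul_one]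

/-! ### Corners and faces -/

/-- Each lattice vertex is the base of an even number of darts in `X`. -/
def EvenAtVertices (X : Finset Dart) : Prop := ∀ v, ∏ d : Fin 4, ind X (v, d) = 1

theorem pairOp_corner_ket (v : ℤ × ℤ) {d : Fin 4} (hd : d ≠ 3) (X : Finset Dart) :
    pairOp (v, d) (v, d + 1) (ket X) =
      ind X (v, d) • ket (symmDiff X (symmDiff {(v, d)} {(v, d + 1)})) := by
  rw [pairOp_ket_of_le v (by revert d; decide)]
  congr 1
  have : Finset.Ico d (d + 1) = {d} := by revert d; decide
  rw [this, Finset.prod_singleton]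

/-- The corner from direction 3 to 0 wraps around the order. Its string 0, 1, 2 is traded for the
single direction 3 by evenness, and exchanging the generators gives the extra minus sign compared
with the other corners. -/
theorem pairOp_corner_three_ket (v : ℤ × ℤ) {X : Finset Dart} (hX : EvenAtVertices X) :
    pairOp (v, 3) (v, 0) (ket X) =
      (-ind X (v, 3)) • ket (symmDiff X (symmDiff {(v, 3)} {(v, 0)})) := by
  have h := hX v
  rw [Fin.prod_univ_four] at h
  have h₃ := ind_mul_self X (v, 3)
  rw [pairOp_swap (by simp), LinearMap.neg_apply,
    pairOp_ket_of_le v (show (0 : Fin 4) ≤ 3 by decide), ← neg_smul, symmDiff_comm {(v, 3)}]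
  congr 1
  have : Finset.Ico (0 : Fin 4) 3 = {0, 1, 2} := by decide
  rw [this, Finset.prod_insert (by decide), Finset.prod_insert (by decide), Finset.prod_singleton]
  linear_combination (-ind X (v, 3)) * h + ind X (v, 0) * ind X (v, 1) * ind X (v, 2) * h₃

section

/-- The darts lying on the edges of `F`. -/
def dartSet (F : Finset (Sym2 (ℤ × ℤ))) : Finset Dart :=
  ((F.biUnion fun e => Sym2.toFinset e) ×ˢ Finset.univ).filter fun x => x.edge ∈ F

theorem mem_dartSet {F : Finset (Sym2 (ℤ × ℤ))} {x : Dart} : x ∈ dartSet F ↔ x.edge ∈ F := by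
  simp only [dartSet, Finset.mem_filter, Finset.mem_product, Finset.mem_biUnion, Sym2.mem_toFinset,
    Finset.mem_univ, and_true, and_iff_right_iff_imp]
  exact fun h => ⟨_, h, x.fst_mem_edge⟩

theorem dartSet_symmDiff (F G : Finset (Sym2 (ℤ × ℤ))) :
    dartSet (symmDiff F G) = symmDiff (dartSet F) (dartSet G) := by
  ext x
  simp only [mem_dartSet, Finset.mem_symmDiff]

theorem dartSet_singleton (x : Dart) : dartSet {x.edge} = symmDiff {x} {x.rev} := by
  ext y
  have := x.rev_ne
  simp only [mem_dartSet, Finset.mem_symmDiff, Finset.mem_singleton, Dart.edge_eq_iff]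
  constructor
  · rintro (rfl | rfl)
    · exact Or.inl ⟨rfl, this.symm⟩
    · exact Or.inr ⟨rfl, this⟩
  · tauto

theorem ind_dartSet (F : Finset (Sym2 (ℤ × ℤ))) (x : Dart) : ind (dartSet F) x = ind F x.edge := by
  simp only [ind, mem_dartSet]
  congr

theorem EvenAtVertices.symmDiff {X Y : Finset Dart} (hX : EvenAtVertices X)
    (hY : EvenAtVertices Y) : EvenAtVertices (symmDiff X Y) := by
  intro v
  simp only [ind_symmDiff, Finset.prod_mul_distrib]
  rw [hX v, hY v, one_mul]

theorem evenAtVertices_dartSet {F : Finset (Sym2 (ℤ × ℤ))} (hF : EvenDegrees F) :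
    EvenAtVertices (dartSet F) := by
  intro v
  simp only [ind_dartSet]
  exact hF v

/-! ### Edge operators -/

/-- The sign attached to a direction. -/
def dirSign (d : Fin 4) : ℤ := if d < 2 then -1 else 1

/-- This oddness compensates the antisymmetry of `pairOp`, so that the operator of an edge does not
depend on which half represents it. The values themselves are those of `linkSign` on edges. -/
theorem dirSign_add_two (d : Fin 4) : dirSign (d + 2) = -dirSign d := by
  revert d; decide

theorem dirSign_sq (d : Fin 4) : dirSign d * dirSign d = 1 := by
  revert d; decide

variable (s : Sym2 (ℤ × ℤ) → ℤ)

/-- The operator of the edge containing the dart `x`, weighted by the sign `s` of the edge. -/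
def dartEdgeOp (x : Dart) : DartOp := (s x.edge * dirSign x.2) • pairOp x x.rev

theorem dartEdgeOp_rev (x : Dart) : dartEdgeOp s x.rev = dartEdgeOp s x := by
  have : dirSign x.rev.2 = -dirSign x.2 := dirSign_add_two x.2
  rw [dartEdgeOp, dartEdgeOp, Dart.edge_rev, Dart.rev_rev, this, pairOp_swap x.rev_ne, smul_neg,
    ← neg_smul]
  congr 1
  ring

/-- The operator of an edge, weighted by the sign `s` of the edge. -/
def edgeOp (e : Sym2 (ℤ × ℤ)) : DartOp :=
  if h : IsLatticeEdge e then dartEdgeOp s h.choose else 1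

theorem edgeOp_edge (x : Dart) : edgeOp s x.edge = dartEdgeOp s x := by
  have h : IsLatticeEdge x.edge := ⟨x, rfl⟩
  rw [edgeOp, dif_pos h]
  rcases Dart.edge_eq_iff.1 h.choose_spec with h' | h'
  · rw [← h']
  · have h₂ : dartEdgeOp s x = dartEdgeOp s h.choose.rev := congrArg _ h'
    rw [h₂, dartEdgeOp_rev]

theorem edgeOp_commute_pairOp {e : Sym2 (ℤ × ℤ)} {z w : Dart} (hz : z.edge ≠ e) (hw : w.edge ≠ e) :
    Commute (edgeOp s e) (pairOp z w) := by
  by_cases he : IsLatticeEdge e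
  · obtain ⟨x, rfl⟩ := he
    rw [edgeOp_edge]
    refine Commute.smul_left (pairOp_commute ?_ ?_ ?_ ?_) _
    · rintro rfl; exact hz rfl
    · rintro rfl; exact hz x.edge_rev
    · rintro rfl; exact hw rfl
    · rintro rfl; exact hw x.edge_rev
  · rw [edgeOp, dif_neg he]
    exact Commute.one_left _

theorem edgeOp_commute (e e' : Sym2 (ℤ × ℤ)) : Commute (edgeOp s e) (edgeOp s e') := by
  by_cases h : e = e'
  · rw [h]
  by_cases he' : IsLatticeEdge e'
  · obtain ⟨x, rfl⟩ := he'
    rw [edgeOp_edge s x]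
    refine Commute.smul_right (edgeOp_commute_pairOp s (Ne.symm h) ?_) _
    rw [Dart.edge_rev]; exact Ne.symm h
  · rw [edgeOp, edgeOp, dif_neg he']
    exact Commute.one_right _

/-- The product of the operators of the edges in `F`. -/
def edgeProd (F : Finset (Sym2 (ℤ × ℤ))) : DartOp := (F.toList.map (edgeOp s)).prod

theorem prod_map_edgeOp_perm {l l' : List (Sym2 (ℤ × ℤ))} (h : l.Perm l') :
    (l.map (edgeOp s)).prod = (l'.map (edgeOp s)).prod := by
  refine (h.map _).prod_eq' ?_
  rw [List.pairwise_map]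
  exact List.Pairwise.imp (fun _ => edgeOp_commute s _ _) 
    (List.pairwise_of_forall (R := fun _ _ => True) fun _ _ => trivial)

theorem edgeProd_empty : edgeProd s ∅ = 1 := by simp [edgeProd]

theorem edgeProd_insert {F : Finset (Sym2 (ℤ × ℤ))} {e : Sym2 (ℤ × ℤ)} (h : e ∉ F) :
    edgeProd s (insert e F) = edgeOp s e * edgeProd s F := by
  rw [edgeProd, prod_map_edgeOp_perm s (Finset.toList_insert h), List.map_cons, List.prod_cons]
  rfl

theorem edgeOp_sq (hs : ∀ e, s e * s e = 1) {e : Sym2 (ℤ × ℤ)} (he : IsLatticeEdge e) :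
    edgeOp s e * edgeOp s e = -1 := by
  obtain ⟨x, rfl⟩ := he
  have : s x.edge * dirSign x.2 * (s x.edge * dirSign x.2) = 1 := by
    linear_combination s x.edge * s x.edge * dirSign_sq x.2 + hs x.edge
  rw [edgeOp_edge, dartEdgeOp, smul_mul_smul_comm, pairOp_sq x.rev_ne.symm, this, one_smul]

/-- Edge operators commute and square to -1, so a sign appears exactly when e is removed rather than
added. -/
theorem edgeOp_mul_edgeProd (hs : ∀ e, s e * s e = 1) {e : Sym2 (ℤ × ℤ)} (he : IsLatticeEdge e)
    (F : Finset (Sym2 (ℤ × ℤ))) :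
    edgeOp s e * edgeProd s F = ind F e • edgeProd s (symmDiff F {e}) := by
  by_cases h : e ∈ F
  · have h₁ : symmDiff F {e} = F.erase e := by
      ext y
      simp only [Finset.mem_symmDiff, Finset.mem_singleton, Finset.mem_erase]
      constructor
      · rintro (h' | ⟨rfl, h'⟩)
        · exact h'.symm
        · exact absurd h h'
      · exact fun h' => Or.inl h'.symm
    have h₂ : F = insert e (F.erase e) := (Finset.insert_erase h).symm
    rw [h₁, ind, if_pos h]
    conv_lhs => rw [h₂]
    rw [edgeProd_insert s (Finset.notMem_erase e F), ← mul_assoc, edgeOp_sq s hs he, neg_mul,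
      one_mul, neg_smul, one_smul]
  · have h₁ : symmDiff F {e} = insert e F := by
      ext y
      simp only [Finset.mem_symmDiff, Finset.mem_singleton, Finset.mem_insert]
      constructor
      · tauto
      · rintro (rfl | h')
        · exact Or.inr ⟨rfl, h⟩
        · exact Or.inl ⟨h', fun h'' => h (h'' ▸ h')⟩
    rw [h₁, ind, if_neg h, edgeProd_insert s h, one_smul]

theorem edgeProd_mul_edgeProd (hs : ∀ e, s e * s e = 1) {T : Finset (Sym2 (ℤ × ℤ))}
    (hT : ∀ e ∈ T, IsLatticeEdge e)
    (F : Finset (Sym2 (ℤ × ℤ))) :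
    edgeProd s T * edgeProd s F = (∏ e ∈ T, ind F e) • edgeProd s (symmDiff F T) := by
  induction T using Finset.induction_on with
  | empty =>
    rw [edgeProd_empty, one_mul, Finset.prod_empty, one_smul]
    congr 1
    exact (symmDiff_bot F).symm
  | insert e T he ih =>
    have h₁ : ind T e = 1 := if_neg he
    have h₂ : insert e T = symmDiff T {e} := by
      ext y
      simp only [Finset.mem_symmDiff, Finset.mem_singleton, Finset.mem_insert]
      constructor
      · rintro (rfl | h')
        · exact Or.inr ⟨rfl, he⟩
        · exact Or.inl ⟨h', fun h'' => he (h'' ▸ h')⟩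
      · tauto
    rw [edgeProd_insert s he, mul_assoc, ih fun e h => hT e (Finset.mem_insert_of_mem h),
      mul_smul_comm, edgeOp_mul_edgeProd s hs (hT e (Finset.mem_insert_self e T)), smul_smul,
      ind_symmDiff, h₁, mul_one, Finset.prod_insert he, h₂, symmDiff_assoc, mul_comm]

/-- The order 2, 1, 0, 3 of the commuting factors is chosen so that, after reversing each pair, the
two halves meeting at three of the corners are already neighbours in the product. -/
theorem edgeProd_faceEdges (f : ℤ × ℤ) :
    edgeProd s (faceEdges f) = edgeOp s (faceDart f 2).edge * edgeOp s (faceDart f 1).edge *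
      edgeOp s (faceDart f 0).edge * edgeOp s (faceDart f 3).edge := by
  have h := fun d e => (faceDart_edge_injective f).ne (a₁ := d) (a₂ := e)
  have : (faceEdges f).toList.Perm [(faceDart f 2).edge, (faceDart f 1).edge, (faceDart f 0).edge,
      (faceDart f 3).edge] := by
    refine (List.perm_ext_iff_of_nodup (Finset.nodup_toList _) ?_).2 ?_
    · simp only [List.nodup_cons, List.mem_cons, List.not_mem_nil, or_false, not_or,
        not_false_eq_true, List.nodup_nil, and_true]
      exact ⟨⟨h 2 1 (by decide), h 2 0 (by decide), h 2 3 (by decide)⟩,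
        ⟨h 1 0 (by decide), h 1 3 (by decide)⟩, h 0 3 (by decide)⟩
    · intro e
      simp only [faceEdges, Finset.mem_toList, Finset.mem_image, Finset.mem_univ, true_and,
        List.mem_cons, List.not_mem_nil, or_false]
      constructor
      · rintro ⟨d, rfl⟩
        fin_cases d <;> simp
      · rintro (h | h | h | h)
        exacts [⟨2, h.symm⟩, ⟨1, h.symm⟩, ⟨0, h.symm⟩, ⟨3, h.symm⟩]
  rw [edgeProd, prod_map_edgeOp_perm s this]
  simp [mul_assoc]

theorem rev_faceDart (f : ℤ × ℤ) (d : Fin 4) :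
    (faceDart f d).rev = ((faceDart f (d + 1)).1, d + 2) := by
  fin_cases d <;> simp [faceDart, Dart.rev, Dart.target, step, Prod.ext_iff]

end

section

variable (s : Sym2 (ℤ × ℤ) → ℤ)

/-! ### Face operators -/

/-- Both sides are products of the same eight generators, grouped by edges on the left and by
corners on the right. Corner operators act with local signs, which is what makes the effect of a
face computable. -/
theorem edgeProd_faceEdges_eq_corners (f : ℤ × ℤ) :
    edgeProd s (faceEdges f) = (-∏ e ∈ faceEdges f, s e) •
      (pairOp ((faceDart f 2).1, 2) ((faceDart f 2).1, 2 + 1) *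
        pairOp ((faceDart f 1).1, 1) ((faceDart f 1).1, 1 + 1) *
        pairOp ((faceDart f 0).1, 0) ((faceDart f 0).1, 0 + 1) *
        pairOp ((faceDart f 3).1, 3) ((faceDart f 3).1, 0)) := by
  rw [edgeProd_faceEdges, edgeOp_edge, edgeOp_edge, edgeOp_edge, edgeOp_edge, prod_faceEdges,
    Fin.prod_univ_four]
  simp only [dartEdgeOp, smul_mul_assoc, mul_smul_comm, smul_smul]
  have e2 : faceDart f 2 = ((faceDart f 2).1, 2) := rfl
  have e1 : faceDart f 1 = ((faceDart f 1).1, 1) := rfl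
  have e0 : faceDart f 0 = ((faceDart f 0).1, 0) := rfl
  have e3 : faceDart f 3 = ((faceDart f 3).1, 3) := rfl
  have r2 : (faceDart f 2).rev = ((faceDart f 3).1, 0) := rev_faceDart f 2
  have r1 : (faceDart f 1).rev = ((faceDart f 2).1, 3) := rev_faceDart f 1
  have r0 : (faceDart f 0).rev = ((faceDart f 1).1, 2) := rev_faceDart f 0
  have r3 : (faceDart f 3).rev = ((faceDart f 0).1, 1) := rev_faceDart f 3
  have d2 : dirSign (faceDart f 2).2 = 1 := rfl
  have d1 : dirSign (faceDart f 1).2 = -1 := rfl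
  have d0 : dirSign (faceDart f 0).2 = -1 := rfl
  have d3 : dirSign (faceDart f 3).2 = 1 := rfl
  rw [d0, d1, d2, d3]
  have key : pairOp (faceDart f 2) (faceDart f 2).rev * pairOp (faceDart f 1) (faceDart f 1).rev *
      pairOp (faceDart f 0) (faceDart f 0).rev * pairOp (faceDart f 3) (faceDart f 3).rev =
      -(pairOp ((faceDart f 2).1, 2) ((faceDart f 2).1, 3) *
        pairOp ((faceDart f 1).1, 1) ((faceDart f 1).1, 2) *
        pairOp ((faceDart f 0).1, 0) ((faceDart f 0).1, 1) *
        pairOp ((faceDart f 3).1, 3) ((faceDart f 3).1, 0)) := by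
    -- The four signs from reversing the pairs cancel one another.
    rw [pairOp_swap (faceDart f 2).rev_ne.symm, pairOp_swap (faceDart f 1).rev_ne.symm,
      pairOp_swap (faceDart f 0).rev_ne.symm, pairOp_swap (faceDart f 3).rev_ne.symm]
    rw [r0, r1, r2, r3, e0, e1, e2, e3]
    have n : ∀ d : Fin 4, d ≠ 3 → (faceDart f d).1 ≠ (faceDart f 3).1 := by
      intro d hd
      fin_cases d <;> simp [faceDart, Prod.ext_iff] at hd ⊢
    have c2 := pairOp_commute_dartOp (x := ((faceDart f 2).1, 2)) (y := ((faceDart f 2).1, 3))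
      (z := ((faceDart f 3).1, 0)) (fun h => n 2 (by decide) (Prod.ext_iff.1 h).1)
      (fun h => n 2 (by decide) (Prod.ext_iff.1 h).1)
    have c1 := pairOp_commute_dartOp (x := ((faceDart f 1).1, 1)) (y := ((faceDart f 1).1, 2))
      (z := ((faceDart f 3).1, 0)) (fun h => n 1 (by decide) (Prod.ext_iff.1 h).1)
      (fun h => n 1 (by decide) (Prod.ext_iff.1 h).1)
    have c0 := pairOp_commute_dartOp (x := ((faceDart f 0).1, 0)) (y := ((faceDart f 0).1, 1))
      (z := ((faceDart f 3).1, 0)) (fun h => n 0 (by decide) (Prod.ext_iff.1 h).1)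
      (fun h => n 0 (by decide) (Prod.ext_iff.1 h).1)
    have h3 := dartOp_swap (x := ((faceDart f 3).1, 0)) (y := ((faceDart f 3).1, 3)) (by simp)
    have cc := ((c2.mul_left c1).mul_left c0).eq
    simp only [neg_mul, mul_neg, neg_neg]
    -- Only the corner at `(faceDart f 3).1` is split between the two ends of the product. Its first
    -- half commutes with the three complete corners and then anticommutes with its second half,
    -- which is the overall minus sign.
    calc _ = dartOp ((faceDart f 3).1, 0) *
          (pairOp ((faceDart f 2).1, 2) ((faceDart f 2).1, 3) *
          pairOp ((faceDart f 1).1, 1) ((faceDart f 1).1, 2) *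
          pairOp ((faceDart f 0).1, 0) ((faceDart f 0).1, 1)) *
          dartOp ((faceDart f 3).1, 3) := by simp only [pairOp, mul_assoc]
      _ = _ := by
        rw [← cc, mul_assoc, h3, mul_neg]
        rfl
  simp only [mul_assoc] at key ⊢
  rw [key, smul_neg, ← neg_smul]
  congr 1
  ring

/-- The minus sign of the regrouping cancels that of the wrapped corner. What is left involves, for
each edge, only the half that has f on its left. The wrapped corner is the rightmost factor, so it
acts on X itself, where evenness is available. -/
theorem edgeProd_faceEdges_ket (f : ℤ × ℤ) {X : Finset Dart} (hX : EvenAtVertices X) :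
    edgeProd s (faceEdges f) (ket X) =
      ((∏ e ∈ faceEdges f, s e) * ∏ d : Fin 4, ind X (faceDart f d)) •
        ket (symmDiff X (dartSet (faceEdges f))) := by
  have n : ∀ d e d' e' : Fin 4, d ≠ e → ((faceDart f d).1, d') ≠ ((faceDart f e).1, e') := by
    intro d e d' e' hd h
    have : (faceDart f d).1 = (faceDart f e).1 := (Prod.ext_iff.1 h).1
    revert hd this
    fin_cases d <;> fin_cases e <;> simp [faceDart, Prod.ext_iff]
  -- The corners sit at different vertices, so toggling one leaves the signs read at the others
  -- unchanged.
  have one : ∀ (Y : Finset Dart) (d e d' e' k : Fin 4), d ≠ e →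
      ind (symmDiff Y (symmDiff {((faceDart f d).1, d')} {((faceDart f d).1, e')}))
        ((faceDart f e).1, k) = ind Y ((faceDart f e).1, k) := by
    intro Y d e d' e' k hd
    have h₁ : ind {((faceDart f d).1, d')} ((faceDart f e).1, k) = 1 :=
      if_neg (by rw [Finset.mem_singleton]; exact n _ _ _ _ hd.symm)
    have h₂ : ind {((faceDart f d).1, e')} ((faceDart f e).1, k) = 1 :=
      if_neg (by rw [Finset.mem_singleton]; exact n _ _ _ _ hd.symm)
    rw [ind_symmDiff, ind_symmDiff, h₁, h₂, mul_one, mul_one]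
  rw [edgeProd_faceEdges_eq_corners, LinearMap.smul_apply]
  simp only [Module.End.mul_apply]
  rw [pairOp_corner_three_ket _ hX, map_smul, pairOp_corner_ket _ (by decide), map_smul, map_smul,
    map_smul, pairOp_corner_ket _ (by decide), map_smul, map_smul,
    pairOp_corner_ket _ (by decide)]
  simp only [smul_smul]
  rw [one _ 3 0 _ _ _ (by decide), one _ 0 1 _ _ _ (by decide), one _ 3 1 _ _ _ (by decide),
    one _ 1 2 _ _ _ (by decide), one _ 0 2 _ _ _ (by decide), one _ 3 2 _ _ _ (by decide),
    Fin.prod_univ_four]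
  have hset : dartSet (faceEdges f) = symmDiff (symmDiff (symmDiff
      (symmDiff {((faceDart f 3).1, 3)} {((faceDart f 3).1, 0)})
      (symmDiff {((faceDart f 0).1, 0)} {((faceDart f 0).1, 0 + 1)}))
      (symmDiff {((faceDart f 1).1, 1)} {((faceDart f 1).1, 1 + 1)}))
      (symmDiff {((faceDart f 2).1, 2)} {((faceDart f 2).1, 2 + 1)}) := by
    have hF : faceEdges f = symmDiff (symmDiff (symmDiff {(faceDart f 0).edge}
        {(faceDart f 1).edge}) {(faceDart f 2).edge}) {(faceDart f 3).edge} := by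
      have h := fun d e => (faceDart_edge_injective f).ne (a₁ := d) (a₂ := e)
      have h01 := h 0 1 (by decide)
      have h02 := h 0 2 (by decide)
      have h03 := h 0 3 (by decide)
      have h12 := h 1 2 (by decide)
      have h13 := h 1 3 (by decide)
      have h23 := h 2 3 (by decide)
      ext e
      simp only [faceEdges, Finset.mem_image, Finset.mem_univ, true_and, Finset.mem_symmDiff,
        Finset.mem_singleton]
      constructor
      · rintro ⟨d, rfl⟩
        fin_cases d <;> simp_all
      · intro h
        by_contra hne
        have h0 : e ≠ (faceDart f 0).edge := fun h => hne ⟨0, h.symm⟩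
        have h1 : e ≠ (faceDart f 1).edge := fun h => hne ⟨1, h.symm⟩
        have h2 : e ≠ (faceDart f 2).edge := fun h => hne ⟨2, h.symm⟩
        have h3 : e ≠ (faceDart f 3).edge := fun h => hne ⟨3, h.symm⟩
        tauto
    rw [hF, dartSet_symmDiff, dartSet_symmDiff, dartSet_symmDiff, dartSet_singleton,
      dartSet_singleton, dartSet_singleton, dartSet_singleton, rev_faceDart, rev_faceDart,
      rev_faceDart, rev_faceDart]
    show symmDiff (symmDiff (symmDiff (symmDiff {((faceDart f 0).1, 0)} {((faceDart f 1).1, 2)})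
      (symmDiff {((faceDart f 1).1, 1)} {((faceDart f 2).1, 3)}))
      (symmDiff {((faceDart f 2).1, 2)} {((faceDart f 3).1, 0)}))
      (symmDiff {((faceDart f 3).1, 3)} {((faceDart f 0).1, 1)}) = symmDiff (symmDiff (symmDiff
      (symmDiff {((faceDart f 3).1, 3)} {((faceDart f 3).1, 0)})
      (symmDiff {((faceDart f 0).1, 0)} {((faceDart f 0).1, 1)}))
      (symmDiff {((faceDart f 1).1, 1)} {((faceDart f 1).1, 2)}))
      (symmDiff {((faceDart f 2).1, 2)} {((faceDart f 2).1, 3)})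
    ac_rfl
  rw [hset]
  simp only [← symmDiff_assoc]
  congr 1
  show _ = _ * (ind X ((faceDart f 0).1, 0) * ind X ((faceDart f 1).1, 1) *
    ind X ((faceDart f 2).1, 2) * ind X ((faceDart f 3).1, 3))
  ring

/-- A dart is one of the four `faceDart f d` exactly when f is its left face. This is how marked
half-edges come to be counted in the face on their left. -/
theorem prod_ind_faceDart (M : Finset Dart) (f : ℤ × ℤ) :
    ∏ d : Fin 4, ind M (faceDart f d) = ∏ m ∈ M, ind {f} m.leftFace := by
  simp only [ind_eq_prod M]
  rw [Finset.prod_comm]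
  refine Finset.prod_congr rfl fun m _ => ?_
  by_cases h : m.leftFace = f
  · have h₁ := eq_faceDart_iff.2 h
    rw [ind, if_pos (by simpa using h), Finset.prod_eq_single m.2]
    · rw [if_pos h₁]
    · intro d _ hd
      exact if_neg fun h' => hd (by rw [h']; rfl)
    · simp
  · rw [ind, if_neg (by simpa using h)]
    refine Finset.prod_eq_one fun d _ => if_neg ?_
    rintro rfl
    exact h (leftFace_faceDart f d)

/-- Effect of moving a configuration by the boundary of a set of faces on the sign with which the
product of its edge operators creates it. -/
theorem edgeProd_symmDiff_faceBoundary (hs : ∀ e, s e * s e = 1) (M : Finset Dart)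
    (F : Finset (Sym2 (ℤ × ℤ))) (φ : DartSpace) (g : ℤ)
    (hF : EvenAtVertices (symmDiff (dartSet F) M))
    (h : edgeProd s F φ = g • ket (symmDiff (dartSet F) M)) (U : Finset (ℤ × ℤ)) :
    edgeProd s (symmDiff F (faceBoundary U)) φ =
      (g * ((∏ f ∈ U, ∏ e ∈ faceEdges f, s e) * ∏ m ∈ M, ind U m.leftFace)) •
        ket (symmDiff (dartSet (symmDiff F (faceBoundary U))) M) := by
  induction U using Finset.induction_on with
  | empty =>
    have h₁ : symmDiff F (faceBoundary ∅) = F := by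
      rw [faceBoundary_empty]; exact symmDiff_bot F
    have h₂ : ∀ x : ℤ × ℤ, ind (∅ : Finset (ℤ × ℤ)) x = 1 := fun x => if_neg (by simp)
    simp only [h₁, h₂, Finset.prod_empty, Finset.prod_const_one, mul_one]
    exact h
  | insert f U hf ih =>
    -- The intermediate set F' may leave the domain, run through holes and contain the full edge of
    -- which a dart of M is one half. Hence all lattice edges have operators, and M enters by
    -- symmetric difference rather than union.
    set F' := symmDiff F (faceBoundary U) with hF'
    have hX : EvenAtVertices (symmDiff (dartSet F') M) := by
      rw [hF', dartSet_symmDiff, symmDiff_right_comm]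
      exact hF.symmDiff (evenAtVertices_dartSet (evenDegrees_faceBoundary U))
    have h₁ : symmDiff F (faceBoundary (insert f U)) = symmDiff F' (faceEdges f) := by
      rw [faceBoundary_insert hf, hF', symmDiff_assoc]
    have h₂ := congrArg (fun A : DartOp => A φ)
      (edgeProd_mul_edgeProd s hs (fun e he => isLatticeEdge_of_mem_faceEdges he) F'
        (T := faceEdges f))
    simp only [Module.End.mul_apply, LinearMap.smul_apply] at h₂
    rw [ih, map_smul, edgeProd_faceEdges_ket s f hX, smul_smul] at h₂
    have h₃ : (∏ e ∈ faceEdges f, ind F' e) * (∏ e ∈ faceEdges f, ind F' e) = 1 := by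
      rw [← Finset.prod_mul_distrib]
      exact Finset.prod_eq_one fun e _ => ind_mul_self F' e
    have h₄ := congrArg (fun v => (∏ e ∈ faceEdges f, ind F' e) • v) h₂
    simp only [smul_smul, h₃, one_smul] at h₄
    -- The signs of F' around f arise once from the action of the corners and once from multiplying
    -- the edge products. They cancel, leaving only the contribution of M.
    have h₅ : ∏ d : Fin 4, ind (symmDiff (dartSet F') M) (faceDart f d) =
        (∏ e ∈ faceEdges f, ind F' e) * ∏ m ∈ M, ind {f} m.leftFace := by
      simp only [ind_symmDiff, Finset.prod_mul_distrib]
      rw [prod_ind_faceDart M, prod_faceEdges]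
      simp only [ind_dartSet]
    have h₆ : ∀ y : ℤ × ℤ, ind (insert f U) y = ind U y * ind {f} y := by
      intro y
      simp only [ind, Finset.mem_insert, Finset.mem_singleton]
      by_cases hy : y = f
      · subst hy; simp [hf]
      · simp [hy]
    rw [h₅] at h₄
    rw [h₁, ← h₄, dartSet_symmDiff F', symmDiff_right_comm (dartSet F')]
    congr 1
    simp only [h₆, Finset.prod_mul_distrib, Finset.prod_insert hf]
    linear_combination (g * (∏ f ∈ U, ∏ e ∈ faceEdges f, s e) * (∏ m ∈ M, ind U m.leftFace) *
      (∏ e ∈ faceEdges f, s e) * (∏ m ∈ M, ind {f} m.leftFace)) * h₃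

end

section

/-! ### Even sets of edges are boundaries of sets of faces -/

/-- `-1` on the edges crossed by the horizontal ray from the centre of `f` to the east. -/
def raySign (f : ℤ × ℤ) (e : Sym2 (ℤ × ℤ)) : ℤ :=
  if ∃ m : ℤ, f.1 < m ∧ e = s((m, f.2), (m, f.2 + 1)) then -1 else 1

theorem raySign_sq (f : ℤ × ℤ) (e : Sym2 (ℤ × ℤ)) : raySign f e * raySign f e = 1 := by
  simp only [raySign]; split_ifs <;> rfl

theorem raySign_horizontal (f v : ℤ × ℤ) : raySign f (Dart.edge (v, 0)) = 1 := by
  refine if_neg ?_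
  rintro ⟨m, -, h⟩
  rcases Sym2.eq_iff.1 h with ⟨h₁, h₂⟩ | ⟨h₁, h₂⟩ <;>
    simp [Dart.target, step, Prod.ext_iff] at h₁ h₂ <;> omega

theorem edge_vertical_eq_iff {v : ℤ × ℤ} {m y : ℤ} :
    Dart.edge (v, 1) = s((m, y), (m, y + 1)) ↔ v = (m, y) := by
  constructor
  · intro h
    rcases Sym2.eq_iff.1 h with ⟨h₁, h₂⟩ | ⟨h₁, h₂⟩ <;>
      simp [Dart.target, step, Prod.ext_iff] at h₁ h₂ ⊢ <;> omega
  · rintro rfl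
    simp [Dart.edge, Dart.target, step]

theorem raySign_vertical (f v : ℤ × ℤ) :
    raySign f (Dart.edge (v, 1)) = if f.1 < v.1 ∧ v.2 = f.2 then -1 else 1 := by
  simp only [raySign, edge_vertical_eq_iff]
  refine if_congr ?_ rfl rfl
  constructor
  · rintro ⟨m, hm, rfl⟩; exact ⟨hm, rfl⟩
  · rintro ⟨h₁, h₂⟩; exact ⟨v.1, h₁, Prod.ext rfl h₂⟩

theorem edge_two (v : ℤ × ℤ) : Dart.edge (v, 2) = Dart.edge (v - (1, 0), 0) := by
  rw [← Dart.edge_rev]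
  congr 1

theorem edge_three (v : ℤ × ℤ) : Dart.edge (v, 3) = Dart.edge (v - (0, 1), 1) := by
  rw [← Dart.edge_rev]
  congr 1

/-- The ray meets both vertical sides of any face it crosses completely, but only the east side of
the face it starts from. -/
theorem prod_faceEdges_raySign (f g : ℤ × ℤ) :
    ∏ e ∈ faceEdges g, raySign f e = if g = f then -1 else 1 := by
  rw [prod_faceEdges, Fin.prod_univ_four]
  simp only [faceDart, edge_two, edge_three, raySign_horizontal, raySign_vertical]
  have : g = f ↔ g.1 = f.1 ∧ g.2 = f.2 := Prod.ext_iff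
  simp only [this]
  simp
  split_ifs <;> first | rfl | omega

theorem prod_faceBoundary_raySign (U : Finset (ℤ × ℤ)) (f : ℤ × ℤ) :
    ∏ e ∈ faceBoundary U, raySign f e = ind U f := by
  rw [prod_faceBoundary U _ (raySign_sq f), ind_eq_prod]
  exact Finset.prod_congr rfl fun g _ => prod_faceEdges_raySign f g

section Boundary

variable {T : Finset (Sym2 (ℤ × ℤ))}

/-- The sign of the number of edges of `T` crossed by the horizontal ray from the centre of `f` to
the east. -/
def rayParity (T : Finset (Sym2 (ℤ × ℤ))) (f : ℤ × ℤ) : ℤ := ∏ e ∈ T, raySign f e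

theorem rayParity_sq (f : ℤ × ℤ) : rayParity T f * rayParity T f = 1 := by
  rw [rayParity, ← Finset.prod_mul_distrib]
  exact Finset.prod_eq_one fun e _ => raySign_sq f e

theorem IsLatticeEdge.cases {e : Sym2 (ℤ × ℤ)} (h : IsLatticeEdge e) :
    ∃ v, e = Dart.edge (v, 0) ∨ e = Dart.edge (v, 1) := by
  obtain ⟨⟨v, d⟩, rfl⟩ := h
  fin_cases d
  · exact ⟨v, Or.inl rfl⟩
  · exact ⟨v, Or.inr rfl⟩
  · exact ⟨_, Or.inl (edge_two v)⟩
  · exact ⟨_, Or.inr (edge_three v)⟩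

/-- The rays from two horizontally adjacent faces differ by exactly the edge between them, so
evenness of T is not needed here. -/
theorem rayParity_mul_vertical (hT : ∀ e ∈ T, IsLatticeEdge e) (m y : ℤ) :
    rayParity T (m - 1, y) * rayParity T (m, y) = ind T (Dart.edge ((m, y), 1)) := by
  rw [rayParity, rayParity, ← Finset.prod_mul_distrib, ind_eq_prod]
  refine Finset.prod_congr rfl fun e he => ?_
  obtain ⟨v, rfl | rfl⟩ := (hT e he).cases
  · rw [raySign_horizontal, raySign_horizontal, if_neg]
    · rfl
    · intro h
      have := raySign_horizontal (m - 1, y) v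
      rw [h, raySign_vertical] at this
      simp at this
  · have : Dart.edge (v, 1) = Dart.edge ((m, y), 1) ↔ v.1 = m ∧ v.2 = y := by
      rw [Dart.edge_eq_iff, ← Prod.ext_iff (y := (m, y))]
      simp [Dart.rev]
    simp only [raySign_vertical, this]
    split_ifs <;> first | rfl | omega

theorem rayParity_eq_one_of_bound {N : ℤ}
    (hN : ∀ e ∈ T, ∀ v ∈ e, |v.1| < N ∧ |v.2| < N) (f : ℤ × ℤ)
    (hf : N ≤ f.1 ∨ N ≤ f.2 ∨ f.2 ≤ -N) : rayParity T f = 1 := by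
  refine Finset.prod_eq_one fun e he => if_neg ?_
  rintro ⟨m, hm, rfl⟩
  have h₁ := hN _ he (m, f.2) (Sym2.mem_mk_left _ _)
  simp only [abs_lt] at h₁
  omega

theorem ind_eq_one_of_bound {N : ℤ} (hN : ∀ e ∈ T, ∀ v ∈ e, |v.1| < N ∧ |v.2| < N) (x : Dart)
    (hx : N ≤ x.1.1 ∨ x.1.1 ≤ -N ∨ N ≤ x.1.2 ∨ x.1.2 ≤ -N) : ind T x.edge = 1 := by
  refine if_neg fun h => ?_
  have h₁ := hN _ h x.1 x.fst_mem_edge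
  simp only [abs_lt] at h₁
  omega

theorem exists_edge_bound (T : Finset (Sym2 (ℤ × ℤ))) :
    ∃ N : ℤ, 0 ≤ N ∧ ∀ e ∈ T, ∀ v ∈ e, |v.1| < N ∧ |v.2| < N := by
  refine ⟨∑ v ∈ T.biUnion fun e => Sym2.toFinset e, (|v.1| + |v.2| + 1),
    Finset.sum_nonneg fun v _ => by positivity, fun e he v hv => ?_⟩
  have h := Finset.single_le_sum (f := fun v : ℤ × ℤ => |v.1| + |v.2| + 1)
    (fun v _ => by positivity)
    (Finset.mem_biUnion.2 ⟨e, he, Sym2.mem_toFinset.2 hv⟩ :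
      v ∈ T.biUnion fun e => Sym2.toFinset e)
  have h₁ := abs_nonneg v.1
  have h₂ := abs_nonneg v.2
  constructor <;> omega

/-- Here evenness of T matters. Far to the east every term is trivial, and the identity is carried
west one vertex at a time. -/
theorem rayParity_mul_horizontal (hT : ∀ e ∈ T, IsLatticeEdge e) (hE : EvenDegrees T) (m y : ℤ) :
    rayParity T (m, y) * rayParity T (m, y - 1) = ind T (Dart.edge ((m, y), 0)) := by
  obtain ⟨N, -, hN⟩ := exists_edge_bound T
  rcases le_total m N with hm | hm
  · induction m, hm using Int.leInductionDown with
    | base =>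
      rw [rayParity_eq_one_of_bound hN _ (Or.inl le_rfl),
        rayParity_eq_one_of_bound hN _ (Or.inl le_rfl),
        ind_eq_one_of_bound hN _ (Or.inl le_rfl)]
      rfl
    | pred k hk ih =>
      have h₁ := rayParity_mul_vertical hT k y
      have h₂ := rayParity_mul_vertical hT k (y - 1)
      have h₃ := hE (k, y)
      rw [Fin.prod_univ_four, edge_two, edge_three] at h₃
      simp only [Prod.mk_sub_mk, sub_zero] at h₃
      have s₁ := rayParity_sq (T := T) (k, y)
      have s₂ := rayParity_sq (T := T) (k, y - 1)
      have s₃ := ind_mul_self T (Dart.edge ((k - 1, y), 0))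
      -- Evenness at (k, y) with the east and the two vertical edges rewritten as ray parities; the
      -- west edge can then be solved for.
      rw [← ih, ← h₁, ← h₂] at h₃
      generalize rayParity T (k, y) = p at *
      generalize rayParity T (k, y - 1) = q at *
      generalize rayParity T (k - 1, y) = p' at *
      generalize rayParity T (k - 1, y - 1) = q' at *
      generalize ind T (Dart.edge ((k - 1, y), 0)) = r at *
      have h₄ : p' * q' * r * (p * p) * (q * q) = 1 := by linear_combination h₃
      rw [s₁, s₂, mul_one, mul_one] at h₄
      linear_combination r * h₄ - p' * q' * s₃
  · rw [rayParity_eq_one_of_bound hN _ (Or.inl hm), rayParity_eq_one_of_bound hN _ (Or.inl hm),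
      ind_eq_one_of_bound hN _ (Or.inl hm)]
    rfl

/-- Rays from the far west do meet T, so the bound alone is not enough. The parity is trivial high
up and does not change on the way down, since no horizontal edge of T is crossed there. -/
theorem rayParity_eq_one_of_west (hT : ∀ e ∈ T, IsLatticeEdge e) (hE : EvenDegrees T) {N : ℤ}
    (hN : ∀ e ∈ T, ∀ v ∈ e, |v.1| < N ∧ |v.2| < N) {m : ℤ} (hm : m ≤ -N) (y : ℤ) :
    rayParity T (m, y) = 1 := by
  rcases le_total y N with hy | hy
  · induction y, hy using Int.leInductionDown with
    | base => exact rayParity_eq_one_of_bound hN _ (Or.inr (Or.inl le_rfl))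
    | pred k hk ih =>
      have h := rayParity_mul_horizontal hT hE m k
      rwa [ih, ind_eq_one_of_bound hN _ (Or.inr (Or.inl hm)), one_mul] at h
  · exact rayParity_eq_one_of_bound hN _ (Or.inr (Or.inl hy))

/-- The plane has no first homology modulo 2: the faces with odd ray parity fill T, because the
parities of two adjacent faces differ exactly across edges of T. -/
theorem exists_eq_faceBoundary (hT : ∀ e ∈ T, IsLatticeEdge e) (hE : EvenDegrees T) :
    ∃ U, T = faceBoundary U := by
  obtain ⟨N, -, hN⟩ := exists_edge_bound T
  -- The box only makes U finite; the bounds to the west and on the other three sides show that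
  -- parities outside it are even.
  set U : Finset (ℤ × ℤ) := (Finset.Icc (-N) N ×ˢ Finset.Icc (-N) N).filter
    fun f => rayParity T f = -1 with hU
  have hind : ∀ f, ind U f = rayParity T f := by
    intro f
    by_cases h : rayParity T f = -1
    · have : f ∈ U := by
        rw [hU, Finset.mem_filter, Finset.mem_product, Finset.mem_Icc, Finset.mem_Icc]
        refine ⟨?_, h⟩
        by_contra hf
        have : rayParity T f = 1 := by
          by_cases hw : f.1 ≤ -N
          · exact rayParity_eq_one_of_west hT hE hN hw f.2
          · exact rayParity_eq_one_of_bound hN f (by omega)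
        omega
      rw [ind, if_pos this, h]
    · have h₁ : f ∉ U := by simp [hU, h]
      have h₂ := mul_self_eq_one_iff.1 (rayParity_sq (T := T) f)
      rw [ind, if_neg h₁]
      tauto
  have key : ∀ e, IsLatticeEdge e → ind (faceBoundary U) e = ind T e := by
    intro e he
    obtain ⟨v, rfl | rfl⟩ := he.cases
    · rw [ind_faceBoundary, hind, hind, ← rayParity_mul_horizontal hT hE v.1 v.2]
      congr 2
      · simp [Dart.leftFace]
      · simp [Dart.rightFace, Dart.leftFace, Prod.ext_iff, sub_eq_add_neg]
    · rw [ind_faceBoundary, hind, hind, ← rayParity_mul_vertical hT v.1 v.2]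
      congr 2
      · simp [Dart.leftFace, Prod.ext_iff, sub_eq_add_neg]
      · simp [Dart.rightFace, Dart.leftFace, show (1 : Fin 4) + 3 = 0 from rfl]
  have mem : ∀ (X : Finset (Sym2 (ℤ × ℤ))) e, e ∈ X ↔ ind X e = -1 := by
    intro X e
    simp only [ind]; split_ifs <;> simp_all
  refine ⟨U, ?_⟩
  ext e
  constructor
  · intro h
    rw [mem, key e (hT e h), ← mem]; exact h
  · intro h
    rw [mem, ← key e (isLatticeEdge_of_mem_faceBoundary h), ← mem]; exact h

end Boundary

/-! ### Parities of closed walks -/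

/-- The edges occurring an odd number of times in a list. -/
def oddEdges (L : List (Sym2 (ℤ × ℤ))) : Finset (Sym2 (ℤ × ℤ)) :=
  L.toFinset.filter fun e => Odd (L.count e)

theorem prod_map_eq_prod_oddEdges (L : List (Sym2 (ℤ × ℤ))) (g : Sym2 (ℤ × ℤ) → ℤ)
    (hg : ∀ e, g e * g e = 1) : (L.map g).prod = ∏ e ∈ oddEdges L, g e := by
  rw [Finset.prod_list_map_count, oddEdges, Finset.prod_filter]
  refine Finset.prod_congr rfl fun e _ => ?_
  split_ifs with h
  · obtain ⟨k, hk⟩ := h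
    rw [hk, pow_succ, pow_mul, sq, hg, one_pow, one_mul]
  · obtain ⟨k, hk⟩ := Nat.not_odd_iff_even.1 h
    rw [hk, ← two_mul, pow_mul, sq, hg, one_pow]

/-- `-1` on the edges incident to `v`. -/
def incidenceSign (v : ℤ × ℤ) (e : Sym2 (ℤ × ℤ)) : ℤ := if v ∈ e then -1 else 1

theorem incidenceSign_sq (v : ℤ × ℤ) (e : Sym2 (ℤ × ℤ)) :
    incidenceSign v e * incidenceSign v e = 1 := by
  simp only [incidenceSign]; split_ifs <;> rfl

/-- The left side tests T in the four directions at v, the right side tests each edge of T for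
incidence with v. The second form can be evaluated along a walk. -/
theorem prod_ind_edge {T : Finset (Sym2 (ℤ × ℤ))} (hT : ∀ e ∈ T, IsLatticeEdge e) (v : ℤ × ℤ) :
    ∏ d : Fin 4, ind T (Dart.edge (v, d)) = ∏ e ∈ T, incidenceSign v e := by
  simp only [ind_eq_prod T]
  rw [Finset.prod_comm]
  refine Finset.prod_congr rfl fun e he => ?_
  obtain ⟨x, rfl⟩ := hT e he
  by_cases hv : v ∈ x.edge
  · obtain ⟨d, hd⟩ := Dart.exists_edge_eq_of_mem hv
    rw [incidenceSign, if_pos hv, Finset.prod_eq_single d, if_pos hd]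
    · intro d' _ hne
      refine if_neg fun h => ?_
      rcases Dart.edge_eq_iff.1 (hd.symm.trans h) with h | h
      · exact hne (Prod.ext_iff.1 h).2.symm
      · exact Dart.target_ne (v, d') (Prod.ext_iff.1 h).1.symm
    · simp
  · rw [incidenceSign, if_neg hv]
    refine Finset.prod_eq_one fun d _ => if_neg fun h => hv ?_
    rw [h]; exact Dart.fst_mem_edge (v, d)

theorem prod_edges_incidenceSign {G : SimpleGraph (ℤ × ℤ)} {u w : ℤ × ℤ} (p : G.Walk u w)
    (v : ℤ × ℤ) : (p.edges.map (incidenceSign v)).prod =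
      (if u = v then -1 else 1) * (if w = v then -1 else 1) := by
  induction p with
  | nil => simp; split_ifs <;> rfl
  | cons h p ih =>
    rename_i a b c
    rw [SimpleGraph.Walk.edges_cons, List.map_cons, List.prod_cons, ih]
    have : incidenceSign v s(a, b) = (if a = v then -1 else 1) * (if b = v then -1 else 1) := by
      have := h.ne
      simp only [incidenceSign, Sym2.mem_iff, eq_comm (a := v)]
      by_cases h₁ : a = v
      · subst h₁; simp [this.symm]
      · by_cases h₂ : b = v <;> simp [h₁, h₂]
    rw [this]
    split_ifs <;> rfl

theorem evenDegrees_oddEdges {G : SimpleGraph (ℤ × ℤ)} (hG : ∀ e ∈ G.edgeSet, IsLatticeEdge e)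
    {u : ℤ × ℤ} (p : G.Walk u u) : EvenDegrees (oddEdges p.edges) := by
  intro v
  rw [prod_ind_edge, ← prod_map_eq_prod_oddEdges _ _ (incidenceSign_sq v),
    prod_edges_incidenceSign]
  · split_ifs <;> rfl
  · intro e he
    exact hG e (p.edges_subset_edgeSet (List.mem_toFinset.1 (Finset.mem_filter.1 he).1))

end

section

/-! ### Graph of the domain -/

section Domain

variable {Ω : DiscreteDomain}

theorem DiscreteDomain.graph_adj_iff {v w : ℤ × ℤ} : Ω.graph.Adj v w ↔ s(v, w) ∈ Ω.innerEdges := by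
  rw [graph, SimpleGraph.fromEdgeSet_adj]
  constructor
  · exact fun h => h.1
  · intro h
    refine ⟨h, ?_⟩
    rintro rfl
    obtain ⟨x, hx⟩ := Ω.innerEdges_lattice _ h
    rcases Sym2.eq_iff.1 hx with ⟨h₁, h₂⟩ | ⟨h₁, h₂⟩
    · exact x.target_ne (h₂.symm.trans h₁)
    · exact x.target_ne (h₁.symm.trans h₂)

theorem DiscreteDomain.adj_target_iff {x : Dart} :
    Ω.graph.Adj x.1 x.target ↔ x.edge ∈ Ω.innerEdges :=
  graph_adj_iff

theorem DiscreteDomain.mem_verts_of_adj {v w : ℤ × ℤ} (h : Ω.graph.Adj v w) : v ∈ Ω.verts := by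
  have h' := graph_adj_iff.1 h
  obtain ⟨x, hx⟩ := Ω.innerEdges_lattice _ h'
  have hv : v ∈ x.edge := hx ▸ Sym2.mem_mk_left v w
  obtain ⟨d, hd⟩ := Dart.exists_edge_eq_of_mem hv
  exact Ω.vert_of_edge (v, d) (by rw [← hd, ← hx]; exact h')

theorem DiscreteDomain.edge_notMem_of_halfEdge {x : Dart} (hx : x ∈ Ω.halfEdges) :
    x.edge ∉ Ω.innerEdges := fun h => by
  rcases Ω.four_incident x (Ω.vert_of_halfEdge x hx) with h' | h'
  · exact h'.2 hx
  · exact h'.2 h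

theorem DiscreteDomain.edge_mem_of_rightFace {x : Dart} (hx : x.rightFace ∈ Ω.faces) :
    x.edge ∈ Ω.innerEdges := by
  rw [← Dart.leftFace_rev] at hx
  rw [← Dart.edge_rev]
  exact Ω.edge_of_face _ hx

theorem DiscreteDomain.mem_edgeSet {e : Sym2 (ℤ × ℤ)} :
    e ∈ Ω.graph.edgeSet ↔ e ∈ Ω.innerEdges := by
  induction e using Sym2.ind with
  | _ v w => exact graph_adj_iff

end Domain

/-! ### Sheets of a double cover -/

namespace DoubleCover

variable {Ω : DiscreteDomain} {C : DoubleCover Ω} (sec : ℤ × ℤ → C.Vert)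

/-- The sheet of a point of the double cover relative to a section `sec`. -/
def sheet (w : C.Vert) : ℤ := if w = sec (C.proj w) then 1 else -1

/-- The sign of an edge: `1` if it lifts to an edge connecting two points of the section. -/
def edgeSign (e : Sym2 (ℤ × ℤ)) : ℤ :=
  if ∃ u v, e = s(u, v) ∧ C.graph.Adj (sec u) (sec v) then 1 else -1

theorem sheet_sq (w : C.Vert) : sheet sec w * sheet sec w = 1 := by
  simp only [sheet]; split_ifs <;> rfl

theorem edgeSign_sq (e : Sym2 (ℤ × ℤ)) : edgeSign sec e * edgeSign sec e = 1 := by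
  simp only [edgeSign]; split_ifs <;> rfl

theorem edgeSign_mk (u v : ℤ × ℤ) :
    edgeSign sec s(u, v) = if C.graph.Adj (sec u) (sec v) then 1 else -1 := by
  refine if_congr ?_ rfl rfl
  constructor
  · rintro ⟨u', v', h, h'⟩
    rcases Sym2.eq_iff.1 h with ⟨rfl, rfl⟩ | ⟨rfl, rfl⟩
    · exact h'
    · exact h'.symm
  · exact fun h => ⟨u, v, rfl, h⟩

variable {sec}

theorem exists_section (C : DoubleCover Ω) :
    ∃ sec : ℤ × ℤ → C.Vert, ∀ v ∈ Ω.verts, C.proj (sec v) = v := by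
  have h : ∀ v ∈ Ω.verts, ∃ w, C.proj w = v := by
    intro v hv
    have h₂ := C.two_to_one v hv
    obtain ⟨w, hw⟩ := Set.nonempty_of_ncard_ne_zero (by rw [h₂]; decide)
    exact ⟨w, hw⟩
  obtain ⟨v₀, hv₀⟩ := Ω.nonempty
  obtain ⟨w₀, -⟩ := h v₀ hv₀
  exact ⟨fun v => if hv : v ∈ Ω.verts then (h v hv).choose else w₀, fun v hv => by
    simp only [dif_pos hv]; exact (h v hv).choose_spec⟩

theorem sheet_section (hsec : ∀ v ∈ Ω.verts, C.proj (sec v) = v) {v : ℤ × ℤ} (hv : v ∈ Ω.verts) :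
    sheet sec (sec v) = 1 := by
  rw [sheet, if_pos]; rw [hsec v hv]

/-- If neither point is on the section, both are the unique other point of the two-element fibre. -/
theorem eq_of_sheet_eq (hsec : ∀ v ∈ Ω.verts, C.proj (sec v) = v) {w w' : C.Vert}
    (hp : C.proj w = C.proj w') (hs : sheet sec w = sheet sec w') : w = w' := by
  simp only [sheet, ← hp] at hs
  split_ifs at hs with h₁ h₂ h₂
  · rw [h₁, h₂]
  · obtain ⟨a, b, -, hab⟩ := Set.ncard_eq_two.1 (C.two_to_one _ (C.proj_mem w))
    have m₁ : w ∈ ({a, b} : Set C.Vert) := hab ▸ (rfl : C.proj w = C.proj w)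
    have m₂ : w' ∈ ({a, b} : Set C.Vert) := hab ▸ hp.symm
    have m₃ : sec (C.proj w) ∈ ({a, b} : Set C.Vert) := hab ▸ hsec _ (C.proj_mem w)
    simp only [Set.mem_insert_iff, Set.mem_singleton_iff] at m₁ m₂ m₃
    rcases m₁ with m₁ | m₁ <;> rcases m₂ with m₂ | m₂ <;> rcases m₃ with m₃ | m₃ <;>
      simp_all

/-- Relative to a section the cover becomes a ℤ/2 gauge field: lifting is multiplication by edge
signs, and all lifting questions turn into products of signs. -/
theorem sheet_eq_of_adj (hsec : ∀ v ∈ Ω.verts, C.proj (sec v) = v) {w w' : C.Vert}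
    (h : C.graph.Adj w w') :
    sheet sec w' = sheet sec w * edgeSign sec s(C.proj w, C.proj w') := by
  have huv := C.proj_adj w w' h
  have hu := C.proj_mem w
  have hv := C.proj_mem w'
  have uniq : ∀ x y z : C.Vert, C.graph.Adj x y → C.graph.Adj x z → C.proj y = C.proj z →
      y = z := by
    intro x y z hy hz hp
    obtain ⟨t, -, ht⟩ := C.local_iso x (C.proj z) (C.proj_adj x z hz)
    rw [ht y ⟨hy, hp⟩, ht z ⟨hz, rfl⟩]
  rw [edgeSign_mk]
  by_cases h₁ : w = sec (C.proj w)
  · by_cases h₂ : w' = sec (C.proj w')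
    · rw [sheet, sheet, if_pos h₁, if_pos h₂, if_pos (by rw [← h₁, ← h₂]; exact h)]; rfl
    · rw [sheet, sheet, if_pos h₁, if_neg h₂, if_neg]
      · rfl
      · intro h'
        rw [← h₁] at h'
        exact h₂ (uniq _ _ _ h h' (hsec _ hv).symm)
  · by_cases h₂ : w' = sec (C.proj w')
    · rw [sheet, sheet, if_neg h₁, if_pos h₂, if_neg]
      · rfl
      · intro h'
        rw [← h₂] at h'
        exact h₁ (uniq _ _ _ h.symm h'.symm (hsec _ hu).symm)
    · rw [sheet, sheet, if_neg h₁, if_neg h₂, if_pos]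
      · rfl
      · obtain ⟨t, ⟨ht, hpt⟩, -⟩ := C.local_iso (sec (C.proj w)) (C.proj w')
          (by rw [hsec _ hu]; exact huv)
        by_cases h₃ : t = sec (C.proj w')
        · rw [← h₃]; exact ht
        -- Otherwise the edge lifted from the section point would also end at w', giving w' two
        -- distinct neighbours over the same vertex.
        · have h₄ : t = w' := eq_of_sheet_eq hsec hpt (by
            rw [sheet, sheet, if_neg h₂, if_neg (by rw [hpt]; exact h₃)])
          rw [h₄] at ht
          exact absurd (uniq _ _ _ h.symm ht.symm (hsec _ hu).symm) h₁

theorem adj_iff_sheet (hsec : ∀ v ∈ Ω.verts, C.proj (sec v) = v) {w w' : C.Vert}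
    (h : Ω.graph.Adj (C.proj w) (C.proj w')) :
    C.graph.Adj w w' ↔ sheet sec w' = sheet sec w * edgeSign sec s(C.proj w, C.proj w') := by
  refine ⟨sheet_eq_of_adj hsec, fun hs => ?_⟩
  obtain ⟨t, ⟨ht, hpt⟩, -⟩ := C.local_iso w _ h
  have h₁ := sheet_eq_of_adj hsec ht
  rw [hpt, ← hs] at h₁
  rwa [← eq_of_sheet_eq hsec hpt h₁]

theorem exists_adj_lift {w : C.Vert} {u v : ℤ × ℤ} (hw : C.proj w = u) (h : Ω.graph.Adj u v) :
    ∃ w', C.graph.Adj w w' ∧ C.proj w' = v := by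
  subst hw
  obtain ⟨t, ht, -⟩ := C.local_iso w v h
  exact ⟨t, ht⟩

/-- Lift the contour of the face edge by edge; `face_lifts` closes the lift, so the accumulated
sheet change is trivial. -/
theorem prod_faceEdges_edgeSign (hsec : ∀ v ∈ Ω.verts, C.proj (sec v) = v) {f : ℤ × ℤ}
    (hf : f ∈ Ω.faces) : ∏ e ∈ faceEdges f, edgeSign sec e = 1 := by
  have inner : ∀ d : Fin 4, Ω.graph.Adj (faceDart f d).1 (faceDart f d).target := fun d =>
    DiscreteDomain.adj_target_iff.2 (Ω.edge_of_face _ (by rwa [leftFace_faceDart]))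
  have v0 : (faceDart f 0).1 = f := by simp [faceDart]
  have v1 : (faceDart f 1).1 = f + (1, 0) := by simp [faceDart, Prod.ext_iff]
  have v2 : (faceDart f 2).1 = f + (1, 1) := by simp [faceDart, Prod.ext_iff]
  have v3 : (faceDart f 3).1 = f + (0, 1) := by simp [faceDart, Prod.ext_iff]
  have t0 : (faceDart f 0).target = f + (1, 0) := by simp [faceDart, Dart.target, step]
  have t1 : (faceDart f 1).target = f + (1, 1) := by
    simp [faceDart, Dart.target, step, Prod.ext_iff]
  have t2 : (faceDart f 2).target = f + (0, 1) := by
    simp [faceDart, Dart.target, step, Prod.ext_iff]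
  have t3 : (faceDart f 3).target = f := by
    simp [faceDart, Dart.target, step]
  have i0 := inner 0
  have i1 := inner 1
  have i2 := inner 2
  have i3 := inner 3
  rw [prod_faceEdges, Fin.prod_univ_four]
  simp only [Dart.edge]
  rw [v0, t0] at i0 ⊢
  rw [v1, t1] at i1 ⊢
  rw [v2, t2] at i2 ⊢
  rw [v3, t3] at i3 ⊢
  have hf' := hsec f (DiscreteDomain.mem_verts_of_adj i0)
  obtain ⟨w1, a1, p1⟩ := exists_adj_lift hf' i0
  obtain ⟨w2, a2, p2⟩ := exists_adj_lift p1 i1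
  obtain ⟨w3, a3, p3⟩ := exists_adj_lift p2 i2
  obtain ⟨w4, a4, p4⟩ := exists_adj_lift p3 i3
  have h := C.face_lifts f hf _ _ _ _ _ a1 a2 a3 a4 hf' p1 p2 p3 p4
  have s1 := sheet_eq_of_adj hsec a1
  have s2 := sheet_eq_of_adj hsec a2
  have s3 := sheet_eq_of_adj hsec a3
  have s4 := sheet_eq_of_adj hsec a4
  rw [s3, s2, s1, hf', p1, p2, p3, p4, h,
    sheet_section hsec (DiscreteDomain.mem_verts_of_adj i0)] at s4
  linarith

theorem sheet_eq_of_lift (hsec : ∀ v ∈ Ω.verts, C.proj (sec v) = v) {u v : ℤ × ℤ}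
    (p : Ω.graph.Walk u v) : ∀ (w w' : C.Vert) (q : C.graph.Walk w w'),
    q.support.map C.proj = p.support →
      sheet sec w' = sheet sec w * (p.edges.map (edgeSign sec)).prod ∧ C.proj w = u ∧
        C.proj w' = v := by
  induction p with
  | nil =>
    intro w w' q hq
    cases q with
    | nil => simpa using hq
    | cons h q => cases q <;> simp at hq
  | cons h p ih =>
    intro w w' q hq
    cases q with
    | nil => cases p <;> simp at hq
    | cons h' q =>
      rw [SimpleGraph.Walk.support_cons, SimpleGraph.Walk.support_cons, List.map_cons,
        List.cons.injEq] at hq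
      obtain ⟨h₁, h₂, h₃⟩ := ih _ _ q hq.2
      refine ⟨?_, hq.1, h₃⟩
      rw [h₁, sheet_eq_of_adj hsec h', hq.1, h₂, SimpleGraph.Walk.edges_cons, List.map_cons,
        List.prod_cons, mul_assoc]

theorem exists_lift {u v : ℤ × ℤ} (p : Ω.graph.Walk u v) : ∀ w : C.Vert, C.proj w = u →
    ∃ (w' : C.Vert) (q : C.graph.Walk w w'), q.support.map C.proj = p.support := by
  induction p with
  | nil => intro w hw; exact ⟨w, .nil, by simpa using hw⟩
  | cons h p ih =>
    intro w hw
    obtain ⟨t, ht, hpt⟩ := exists_adj_lift hw h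
    obtain ⟨w', q, hq⟩ := ih t hpt
    exact ⟨w', .cons ht q, by
      rw [SimpleGraph.Walk.support_cons, SimpleGraph.Walk.support_cons, List.map_cons, hq, hw]⟩

theorem liftsToLoop_iff (hsec : ∀ v ∈ Ω.verts, C.proj (sec v) = v) {v : ℤ × ℤ}
    (hv : v ∈ Ω.verts) (p : Ω.graph.Walk v v) :
    C.LiftsToLoop p ↔ (p.edges.map (edgeSign sec)).prod = 1 := by
  constructor
  · intro h
    obtain ⟨w', q, hq⟩ := exists_lift p (sec v) (hsec v hv)
    have h₁ := (sheet_eq_of_lift hsec p _ _ q hq).1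
    rw [← h _ _ q hq, sheet_section hsec hv, one_mul] at h₁
    exact h₁.symm
  · intro h w w' q hq
    obtain ⟨h₁, h₂, h₃⟩ := sheet_eq_of_lift hsec p _ _ q hq
    rw [h, mul_one] at h₁
    exact eq_of_sheet_eq hsec (h₂.trans h₃.symm) h₁.symm

end DoubleCover

end

section

open DoubleCover

variable {Ω : DiscreteDomain}

/-! ### Closed walks with prescribed parities -/

/-- For every edge of T make a round trip from a base vertex along fixed connecting paths. The path
to w is used as often as T has edges at w, an even number of times, so only T survives modulo 2. T
itself need not be connected. -/
theorem exists_closed_walk {T : Finset (Sym2 (ℤ × ℤ))} (hT : T ⊆ Ω.innerEdges)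
    (hE : EvenDegrees T) : ∃ v ∈ Ω.verts, ∃ p : Ω.graph.Walk v v,
      ∀ g : Sym2 (ℤ × ℤ) → ℤ, (∀ e, g e * g e = 1) → (p.edges.map g).prod = ∏ e ∈ T, g e := by
  obtain ⟨v₀, hv₀⟩ := Ω.nonempty
  refine ⟨v₀, hv₀, ?_⟩
  have hreach : ∀ u ∈ Ω.verts, Nonempty (Ω.graph.Walk v₀ u) := fun u hu => Ω.connected v₀ hv₀ u hu
  let L : ℤ × ℤ → List (Sym2 (ℤ × ℤ)) := fun u =>
    if hu : u ∈ Ω.verts then (hreach u hu).some.edges else []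
  have hL : ∀ u ∈ Ω.verts, ∃ q : Ω.graph.Walk v₀ u, q.edges = L u := fun u hu =>
    ⟨(hreach u hu).some, by simp only [L, dif_pos hu]⟩
  have key : ∃ p : Ω.graph.Walk v₀ v₀, ∀ g : Sym2 (ℤ × ℤ) → ℤ, (∀ e, g e * g e = 1) →
      (p.edges.map g).prod =
        ∏ e ∈ T, (g e * ∏ w ∈ Ω.verts, if w ∈ e then ((L w).map g).prod else 1) := by
    -- Evenness is not inherited by the subsets met in the induction; it is used only at the end, to
    -- cancel the connecting paths.
    clear hE
    induction T using Finset.induction_on with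
    | empty => exact ⟨.nil, fun g _ => by simp⟩
    | insert e T he ih =>
      obtain ⟨p, hp⟩ := ih fun x hx => hT (Finset.mem_insert_of_mem hx)
      have hin := hT (Finset.mem_insert_self e T)
      induction e using Sym2.ind with
      | _ u v =>
        have huv := DiscreteDomain.graph_adj_iff.2 hin
        have hu := DiscreteDomain.mem_verts_of_adj huv
        have hv := DiscreteDomain.mem_verts_of_adj huv.symm
        obtain ⟨q, hq⟩ := hL u hu
        obtain ⟨r, hr⟩ := hL v hv
        refine ⟨(q.append (.cons huv r.reverse)).append p, fun g hg => ?_⟩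
        have hw : (∏ w ∈ Ω.verts, if w ∈ s(u, v) then ((L w).map g).prod else 1) =
            ((L u).map g).prod * ((L v).map g).prod := by
          rw [← Finset.prod_filter]
          have : Ω.verts.filter (fun w => w ∈ s(u, v)) = {u, v} := by
            ext w
            simp only [Finset.mem_filter, Sym2.mem_iff, Finset.mem_insert, Finset.mem_singleton]
            constructor
            · exact fun h => h.2
            · rintro (rfl | rfl)
              · exact ⟨hu, Or.inl rfl⟩
              · exact ⟨hv, Or.inr rfl⟩
          rw [this, Finset.prod_pair huv.ne]
        rw [Finset.prod_insert he, hw, ← hp g hg, SimpleGraph.Walk.edges_append,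
          SimpleGraph.Walk.edges_append, SimpleGraph.Walk.edges_cons,
          SimpleGraph.Walk.edges_reverse, hq, hr, List.map_append, List.map_append, List.map_cons,
          List.map_reverse, List.prod_append, List.prod_append, List.prod_cons, List.prod_reverse]
        ring
  obtain ⟨p, hp⟩ := key
  refine ⟨p, fun g hg => ?_⟩
  rw [hp g hg, Finset.prod_mul_distrib, Finset.prod_comm, Finset.prod_eq_one (s := Ω.verts),
    mul_one]
  intro w _
  have hsq : ((L w).map g).prod * ((L w).map g).prod = 1 := by
    rw [prod_map_eq_prod_oddEdges _ g hg, ← Finset.prod_mul_distrib]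
    exact Finset.prod_eq_one fun e _ => hg e
  rcases mul_self_eq_one_iff.1 hsq with h | h
  · rw [h]; simp
  · rw [h]
    have := prod_ind_edge (fun e he => Ω.innerEdges_lattice e (hT he)) w
    rw [hE w] at this
    exact this.symm

/-! ### Holes -/

theorem neg_one_pow_rayCrossings {v w : ℤ × ℤ} (p : Ω.graph.Walk v w) (f : ℤ × ℤ) :
    (-1 : ℤ) ^ DiscreteDomain.rayCrossings p f = (p.edges.map (raySign f)).prod := by
  rw [DiscreteDomain.rayCrossings]
  induction p.edges with
  | nil => rfl
  | cons e L ih =>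
    rw [List.map_cons, List.prod_cons, ← ih, List.filter_cons, raySign]
    simp only [decide_eq_true_eq]
    split_ifs
    · rw [List.length_cons, pow_succ, mul_comm]
    · rw [one_mul]

theorem odd_iff_neg_one_pow {k : ℕ} : Odd k ↔ (-1 : ℤ) ^ k = -1 := by
  rcases Nat.even_or_odd k with h | h
  · rw [h.neg_one_pow]
    exact ⟨fun h' => absurd h (Nat.not_even_iff_odd.2 h'), fun h' => by norm_num at h'⟩
  · simp [h, h.neg_one_pow]

theorem mem_iff_ind {α : Type*} {X : Finset α} {x : α} : x ∈ X ↔ ind X x = -1 := by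
  simp only [ind]; split_ifs <;> simp_all

namespace DiscreteDomain.BoundaryComponent

/-- The faces of a hole. -/
def holeFaces (K : Ω.BoundaryComponent) (hK : K.IsInner) : Finset (ℤ × ℤ) :=
  (Set.Finite.toFinset (s := K.supp) hK).image Subtype.val

theorem mem_holeFaces {K : Ω.BoundaryComponent} {hK : K.IsInner} {f : ℤ × ℤ} :
    f ∈ K.holeFaces hK ↔ K.HasFace f := by
  simp only [holeFaces, Finset.mem_image, HasFace]
  constructor
  · rintro ⟨⟨f, hf⟩, h, rfl⟩; exact ⟨hf, (Set.Finite.mem_toFinset hK).1 h⟩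
  · rintro ⟨hf, h⟩; exact ⟨⟨f, hf⟩, (Set.Finite.mem_toFinset hK).2 h, rfl⟩

/-- Adjacent faces outside the domain lie in the same complementary component, so the boundary of a
hole consists of interior edges only. -/
theorem hasFace_congr {K : Ω.BoundaryComponent} {x : Dart} (hl : x.leftFace ∉ Ω.faces)
    (hr : x.rightFace ∉ Ω.faces) : K.HasFace x.leftFace ↔ K.HasFace x.rightFace := by
  have hadj : Ω.complementGraph.Adj ⟨_, hl⟩ ⟨_, hr⟩ := by
    rw [complementGraph, SimpleGraph.fromRel_adj]
    exact ⟨fun h => x.leftFace_ne_rightFace (congrArg Subtype.val h), Or.inl ⟨x, rfl, rfl⟩⟩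
  have := SimpleGraph.ConnectedComponent.connectedComponentMk_eq_of_adj hadj
  simp only [HasFace, SimpleGraph.ConnectedComponent.mem_supp_iff]
  constructor
  · rintro ⟨_, h⟩; exact ⟨hr, this ▸ h⟩
  · rintro ⟨_, h⟩; exact ⟨hl, this ▸ h⟩

end DiscreteDomain.BoundaryComponent

/-! ### Monodromy of the double cover around holes -/

section Monodromy

variable {C : DoubleCover Ω} {sec : ℤ × ℤ → C.Vert}

/-- The monodromy sign of the double cover around a face. -/
def faceMonodromy (sec : ℤ × ℤ → C.Vert) (f : ℤ × ℤ) : ℤ := ∏ e ∈ faceEdges f, edgeSign sec e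

theorem prod_faceMonodromy_sq (sec : ℤ × ℤ → C.Vert) (U : Finset (ℤ × ℤ)) :
    (∏ f ∈ U, faceMonodromy sec f) * ∏ f ∈ U, faceMonodromy sec f = 1 := by
  simp only [faceMonodromy, ← Finset.prod_mul_distrib]
  exact Finset.prod_eq_one fun f _ => Finset.prod_eq_one fun e _ => edgeSign_sq sec e

/-- By `prod_faceBoundary` the product over the faces of the hole reduces to edge signs along its
boundary. Values of `edgeSign` on edges inside the hole have no meaning for the cover, but each
occurs twice. -/
theorem branchesAround_iff (hsec : ∀ v ∈ Ω.verts, C.proj (sec v) = v) (K : Ω.BoundaryComponent)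
    (hK : K.IsInner) :
    C.BranchesAround K ↔ ∏ f ∈ K.holeFaces hK, faceMonodromy sec f = -1 := by
  constructor
  · rintro ⟨v, p, hp, hlift⟩
    have hG : ∀ e ∈ Ω.graph.edgeSet, IsLatticeEdge e := fun e he =>
      Ω.innerEdges_lattice e (DiscreteDomain.mem_edgeSet.1 he)
    obtain ⟨U, hU⟩ := exists_eq_faceBoundary (T := oddEdges p.edges) (fun e he =>
      hG e (p.edges_subset_edgeSet (List.mem_toFinset.1 (Finset.mem_filter.1 he).1)))
      (evenDegrees_oddEdges hG p)
    have hv : v ∈ Ω.verts := by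
      by_contra hv
      exact hlift fun w w' q hq =>
        absurd ((sheet_eq_of_lift hsec p _ _ q hq).2.1 ▸ C.proj_mem w) hv
    have hUmem : ∀ f, f ∈ U ↔ Odd (DiscreteDomain.rayCrossings p f) := by
      intro f
      rw [odd_iff_neg_one_pow, neg_one_pow_rayCrossings,
        prod_map_eq_prod_oddEdges _ _ (raySign_sq f), hU, prod_faceBoundary_raySign, mem_iff_ind]
    rw [liftsToLoop_iff hsec hv, prod_map_eq_prod_oddEdges _ _ (edgeSign_sq sec), hU,
      prod_faceBoundary _ _ (edgeSign_sq sec)] at hlift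
    have h₁ := (mul_self_eq_one_iff.1 (prod_faceMonodromy_sq sec U)).resolve_left hlift
    rw [← h₁]
    -- The faces surrounded by p are those of the hole plus some domain faces, and the latter have
    -- trivial monodromy.
    refine Finset.prod_subset ?_ ?_
    · intro f hf
      have hf' := DiscreteDomain.BoundaryComponent.mem_holeFaces.1 hf
      exact (hUmem f).2 ((hp f hf'.1).2 hf')
    · intro f hfU hf
      by_cases hfΩ : f ∈ Ω.faces
      · exact prod_faceEdges_edgeSign hsec hfΩ
      · exact absurd (DiscreteDomain.BoundaryComponent.mem_holeFaces.2
          ((hp f hfΩ).1 ((hUmem f).1 hfU))) hf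
  · intro h
    have hin : faceBoundary (K.holeFaces hK) ⊆ Ω.innerEdges := by
      intro e he
      obtain ⟨x, rfl⟩ := isLatticeEdge_of_mem_faceBoundary he
      rw [edge_mem_faceBoundary, DiscreteDomain.BoundaryComponent.mem_holeFaces,
        DiscreteDomain.BoundaryComponent.mem_holeFaces] at he
      by_contra hx
      have hl : x.leftFace ∉ Ω.faces := fun h => hx (Ω.edge_of_face _ h)
      have hr : x.rightFace ∉ Ω.faces := fun h => hx (DiscreteDomain.edge_mem_of_rightFace h)
      have := DiscreteDomain.BoundaryComponent.hasFace_congr (K := K) hl hr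
      tauto
    obtain ⟨v, hv, p, hp⟩ := exists_closed_walk hin (evenDegrees_faceBoundary _)
    refine ⟨v, p, fun f _ => ?_, ?_⟩
    · rw [odd_iff_neg_one_pow, neg_one_pow_rayCrossings, hp _ (raySign_sq f),
        prod_faceBoundary_raySign, ← mem_iff_ind, DiscreteDomain.BoundaryComponent.mem_holeFaces]
    · rw [liftsToLoop_iff hsec hv, hp _ (edgeSign_sq sec), prod_faceBoundary _ _ (edgeSign_sq sec)]
      intro h'
      exact absurd (h.symm.trans h') (by norm_num)

theorem prod_ind_eq_neg_one_pow {ι : Type*} [Fintype ι] (X : Finset (ℤ × ℤ)) (g : ι → ℤ × ℤ) :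
    ∏ i, ind X (g i) = (-1) ^ (Finset.univ.filter fun i => g i ∈ X).card := by
  rw [← Finset.prod_const, Finset.prod_filter]
  exact Finset.prod_congr rfl fun i _ => by simp only [ind]; congr

/-- If the double cover branches exactly around the holes with an odd number of marked points, its
monodromy around a union of faces and holes is the sign of the number of marked points there. -/
theorem prod_faceMonodromy_mul {n : ℕ} {P : MarkedPoints Ω n}
    (hC : ∀ K : Ω.BoundaryComponent, K.IsInner → (C.BranchesAround K ↔ Odd (P.countOn K)))
    (hsec : ∀ v ∈ Ω.verts, C.proj (sec v) = v) (U : Finset (ℤ × ℤ))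
    (hU : ∀ x : Dart, x.leftFace ∉ Ω.faces → x.rightFace ∉ Ω.faces →
      (x.leftFace ∈ U ↔ x.rightFace ∈ U)) :
    (∏ f ∈ U, faceMonodromy sec f) * ∏ i, ind U (P.pt i).leftFace = 1 := by
  -- Induction on the number of faces of U outside the domain, removing a whole hole at a time.
  induction hk : (U \ Ω.faces).card using Nat.strong_induction_on generalizing U with
  | _ k ih =>
    by_cases hne : ∃ f ∈ U, f ∉ Ω.faces
    · obtain ⟨f, hfU, hf⟩ := hne
      set K : Ω.BoundaryComponent := Ω.complementGraph.connectedComponentMk ⟨f, hf⟩ with hKdef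
      have hsub : ∀ g ∈ K.supp, g.1 ∈ U := by
        intro g hg
        rw [SimpleGraph.ConnectedComponent.mem_supp_iff, hKdef,
          SimpleGraph.ConnectedComponent.eq] at hg
        obtain ⟨p⟩ := hg.symm
        have : ∀ (a b : {f : ℤ × ℤ // f ∉ Ω.faces}) (p : Ω.complementGraph.Walk a b),
            a.1 ∈ U → b.1 ∈ U := by
          intro a b p
          induction p with
          | nil => exact id
          | cons h p ih =>
            intro ha
            refine ih ?_
            rename_i u v w
            rw [DiscreteDomain.complementGraph, SimpleGraph.fromRel_adj] at h
            rcases h.2 with ⟨x, h₁, h₂⟩ | ⟨x, h₁, h₂⟩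
            · rw [← h₁] at ha
              rw [← h₂]
              exact (hU x (h₁ ▸ u.2) (h₂ ▸ v.2)).1 ha
            · rw [← h₂] at ha
              rw [← h₁]
              exact (hU x (h₁ ▸ v.2) (h₂ ▸ u.2)).2 ha
        exact this _ _ p hfU
      -- A component meeting U is contained in the finite set U, so it is never the outer one.
      have hK : K.IsInner := by
        refine Set.Finite.of_finite_image (f := Subtype.val) ?_ Subtype.val_injective.injOn
        exact U.finite_toSet.subset fun y ⟨g, hg, hy⟩ => hy ▸ hsub g hg
      set H := K.holeFaces hK with hH
      have hHU : H ⊆ U := by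
        intro y hy
        obtain ⟨h₁, h₂⟩ := DiscreteDomain.BoundaryComponent.mem_holeFaces.1 hy
        exact hsub _ h₂
      have hfH : f ∈ H := DiscreteDomain.BoundaryComponent.mem_holeFaces.2 ⟨hf, rfl⟩
      have hcard : ((U \ H) \ Ω.faces).card < k := by
        rw [← hk]
        refine Finset.card_lt_card (Finset.ssubset_iff_subset_ne.2 ⟨?_, ?_⟩)
        · intro y hy
          simp only [Finset.mem_sdiff] at hy ⊢
          exact ⟨hy.1.1, hy.2⟩
        · intro h
          have : f ∈ U \ Ω.faces := Finset.mem_sdiff.2 ⟨hfU, hf⟩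
          rw [← h] at this
          simp [hfH] at this
      have h₁ := ih _ hcard (U \ H) (fun x hl hr => by
        rw [Finset.mem_sdiff, Finset.mem_sdiff, hU x hl hr, hH,
          DiscreteDomain.BoundaryComponent.mem_holeFaces,
          DiscreteDomain.BoundaryComponent.mem_holeFaces,
          DiscreteDomain.BoundaryComponent.hasFace_congr hl hr]) rfl
      have h₂ : ∏ i, ind H (P.pt i).leftFace = ∏ f ∈ H, faceMonodromy sec f := by
        have h₃ := hC K hK
        rw [branchesAround_iff hsec K hK, odd_iff_neg_one_pow] at h₃
        have h₄ : ∏ i, ind H (P.pt i).leftFace = (-1) ^ P.countOn K := by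
          rw [prod_ind_eq_neg_one_pow, MarkedPoints.countOn]
          congr 2
          ext i
          simp only [Finset.mem_filter, Finset.mem_univ, true_and, hH,
            DiscreteDomain.BoundaryComponent.mem_holeFaces]
          rfl
        rw [h₄]
        rcases mul_self_eq_one_iff.1 (prod_faceMonodromy_sq sec H) with h | h
        · rcases neg_one_pow_eq_or ℤ (P.countOn K) with h' | h'
          · rw [h, h']
          · have := h₃.2 h'
            rw [this, h']
        · rw [h]; exact h₃.1 h
      have h₅ : ∀ y, ind U y = ind (U \ H) y * ind H y := by
        intro y
        simp only [ind, Finset.mem_sdiff]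
        by_cases hy : y ∈ H
        · simp [hy, hHU hy]
        · simp [hy]
      simp only [h₅, Finset.prod_mul_distrib]
      rw [← Finset.prod_sdiff hHU, h₂]
      linear_combination (∏ f ∈ H, faceMonodromy sec f) * (∏ f ∈ H, faceMonodromy sec f) * h₁ +
        prod_faceMonodromy_sq sec H
    -- With domain faces only, monodromies are trivial and no marked half-edge counts: a dart with a
    -- domain face on its left lies on an interior edge.
    · push Not at hne
      rw [Finset.prod_eq_one, Finset.prod_eq_one, one_mul]
      · intro i _
        refine if_neg fun h => ?_
        exact DiscreteDomain.edge_notMem_of_halfEdge (P.pt_mem i) (Ω.edge_of_face _ (hne _ h))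
      · exact fun f hf => prod_faceEdges_edgeSign hsec (hne f hf)

end Monodromy

end

section

/-! ### Operators of sequences of visits -/

/-- The darts used by a sequence of visits. -/
def visitDarts (l : List Visit) : List Dart := l.flatMap fun x => [x.inDart, x.outDart]

theorem visitDarts_cons (x : Visit) (l : List Visit) :
    visitDarts (x :: l) = x.inDart :: x.outDart :: visitDarts l := rfl

theorem visitDarts_append (l l' : List Visit) :
    visitDarts (l ++ l') = visitDarts l ++ visitDarts l' := List.flatMap_append

namespace Visit

/-- The sign of a visit: `1` if the direction of departure follows that of arrival. -/
def sign (x : Visit) : ℤ := if x.din < x.dout then 1 else -1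

theorem sign_sq (x : Visit) : x.sign * x.sign = 1 := by
  simp only [sign]; split_ifs <;> rfl

/-- The curve arrives travelling in direction din + 2, so its turn is dout - din - 2 modulo 4. Which
representative is right depends on the order of din and dout, and this order is also the sign in the
operator of the visit. -/
theorem turn_eq {x : Visit} (h : x.din ≠ x.dout) :
    x.turn = (x.dout.val : ℤ) - x.din.val - 2 * x.sign := by
  obtain ⟨v, d, e⟩ := x
  have : ∀ d e : Fin 4, d ≠ e → (if e = d + 3 then (1 : ℤ) else if e = d + 1 then -1 else 0) =
      (e.val : ℤ) - d.val - 2 * if d < e then 1 else -1 := by decide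
  exact this d e h

/-- The signed operator of a visit. -/
def op (x : Visit) : DartOp := x.sign • pairOp x.inDart x.outDart

end Visit

/-- The Jordan–Wigner string between two unoccupied directions is trivial: for neighbours it is one
of them, for opposite directions the non-crossing hypothesis applies, and for 0 and 3 evenness at
the vertex does. -/
theorem prod_Ico_eq_one {a : Fin 4 → ℤ} (ha : ∏ d, a d = 1) {d e : Fin 4} (hde : d < e)
    (hd : a d = 1) (he : a e = 1) (hop : e = d + 2 → a (d + 1) = 1) :
    ∏ k ∈ Finset.Ico d e, a k = 1 := by
  rw [Fin.prod_univ_four] at ha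
  have i01 : Finset.Ico (0 : Fin 4) 1 = {0} := by decide
  have i02 : Finset.Ico (0 : Fin 4) 2 = {0, 1} := by decide
  have i03 : Finset.Ico (0 : Fin 4) 3 = {0, 1, 2} := by decide
  have i12 : Finset.Ico (1 : Fin 4) 2 = {1} := by decide
  have i13 : Finset.Ico (1 : Fin 4) 3 = {1, 2} := by decide
  have i23 : Finset.Ico (2 : Fin 4) 3 = {2} := by decide
  fin_cases d <;> fin_cases e <;> simp at hde hd he hop ⊢ <;>
    simp_all

theorem Visit.op_ket {x : Visit} {X : Finset Dart} (hX : EvenAtVertices X) (hne : x.din ≠ x.dout)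
    (hin : x.inDart ∉ X) (hout : x.outDart ∉ X)
    (hnc : x.dout = x.din + 2 → (x.vert, x.din + 1) ∉ X ∧ (x.vert, x.din + 3) ∉ X) :
    x.op (ket X) = ket (symmDiff X (symmDiff {x.inDart} {x.outDart})) := by
  have h₁ : ind X x.inDart = 1 := if_neg hin
  have h₂ : ind X x.outDart = 1 := if_neg hout
  obtain ⟨v, d, e⟩ := x
  simp only [Visit.inDart, Visit.outDart, Visit.op, Visit.sign] at *
  rcases lt_or_gt_of_ne hne with h | h
  · rw [if_pos h, one_smul, pairOp_ket_of_le v h.le, prod_Ico_eq_one (hX v) h h₁ h₂, one_smul]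
    exact fun he => if_neg (hnc he).1
  · rw [if_neg h.not_gt, pairOp_swap fun h' => hne (Prod.ext_iff.1 h').2, smul_neg, neg_smul,
      neg_neg, one_smul, pairOp_ket_of_le v h.le, prod_Ico_eq_one (hX v) h h₂ h₁, one_smul,
      symmDiff_comm {(v, e)}]
    intro he
    have h₃ : e = d + 2 := by rw [he]; clear * -; revert e; decide
    have h₄ : e + 1 = d + 3 := by rw [h₃]; clear * -; revert d; decide
    rw [h₄]
    exact if_neg (hnc h₃).2

theorem symmDiff_singleton_eq_insert {α : Type*} [DecidableEq α] {X : Finset α} {x y : α}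
    (hx : x ∉ X) (hy : y ∉ X) (hxy : x ≠ y) :
    symmDiff X (symmDiff {x} {y}) = insert x (insert y X) := by
  ext z
  simp only [Finset.mem_symmDiff, Finset.mem_singleton, Finset.mem_insert]
  by_cases h₁ : z = x
  · subst h₁; simp [hx, hxy]
  · by_cases h₂ : z = y
    · subst h₂; simp [hy, hxy.symm]
    · simp [h₁, h₂]

theorem evenAtVertices_pair (v : ℤ × ℤ) (d e : Fin 4) :
    EvenAtVertices (symmDiff {(v, d)} {(v, e)}) := by
  intro w
  simp only [ind_symmDiff, Finset.prod_mul_distrib]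
  have : ∀ d : Fin 4, ∏ k, ind {(v, d)} (w, k) = if w = v then -1 else 1 := by
    intro d
    by_cases hw : w = v
    · subst hw
      rw [Finset.prod_eq_single d, if_pos rfl]
      · exact if_pos (by simp)
      · intro k _ hk
        exact if_neg (by simpa using hk)
      · simp
    · rw [if_neg hw]
      exact Finset.prod_eq_one fun k _ => if_neg (by simp [hw])
  rw [this, this]
  split_ifs <;> rfl

/-- The visits are created one after another; evenness of what is already present persists because
each visit adds two darts at one vertex. -/
theorem prod_visit_op_ket {l : List Visit} (hl : (visitDarts l).Nodup)
    (hnc : ∀ x ∈ l, x.dout = x.din + 2 →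
      (x.vert, x.din + 1) ∉ visitDarts l ∧ (x.vert, x.din + 3) ∉ visitDarts l) :
    (l.map Visit.op).prod (ket ∅) = ket (visitDarts l).toFinset ∧
      EvenAtVertices (visitDarts l).toFinset := by
  induction l with
  | nil =>
    refine ⟨rfl, fun v => Finset.prod_eq_one fun d _ => if_neg ?_⟩
    simp [visitDarts]
  | cons x l ih =>
    rw [visitDarts_cons, List.nodup_cons, List.nodup_cons, List.mem_cons, not_or] at hl
    obtain ⟨⟨h₁, h₂⟩, h₃, h₄⟩ := hl
    simp only [visitDarts_cons, List.mem_cons, not_or] at hnc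
    obtain ⟨ih₁, ih₂⟩ := ih h₄ fun y hy hd =>
      ⟨(hnc y (Or.inr hy) hd).1.2.2, (hnc y (Or.inr hy) hd).2.2.2⟩
    have hset : (visitDarts (x :: l)).toFinset =
        symmDiff (visitDarts l).toFinset (symmDiff {x.inDart} {x.outDart}) := by
      rw [symmDiff_singleton_eq_insert (by simpa using h₂) (by simpa using h₃) h₁,
        visitDarts_cons, List.toFinset_cons, List.toFinset_cons]
    rw [hset]
    refine ⟨?_, ih₂.symmDiff (evenAtVertices_pair _ _ _)⟩
    rw [List.map_cons, List.prod_cons, Module.End.mul_apply, ih₁]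
    refine Visit.op_ket ih₂ (fun h => h₁ (Prod.ext rfl h)) (by simpa using h₂) (by simpa using h₃) ?_
    intro hd
    have := hnc x (Or.inl rfl) hd
    simp only [List.mem_toFinset]
    exact ⟨this.1.2.2, this.2.2.2⟩

/-! ### Links -/

/-- The pairs of darts connected by a curve between consecutive visits. -/
def visitLinks : List Visit → List (Dart × Dart)
  | [] => []
  | [_] => []
  | x :: y :: l => (x.outDart, y.inDart) :: visitLinks (y :: l)

/-- The pairs of darts connected by a closed curve between cyclically consecutive visits. -/
def loopLinks : List Visit → List (Dart × Dart)
  | [] => []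
  | x :: l => visitLinks (x :: l) ++
      [(((x :: l).getLast (List.cons_ne_nil x l)).outDart, x.inDart)]

/-- The darts occurring in a list of links. -/
def linkDarts (L : List (Dart × Dart)) : List Dart := L.flatMap fun p => [p.1, p.2]

theorem linkDarts_cons (p : Dart × Dart) (L : List (Dart × Dart)) :
    linkDarts (p :: L) = p.1 :: p.2 :: linkDarts L := rfl

theorem linkDarts_append (L L' : List (Dart × Dart)) :
    linkDarts (L ++ L') = linkDarts L ++ linkDarts L' := List.flatMap_append

theorem visitDarts_eq_linkDarts (x : Visit) (l : List Visit) :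
    visitDarts (x :: l) = x.inDart :: (linkDarts (visitLinks (x :: l)) ++
      [((x :: l).getLast (List.cons_ne_nil x l)).outDart]) := by
  induction l generalizing x with
  | nil => rfl
  | cons y l ih =>
    rw [visitDarts_cons, ih y, visitLinks, linkDarts_cons]
    rfl

theorem linkDarts_loopLinks_perm {l : List Visit} :
    (linkDarts (loopLinks l)).Perm (visitDarts l) := by
  cases l with
  | nil => exact List.Perm.refl _
  | cons x l =>
    rw [visitDarts_eq_linkDarts, loopLinks, linkDarts_append]
    have : linkDarts [(((x :: l).getLast (List.cons_ne_nil x l)).outDart, x.inDart)] =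
        [((x :: l).getLast (List.cons_ne_nil x l)).outDart] ++ [x.inDart] := rfl
    rw [this, ← List.append_assoc]
    exact List.perm_append_singleton _ _

variable (ω : Dart → Dart → ℤ)

/-- The weighted operator of a link. -/
def linkOp (p : Dart × Dart) : DartOp := ω p.1 p.2 • pairOp p.1 p.2

theorem prod_map_smul {α : Type*} (L : List α) (g : α → ℤ) (A : α → DartOp) :
    (L.map fun x => g x • A x).prod = (L.map g).prod • (L.map A).prod := by
  induction L with
  | nil => simp
  | cons x L ih =>
    simp only [List.map_cons, List.prod_cons, ih, smul_mul_assoc, mul_smul_comm, smul_smul,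
      mul_comm (g x)]

theorem prod_map_sq {α : Type*} (L : List α) (g : α → ℤ) (hg : ∀ x ∈ L, g x * g x = 1) :
    (L.map g).prod * (L.map g).prod = 1 := by
  rw [← List.prod_map_mul]
  exact List.prod_eq_one fun y hy => by
    obtain ⟨x, hx, rfl⟩ := List.mem_map.1 hy; exact hg x hx

/-- The product of the weights of the links. -/
def linkWeight (L : List (Dart × Dart)) : ℤ := (L.map fun p => ω p.1 p.2).prod

theorem linkWeight_append (L L' : List (Dart × Dart)) :
    linkWeight ω (L ++ L') = linkWeight ω L * linkWeight ω L' := by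
  simp [linkWeight]

/-- The product of the signs of the visits. -/
def visitWeight (l : List Visit) : ℤ := (l.map Visit.sign).prod

theorem visitWeight_sq (l : List Visit) : visitWeight l * visitWeight l = 1 :=
  prod_map_sq l _ fun x _ => x.sign_sq

theorem prod_visit_op (l : List Visit) :
    (l.map Visit.op).prod =
      visitWeight l • (l.map fun x => pairOp x.inDart x.outDart).prod :=
  prod_map_smul _ _ _

/-- Pure reassociation: in the product of (in, out) pairs, each out-generator is followed by the
in-generator of the next visit. -/
theorem prod_pairOp_visits (x : Visit) (l : List Visit) :
    ((x :: l).map fun x => pairOp x.inDart x.outDart).prod =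
      dartOp x.inDart * ((visitLinks (x :: l)).map fun p => pairOp p.1 p.2).prod *
        dartOp ((x :: l).getLast (List.cons_ne_nil x l)).outDart := by
  induction l generalizing x with
  | nil => simp [visitLinks, pairOp]
  | cons y l ih =>
    rw [List.map_cons, List.prod_cons, ih y, visitLinks, List.map_cons, List.prod_cons,
      List.getLast_cons (List.cons_ne_nil y l)]
    simp only [pairOp, mul_assoc]

theorem commute_prod_pairOp {z : Dart} {L : List (Dart × Dart)} (h : z ∉ linkDarts L) :
    Commute (dartOp z) (L.map fun p => pairOp p.1 p.2).prod := by
  refine Commute.list_prod_right _ _ fun A hA => ?_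
  obtain ⟨p, hp, rfl⟩ := List.mem_map.1 hA
  refine (pairOp_commute_dartOp ?_ ?_).symm
  · rintro rfl; exact h (List.mem_flatMap.2 ⟨p, hp, by simp⟩)
  · rintro rfl; exact h (List.mem_flatMap.2 ⟨p, hp, by simp⟩)

variable {ω}

theorem prod_linkOp {L : List (Dart × Dart)} (hL : ∀ p ∈ L, ω p.1 p.2 * ω p.1 p.2 = 1) :
    (L.map fun p => pairOp p.1 p.2).prod = linkWeight ω L • (L.map (linkOp ω)).prod := by
  have : (L.map (linkOp ω)).prod = linkWeight ω L • (L.map fun p => pairOp p.1 p.2).prod :=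
    prod_map_smul _ _ _
  rw [this, smul_smul, linkWeight, prod_map_sq L _ hL, one_smul]

/-- Links are bilinear in generators different from that of the first dart, so this one commutes
past them to join the last. The weights have square 1 and can be inserted at will. -/
theorem prod_visit_op_path {x : Visit} {l : List Visit}
    (hL : ∀ p ∈ visitLinks (x :: l), ω p.1 p.2 * ω p.1 p.2 = 1)
    (hl : (visitDarts (x :: l)).Nodup) :
    ((x :: l).map Visit.op).prod =
      (visitWeight (x :: l) * linkWeight ω (visitLinks (x :: l))) •
        (((visitLinks (x :: l)).map (linkOp ω)).prod *
          pairOp x.inDart ((x :: l).getLast (List.cons_ne_nil x l)).outDart) := by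
  rw [visitDarts_eq_linkDarts, List.nodup_cons] at hl
  have h := commute_prod_pairOp fun h => hl.1 (List.mem_append_left _ h)
  rw [prod_visit_op, prod_pairOp_visits, h.eq, prod_linkOp hL, mul_assoc, smul_mul_assoc, smul_smul]
  rfl

/-- Here the first and last generators form the closing link in reverse order; exchanging them is
the origin of the minus sign attached to every loop. -/
theorem prod_visit_op_loop {l : List Visit} (hne : l ≠ [])
    (hL : ∀ p ∈ loopLinks l, ω p.1 p.2 * ω p.1 p.2 = 1) (hl : (visitDarts l).Nodup) :
    (l.map Visit.op).prod = (-(visitWeight l * linkWeight ω (loopLinks l))) •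
      ((loopLinks l).map (linkOp ω)).prod := by
  cases l with
  | nil => exact absurd rfl hne
  | cons x l =>
    rw [prod_visit_op_path (ω := ω) (fun p hp => hL p (List.mem_append_left _ hp)) hl]
    rw [visitDarts_eq_linkDarts, List.nodup_cons] at hl
    have hne : x.inDart ≠ ((x :: l).getLast (List.cons_ne_nil x l)).outDart := fun h =>
      hl.1 (by rw [h]; simp)
    have hlast := hL _ (List.mem_append_right _ (List.mem_singleton_self _))
    simp only at hlast
    rw [pairOp_swap hne, loopLinks, linkWeight_append, List.map_append, List.prod_append, mul_neg,
      smul_neg, ← neg_smul]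
    simp only [List.map_cons, List.map_nil, List.prod_singleton, linkOp, linkWeight, mul_smul_comm,
      smul_smul]
    congr 1
    linear_combination (visitWeight (x :: l) * (List.map (fun p => ω p.1 p.2)
      (visitLinks (x :: l))).prod) * hlast

/-- The links of a family of loops and a path. -/
def allLinks (loops : List (List Visit)) (path : List Visit) : List (Dart × Dart) :=
  loops.flatMap loopLinks ++ visitLinks path

variable (ω) in
/-- The total sign of a family of loops and a path. -/
def totalSign (loops : List (List Visit)) (path : List Visit) : ℤ :=
  (loops.map fun l => -(visitWeight l * linkWeight ω (loopLinks l))).prod *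
    (visitWeight path * linkWeight ω (visitLinks path))

theorem prod_visit_op_all {loops : List (List Visit)} {x : Visit} {l : List Visit}
    (hne : ∀ l ∈ loops, l ≠ []) (hω : ∀ p ∈ allLinks loops (x :: l), ω p.1 p.2 * ω p.1 p.2 = 1)
    (hd : (visitDarts (loops.flatten ++ x :: l)).Nodup) :
    ((loops.flatten ++ x :: l).map Visit.op).prod = totalSign ω loops (x :: l) •
      (((allLinks loops (x :: l)).map (linkOp ω)).prod *
        pairOp x.inDart ((x :: l).getLast (List.cons_ne_nil x l)).outDart) := by
  induction loops with
  | nil =>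
    simp only [allLinks, totalSign, List.flatten_nil, List.nil_append, List.flatMap_nil,
      List.map_nil, List.prod_nil, one_mul] at *
    exact prod_visit_op_path hω hd
  | cons c loops ih =>
    rw [List.flatten_cons, List.append_assoc, visitDarts_append, List.nodup_append] at hd
    have hω' : ∀ p ∈ allLinks loops (x :: l), ω p.1 p.2 * ω p.1 p.2 = 1 := fun p hp => hω p (by
      simp only [allLinks, List.flatMap_cons, List.append_assoc, List.mem_append] at hp ⊢
      exact Or.inr hp)
    have hc : ∀ p ∈ loopLinks c, ω p.1 p.2 * ω p.1 p.2 = 1 := fun p hp => hω p (by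
      simp only [allLinks, List.flatMap_cons, List.append_assoc, List.mem_append]
      exact Or.inl hp)
    have h₁ := ih (fun l hl => hne l (List.mem_cons_of_mem _ hl)) hω' hd.2.1
    rw [List.flatten_cons, List.append_assoc, List.map_append, List.prod_append, h₁,
      prod_visit_op_loop (hne c List.mem_cons_self) hc hd.1]
    simp only [allLinks, totalSign, List.flatMap_cons, List.map_cons, List.prod_cons,
      List.append_assoc, List.map_append, List.prod_append, smul_mul_assoc, mul_smul_comm, smul_smul,
      mul_assoc]
    congr 1
    ring

end

section

open DoubleCover

/-! ### Marked points and links -/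

section Links

variable {Ω : DiscreteDomain} {C : DoubleCover Ω} {n : ℕ} {P : MarkedPoints Ω n}

namespace MarkedPoints

theorem arcStart_injective : Function.Injective P.arcStart := by
  intro s t h
  have := P.pt_injective h
  simp only [Fin.mk.injEq] at this
  exact Fin.ext (by omega)

theorem arcEnd_injective : Function.Injective P.arcEnd := by
  intro s t h
  have := P.pt_injective h
  simp only [Fin.mk.injEq] at this
  exact Fin.ext (by omega)

theorem arcStart_ne_arcEnd (s t : Fin n) : P.arcStart s ≠ P.arcEnd t := by
  intro h
  have := P.pt_injective h
  simp only [Fin.mk.injEq] at this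
  omega

theorem arcStart_ne_a (s : Fin n) : P.arcStart s ≠ P.a := by
  intro h
  have := congrArg Fin.val (P.pt_injective h)
  simp at this

theorem arcEnd_ne_a (s : Fin n) : P.arcEnd s ≠ P.a := by
  intro h
  have := congrArg Fin.val (P.pt_injective h)
  simp at this

theorem arcStart_ne_b (s : Fin n) : P.arcStart s ≠ P.b := by
  intro h
  have := congrArg Fin.val (P.pt_injective h)
  simp at this
  omega

theorem arcEnd_ne_b (s : Fin n) : P.arcEnd s ≠ P.b := by
  intro h
  have := congrArg Fin.val (P.pt_injective h)
  simp at this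
  omega

theorem a_ne_b : P.a ≠ P.b := by
  intro h
  have := congrArg Fin.val (P.pt_injective h)
  simp at this

theorem pt_cases (i : Fin (2 * n + 2)) :
    P.pt i = P.a ∨ P.pt i = P.b ∨ ∃ s, P.pt i = P.arcStart s ∨ P.pt i = P.arcEnd s := by
  obtain ⟨k, hk⟩ := i
  by_cases h₀ : k = 0
  · subst h₀; exact Or.inl rfl
  by_cases h₁ : k = 2 * n + 1
  · subst h₁; exact Or.inr (Or.inl rfl)
  refine Or.inr (Or.inr ⟨⟨(k - 1) / 2, by omega⟩, ?_⟩)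
  rcases Nat.even_or_odd k with h | h
  · right
    unfold arcEnd
    congr 2
    obtain ⟨m, rfl⟩ := h
    dsimp only
    omega
  · left
    unfold arcStart
    congr 2
    obtain ⟨m, rfl⟩ := h
    dsimp only
    omega

theorem edge_pt_notMem (i : Fin (2 * n + 2)) : (P.pt i).edge ∉ Ω.innerEdges :=
  DiscreteDomain.edge_notMem_of_halfEdge (P.pt_mem i)

theorem edge_arcStart_notMem (s : Fin n) : (P.arcStart s).edge ∉ Ω.innerEdges :=
  P.edge_pt_notMem _

theorem edge_arcEnd_notMem (s : Fin n) : (P.arcEnd s).edge ∉ Ω.innerEdges :=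
  P.edge_pt_notMem _

end MarkedPoints

open MarkedPoints

/-! ### Winding and sheet signs of links -/

theorem linkTurns_swap (ν : Arcs C P) (o i : Dart) : linkTurns ν i o = -linkTurns ν o i := by
  rw [linkTurns, linkTurns, ← Finset.sum_neg_distrib]
  refine Finset.sum_congr rfl fun s _ => ?_
  by_cases h₁ : o = P.arcStart s ∧ i = P.arcEnd s
  · rw [if_pos h₁, if_neg, if_pos ⟨h₁.2, h₁.1⟩]
    rintro ⟨h, -⟩
    exact P.arcStart_ne_arcEnd s s (h.symm.trans h₁.2)
  · by_cases h₂ : i = P.arcStart s ∧ o = P.arcEnd s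
    · rw [if_pos h₂, if_neg h₁, if_pos ⟨h₂.2, h₂.1⟩, neg_neg]
    · rw [if_neg h₂, if_neg h₁, if_neg fun h => h₁ ⟨h.2, h.1⟩, if_neg fun h => h₂ ⟨h.2, h.1⟩, neg_zero]

theorem linkTurns_arc (ν : Arcs C P) (s : Fin n) :
    linkTurns ν (P.arcStart s) (P.arcEnd s) = (ν s).turns := by
  rw [linkTurns, Finset.sum_eq_single s]
  · rw [if_pos ⟨rfl, rfl⟩]
  · intro t _ ht
    rw [if_neg fun h => ht (P.arcStart_injective h.1).symm,
      if_neg fun h => P.arcStart_ne_arcEnd _ _ h.1]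
  · simp

theorem linkTurns_of_inner (ν : Arcs C P) {o : Dart} (ho : o.edge ∈ Ω.innerEdges) (i : Dart) :
    linkTurns ν o i = 0 := by
  refine Finset.sum_eq_zero fun s _ => ?_
  rw [if_neg, if_neg]
  · rintro ⟨rfl, -⟩; exact P.edge_arcEnd_notMem s ho
  · rintro ⟨rfl, -⟩; exact P.edge_arcStart_notMem s ho

/-- The sign `± 1` comparing the winding of a link with the directions of its ends. -/
def linkSign (ν : Arcs C P) (o i : Dart) : ℤ :=
  if 8 ∣ linkTurns ν o i - ((i.2.val : ℤ) - o.2.val) - 2 then 1 else -1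

/-- The sign telling whether a link stays on the same sheet. -/
def linkSheet (sec : ℤ × ℤ → C.Vert) (ν : Arcs C P) (o i : Dart) : ℤ :=
  if o.edge ∈ Ω.innerEdges then edgeSign sec o.edge else
    ∏ s, if (o = P.arcStart s ∧ i = P.arcEnd s) ∨ (o = P.arcEnd s ∧ i = P.arcStart s) then
      sheet sec (ν s).src * sheet sec (ν s).dst else 1

/-- The total weight of a link. -/
def linkFactor (sec : ℤ × ℤ → C.Vert) (ν : Arcs C P) (o i : Dart) : ℤ :=
  linkSign ν o i * linkSheet sec ν o i

theorem linkSign_sq (ν : Arcs C P) (o i : Dart) : linkSign ν o i * linkSign ν o i = 1 := by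
  simp only [linkSign]; split_ifs <;> rfl

theorem linkSheet_sq (sec : ℤ × ℤ → C.Vert) (ν : Arcs C P) (o i : Dart) :
    linkSheet sec ν o i * linkSheet sec ν o i = 1 := by
  unfold linkSheet
  split_ifs
  · exact edgeSign_sq sec _
  · rw [← Finset.prod_mul_distrib]
    refine Finset.prod_eq_one fun s _ => ?_
    split_ifs
    · linear_combination sheet sec (ν s).dst * sheet sec (ν s).dst * sheet_sq sec (ν s).src +
        sheet_sq sec (ν s).dst
    · rfl

theorem linkFactor_sq (sec : ℤ × ℤ → C.Vert) (ν : Arcs C P) (o i : Dart) :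
    linkFactor sec ν o i * linkFactor sec ν o i = 1 := by
  rw [linkFactor]
  linear_combination linkSheet sec ν o i * linkSheet sec ν o i * linkSign_sq ν o i +
    linkSheet_sq sec ν o i

/-- A straight edge has no winding, while the direction numbers of its halves differ by ±2. -/
theorem linkSign_edge (ν : Arcs C P) {o : Dart} (ho : o.edge ∈ Ω.innerEdges) :
    linkSign ν o o.rev = dirSign o.2 := by
  rw [linkSign, linkTurns_of_inner ν ho]
  have : ∀ d : Fin 4, (if (8 : ℤ) ∣ 0 - (((d + 2 : Fin 4).val : ℤ) - d.val) - 2 then (1 : ℤ) else -1)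
      = dirSign d := by decide
  rw [← this]
  rfl

theorem linkSheet_edge (sec : ℤ × ℤ → C.Vert) (ν : Arcs C P) {o : Dart}
    (ho : o.edge ∈ Ω.innerEdges) (i : Dart) : linkSheet sec ν o i = edgeSign sec o.edge :=
  if_pos ho

theorem linkSheet_arc (sec : ℤ × ℤ → C.Vert) (ν : Arcs C P) (s : Fin n) :
    linkSheet sec ν (P.arcStart s) (P.arcEnd s) =
      sheet sec (ν s).src * sheet sec (ν s).dst := by
  rw [linkSheet, if_neg (P.edge_arcStart_notMem s), Finset.prod_eq_single s]
  · rw [if_pos (Or.inl ⟨rfl, rfl⟩)]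
  · intro t _ ht
    refine if_neg ?_
    rintro (h | h)
    · exact ht (P.arcStart_injective h.1).symm
    · exact P.arcStart_ne_arcEnd _ _ h.1
  · simp

theorem linkSheet_arc_symm (sec : ℤ × ℤ → C.Vert) (ν : Arcs C P) (s : Fin n) :
    linkSheet sec ν (P.arcEnd s) (P.arcStart s) =
      sheet sec (ν s).src * sheet sec (ν s).dst := by
  rw [linkSheet, if_neg (P.edge_arcEnd_notMem s), Finset.prod_eq_single s]
  · rw [if_pos (Or.inr ⟨rfl, rfl⟩)]
  · intro t _ ht
    refine if_neg ?_
    rintro (h | h)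
    · exact P.arcStart_ne_arcEnd _ _ h.1.symm
    · exact ht (P.arcEnd_injective h.1).symm
  · simp

theorem turns_emod (ν : Arcs C P) (s : Fin n) :
    8 ∣ (ν s).turns - (((P.arcEnd s).2.val : ℤ) - (P.arcStart s).2.val) - 2 ∨
      8 ∣ (ν s).turns - (((P.arcEnd s).2.val : ℤ) - (P.arcStart s).2.val) - 6 := by
  have h := (ν s).turns_spec.dvd
  omega

/-- The winding minus the direction difference is 2 or 6 modulo 8, and reversing the arc negates it.
-/
theorem linkSign_arc_symm (ν : Arcs C P) (s : Fin n) :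
    linkSign ν (P.arcEnd s) (P.arcStart s) = -linkSign ν (P.arcStart s) (P.arcEnd s) := by
  rw [linkSign, linkSign, linkTurns_swap, linkTurns_arc]
  have h := turns_emod ν s
  split_ifs <;> first | rfl | omega

variable {S : Config}

/-- The winding of a link determines its sign. -/
theorem linkTurns_emod (hS : S.1 ⊆ Ω.innerEdges) (ν : Arcs C P) {o i : Dart}
    (h : Linked P S o i) :
    8 ∣ linkTurns ν o i - ((i.2.val : ℤ) - o.2.val) - 2 * linkSign ν o i := by
  rcases h with ⟨ho, rfl⟩ | ⟨s, ⟨rfl, rfl⟩ | ⟨rfl, rfl⟩⟩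
  · rw [linkTurns_of_inner ν (hS ho), linkSign_edge ν (hS ho)]
    have : ∀ d : Fin 4, (8 : ℤ) ∣ 0 - (((d + 2 : Fin 4).val : ℤ) - d.val) - 2 * dirSign d := by
      decide
    exact this o.2
  · have h := turns_emod ν s
    rw [linkSign, linkTurns_arc]
    split_ifs <;> omega
  · have h := turns_emod ν s
    rw [linkSign, linkTurns_swap, linkTurns_arc]
    split_ifs <;> omega

theorem arc_lifts_iff {sec : ℤ × ℤ → C.Vert} (hsec : ∀ v ∈ Ω.verts, C.proj (sec v) = v)
    {p q : Dart} (ν : ArtificialArc C p q) (w w' : C.Vert) :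
    ν.Lifts w w' ↔ C.proj w = p.1 ∧ C.proj w' = q.1 ∧
      sheet sec w' = sheet sec w * (sheet sec ν.src * sheet sec ν.dst) := by
  rw [ArtificialArc.Lifts]
  refine and_congr_right fun hw => and_congr_right fun hw' => ?_
  have h₁ : w = ν.src ↔ sheet sec w = sheet sec ν.src :=
    ⟨fun h => by rw [h], fun h => eq_of_sheet_eq hsec (hw.trans ν.proj_src.symm) h⟩
  have h₂ : w' = ν.dst ↔ sheet sec w' = sheet sec ν.dst :=
    ⟨fun h => by rw [h], fun h => eq_of_sheet_eq hsec (hw'.trans ν.proj_dst.symm) h⟩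
  rw [h₁, h₂]
  rcases mul_self_eq_one_iff.1 (sheet_sq sec w) with a | a <;>
  rcases mul_self_eq_one_iff.1 (sheet_sq sec w') with b | b <;>
  rcases mul_self_eq_one_iff.1 (sheet_sq sec ν.src) with c | c <;>
  rcases mul_self_eq_one_iff.1 (sheet_sq sec ν.dst) with d | d <;>
  simp [a, b, c, d]

/-- Edges and arcs are treated uniformly: either kind of link lifts exactly according to its sheet
sign. -/
theorem linkLifts_iff (hS : S.1 ⊆ Ω.innerEdges) {sec : ℤ × ℤ → C.Vert}
    (hsec : ∀ v ∈ Ω.verts, C.proj (sec v) = v) (ν : Arcs C P) {o i : Dart}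
    (h : Linked P S o i) (w w' : C.Vert) :
    LinkLifts ν o i w w' ↔ C.proj w = o.1 ∧ C.proj w' = i.1 ∧
      sheet sec w' = sheet sec w * linkSheet sec ν o i := by
  rw [LinkLifts]
  have noadj : ∀ x : Dart, x.edge ∉ Ω.innerEdges → ∀ y, y = x.rev →
      ¬ (C.proj w = x.1 ∧ C.proj w' = y.1 ∧ C.graph.Adj w w') := by
    rintro x hx y rfl ⟨h₁, h₂, h₃⟩
    have h₄ := C.proj_adj _ _ h₃
    rw [h₁, h₂] at h₄
    exact hx (DiscreteDomain.adj_target_iff.1 h₄)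
  rcases h with ⟨ho, rfl⟩ | ⟨s, ⟨rfl, rfl⟩ | ⟨rfl, rfl⟩⟩
  · rw [linkSheet_edge sec ν (hS ho)]
    constructor
    · rintro (⟨-, h₁, h₂, h₃⟩ | ⟨s, ⟨rfl, -⟩ | ⟨rfl, -⟩⟩)
      · refine ⟨h₁, h₂, ?_⟩
        have := sheet_eq_of_adj hsec h₃
        rwa [h₁, h₂] at this
      · exact absurd (hS ho) (P.edge_arcStart_notMem s)
      · exact absurd (hS ho) (P.edge_arcEnd_notMem s)
    · rintro ⟨h₁, h₂, h₃⟩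
      refine Or.inl ⟨rfl, h₁, h₂, (adj_iff_sheet hsec ?_).2 ?_⟩
      · rw [h₁, h₂]; exact DiscreteDomain.adj_target_iff.2 (hS ho)
      · rw [h₁, h₂]; exact h₃
  · rw [linkSheet_arc, ← arc_lifts_iff hsec]
    constructor
    · rintro (⟨h₁, h₂⟩ | ⟨t, ⟨h₁, -, h₃⟩ | ⟨h₁, -⟩⟩)
      · exact absurd h₂ (noadj _ (P.edge_arcStart_notMem s) _ h₁)
      · obtain rfl := P.arcStart_injective h₁
        exact h₃
      · exact absurd h₁ (P.arcStart_ne_arcEnd _ _)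
    · exact fun h => Or.inr ⟨s, Or.inl ⟨rfl, rfl, h⟩⟩
  · have : (C.proj w = (P.arcEnd s).1 ∧ C.proj w' = (P.arcStart s).1 ∧
        sheet sec w' = sheet sec w * (sheet sec (ν s).src * sheet sec (ν s).dst)) ↔
        (ν s).Lifts w' w := by
      rw [arc_lifts_iff hsec]
      have h₁ := sheet_sq sec (ν s).src
      have h₂ := sheet_sq sec (ν s).dst
      constructor
      · rintro ⟨h₃, h₄, h₅⟩
        refine ⟨h₄, h₃, ?_⟩
        rw [h₅]
        linear_combination (-sheet sec w * (sheet sec (ν s).src * sheet sec (ν s).src)) * h₂ -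
          sheet sec w * h₁
      · rintro ⟨h₃, h₄, h₅⟩
        refine ⟨h₄, h₃, ?_⟩
        rw [h₅]
        linear_combination (-sheet sec w' * (sheet sec (ν s).src * sheet sec (ν s).src)) * h₂ -
          sheet sec w' * h₁
    rw [linkSheet_arc_symm, this]
    constructor
    · rintro (⟨h₁, h₂⟩ | ⟨t, ⟨h₁, -⟩ | ⟨h₁, -, h₃⟩⟩)
      · exact absurd h₂ (noadj _ (P.edge_arcEnd_notMem s) _ h₁)
      · exact absurd h₁.symm (P.arcStart_ne_arcEnd _ _)
      · obtain rfl := P.arcEnd_injective h₁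
        exact h₃
    · exact fun h => Or.inr ⟨s, Or.inr ⟨rfl, rfl, h⟩⟩

/-! ### The product of the operators of all links -/

/-- The edge or the arc underlying a link. -/
def linkKey (P : MarkedPoints Ω n) (p : Dart × Dart) : Sym2 (ℤ × ℤ) ⊕ Fin n :=
  if h : ∃ s, p.1 = P.arcStart s ∨ p.1 = P.arcEnd s then Sum.inr h.choose else Sum.inl p.1.edge

theorem linkKey_spec (hS : S.1 ⊆ Ω.innerEdges) {p : Dart × Dart} (h : Linked P S p.1 p.2) :
    (p.1.edge ∈ S.1 ∧ p.2 = p.1.rev ∧ linkKey P p = Sum.inl p.1.edge) ∨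
      ∃ s, linkKey P p = Sum.inr s ∧
        (p.1 = P.arcStart s ∧ p.2 = P.arcEnd s ∨ p.1 = P.arcEnd s ∧ p.2 = P.arcStart s) := by
  rcases h with ⟨ho, hi⟩ | ⟨s, hs⟩
  · refine Or.inl ⟨ho, hi, dif_neg ?_⟩
    rintro ⟨s, h | h⟩
    · exact P.edge_arcStart_notMem s (h ▸ hS ho)
    · exact P.edge_arcEnd_notMem s (h ▸ hS ho)
  · refine Or.inr ⟨s, ?_, hs⟩
    have hex : ∃ s, p.1 = P.arcStart s ∨ p.1 = P.arcEnd s := ⟨s, hs.imp And.left And.left⟩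
    rw [linkKey, dif_pos hex]
    congr 1
    rcases hex.choose_spec with h | h <;> rcases hs with h' | h'
    · exact P.arcStart_injective (h.symm.trans h'.1)
    · exact absurd (h.symm.trans h'.1) (P.arcStart_ne_arcEnd _ _)
    · exact absurd (h'.1.symm.trans h) (P.arcStart_ne_arcEnd _ _)
    · exact P.arcEnd_injective (h.symm.trans h'.1)

/-- The operator of an edge or an arc. -/
def keyOp (sec : ℤ × ℤ → C.Vert) (ν : Arcs C P) : Sym2 (ℤ × ℤ) ⊕ Fin n → DartOp :=
  Sum.elim (edgeOp (edgeSign sec))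
    fun s => linkOp (linkFactor sec ν) (P.arcStart s, P.arcEnd s)

/-- On reversing a link, both `linkSign` and `pairOp` change sign while the sheet factor does not.
So the weighted operator forgets the direction in which the curve runs. -/
theorem linkOp_eq_keyOp (hS : S.1 ⊆ Ω.innerEdges) (sec : ℤ × ℤ → C.Vert) (ν : Arcs C P)
    {p : Dart × Dart} (h : Linked P S p.1 p.2) :
    linkOp (linkFactor sec ν) p = keyOp sec ν (linkKey P p) := by
  obtain ⟨o, i⟩ := p
  rcases linkKey_spec hS h with ⟨ho, hi, hk⟩ | ⟨s, hk, ⟨ho, hi⟩ | ⟨ho, hi⟩⟩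
  · simp only at ho hi hk
    subst hi
    rw [hk]
    show linkOp _ _ = edgeOp _ _
    rw [edgeOp_edge, linkOp, dartEdgeOp, linkFactor, linkSign_edge ν (hS ho),
      linkSheet_edge sec ν (hS ho), mul_comm]
  · simp only at ho hi hk
    rw [hk, ho, hi]; rfl
  · simp only at ho hi hk
    rw [hk, ho, hi]
    show linkOp _ _ = linkOp _ _
    simp only [linkOp, linkFactor]
    rw [linkSign_arc_symm, linkSheet_arc, linkSheet_arc_symm,
      pairOp_swap (P.arcStart_ne_arcEnd s s).symm, smul_neg, ← neg_smul]
    congr 1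
    ring

theorem keyOp_commute (sec : ℤ × ℤ → C.Vert) (ν : Arcs C P) (k k' : Sym2 (ℤ × ℤ) ⊕ Fin n)
    (hk : ∀ e, k = Sum.inl e → e ∈ Ω.innerEdges) (hk' : ∀ e, k' = Sum.inl e → e ∈ Ω.innerEdges) :
    Commute (keyOp sec ν k) (keyOp sec ν k') := by
  have edge_arc : ∀ e ∈ Ω.innerEdges, ∀ s : Fin n,
      Commute (edgeOp (edgeSign sec) e) (linkOp (linkFactor sec ν) (P.arcStart s, P.arcEnd s)) := by
    intro e he s
    refine Commute.smul_right (edgeOp_commute_pairOp _ ?_ ?_) _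
    · rintro rfl; exact P.edge_arcStart_notMem s he
    · rintro rfl; exact P.edge_arcEnd_notMem s he
  rcases k with e | s <;> rcases k' with e' | s'
  · exact edgeOp_commute _ e e'
  · exact edge_arc e (hk e rfl) s'
  · exact (edge_arc e' (hk' e' rfl) s).symm
  · by_cases h : s = s'
    · rw [h]
    · exact Commute.smul_left (Commute.smul_right (pairOp_commute
        (fun h' => h (P.arcStart_injective h')) (P.arcStart_ne_arcEnd _ _).symm
        (P.arcStart_ne_arcEnd _ _) (fun h' => h (P.arcEnd_injective h'))) _) _

/-- The product of the operators of all artificial arcs. -/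
def arcProd (sec : ℤ × ℤ → C.Vert) (ν : Arcs C P) : DartOp :=
  ((Finset.univ : Finset (Fin n)).toList.map
    fun s => linkOp (linkFactor sec ν) (P.arcStart s, P.arcEnd s)).prod

/-- Two links with the same key would share a dart, contradicting `hnd`. Every edge of S and every
arc occurs because its darts do, a and b being halves of neither. -/
theorem linkKeys_perm (hS : S.1 ⊆ Ω.innerEdges) (hS₂ : S.2 = Finset.univ.image P.pt)
    {L : List (Dart × Dart)} (hL : ∀ p ∈ L, Linked P S p.1 p.2) (hnd : (linkDarts L).Nodup)
    (hmem : ∀ x, S.Occupied x → x ≠ P.a → x ≠ P.b → x ∈ linkDarts L) :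
    (L.map (linkKey P)).Perm
      (S.1.toList.map Sum.inl ++ (Finset.univ : Finset (Fin n)).toList.map Sum.inr) := by
  refine (List.perm_ext_iff_of_nodup ?_ ?_).2 ?_
  · clear hmem
    induction L with
    | nil => simp
    | cons p L ih =>
      rw [linkDarts_cons, List.nodup_cons, List.nodup_cons] at hnd
      rw [List.map_cons, List.nodup_cons]
      refine ⟨fun h => ?_, ih (fun q hq => hL q (List.mem_cons_of_mem _ hq)) hnd.2.2⟩
      obtain ⟨q, hq, hpq⟩ := List.mem_map.1 h
      have hp := linkKey_spec hS (hL p List.mem_cons_self)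
      have hq' := linkKey_spec hS (hL q (List.mem_cons_of_mem _ hq))
      have : p.1 = q.1 ∨ p.1 = q.2 := by
        rcases hp with ⟨-, -, hp⟩ | ⟨s, hp, hp'⟩ <;> rcases hq' with ⟨-, hq₂, hq⟩ | ⟨t, hq, hq'⟩ <;>
          rw [hp, hq] at hpq
        · rw [hq₂]
          exact Dart.edge_eq_iff.1 (Sum.inl.inj hpq).symm
        · cases hpq
        · cases hpq
        · obtain rfl := Sum.inr.inj hpq
          rcases hp' with h | h <;> rcases hq' with h' | h'
          · exact Or.inl (h.1.trans h'.1.symm)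
          · exact Or.inr (h.1.trans h'.2.symm)
          · exact Or.inr (h.1.trans h'.2.symm)
          · exact Or.inl (h.1.trans h'.1.symm)
      refine hnd.1 (List.mem_cons_of_mem _ (List.mem_flatMap.2 ⟨q, hq, ?_⟩))
      simpa using this
  · refine List.nodup_append.2 ⟨(Finset.nodup_toList _).map Sum.inl_injective,
      (Finset.nodup_toList _).map Sum.inr_injective, ?_⟩
    intro k hk k' hk'
    obtain ⟨e, -, rfl⟩ := List.mem_map.1 hk
    obtain ⟨s, -, rfl⟩ := List.mem_map.1 hk'
    simp
  · intro k
    simp only [List.mem_map, List.mem_append, Finset.mem_toList, Finset.mem_univ, true_and]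
    constructor
    · rintro ⟨p, hp, rfl⟩
      rcases linkKey_spec hS (hL p hp) with ⟨h, -, hk⟩ | ⟨s, hk, -⟩
      · exact Or.inl ⟨_, h, hk.symm⟩
      · exact Or.inr ⟨_, hk.symm⟩
    · rintro (⟨e, he, rfl⟩ | ⟨s, rfl⟩)
      · obtain ⟨x, rfl⟩ := Ω.innerEdges_lattice e (hS he)
        obtain ⟨p, hp, hx⟩ := List.mem_flatMap.1 (hmem x (Or.inl he)
          (fun h => P.edge_pt_notMem 0 (by rw [h] at he; exact hS he))
          (fun h => P.edge_pt_notMem (Fin.last _) (by rw [h] at he; exact hS he)))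
        simp only [List.mem_cons, List.not_mem_nil, or_false] at hx
        refine ⟨p, hp, ?_⟩
        rcases linkKey_spec hS (hL p hp) with ⟨-, h₂, hk⟩ | ⟨s, -, h⟩
        · rw [hk]
          rcases hx with rfl | rfl
          · rfl
          · rw [h₂, Dart.edge_rev]
        · exfalso
          have hi := hS he
          have h₁ := P.edge_arcStart_notMem s
          have h₂ := P.edge_arcEnd_notMem s
          rcases h with ⟨h, h'⟩ | ⟨h, h'⟩ <;> rcases hx with rfl | rfl <;> simp_all
      · obtain ⟨p, hp, hx⟩ := List.mem_flatMap.1 (hmem (P.arcStart s)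
          (Or.inr (by rw [hS₂]; exact Finset.mem_image_of_mem _ (Finset.mem_univ _)))
          (P.arcStart_ne_a s) (P.arcStart_ne_b s))
        simp only [List.mem_cons, List.not_mem_nil, or_false] at hx
        refine ⟨p, hp, ?_⟩
        rcases linkKey_spec hS (hL p hp) with ⟨h₁, h₂, hk⟩ | ⟨t, hk, h⟩
        · exfalso
          refine P.edge_arcStart_notMem s ?_
          rcases hx with hx | hx
          · rw [hx]; exact hS h₁
          · rw [hx, h₂, Dart.edge_rev]; exact hS h₁
        · rw [hk]
          congr 1
          rcases h with ⟨h, h'⟩ | ⟨h, h'⟩ <;> rcases hx with hx | hx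
          · exact (P.arcStart_injective (hx.trans h)).symm
          · exact absurd (hx.trans h') (P.arcStart_ne_arcEnd _ _)
          · exact absurd (hx.trans h) (P.arcStart_ne_arcEnd _ _)
          · exact (P.arcStart_injective (hx.trans h')).symm

theorem prod_linkOp_eq (hS : S.1 ⊆ Ω.innerEdges) (hS₂ : S.2 = Finset.univ.image P.pt)
    (sec : ℤ × ℤ → C.Vert) (ν : Arcs C P)
    {L : List (Dart × Dart)} (hL : ∀ p ∈ L, Linked P S p.1 p.2) (hnd : (linkDarts L).Nodup)
    (hmem : ∀ x, S.Occupied x → x ≠ P.a → x ≠ P.b → x ∈ linkDarts L) :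
    (L.map (linkOp (linkFactor sec ν))).prod =
      edgeProd (edgeSign sec) S.1 * arcProd sec ν := by
  have h₁ : L.map (linkOp (linkFactor sec ν)) = (L.map (linkKey P)).map (keyOp sec ν) := by
    rw [List.map_map]
    exact List.map_congr_left fun p hp => linkOp_eq_keyOp hS sec ν (hL p hp)
  have hperm := linkKeys_perm hS hS₂ hL hnd hmem
  have hin : ∀ k ∈ L.map (linkKey P), ∀ e, k = Sum.inl e → e ∈ Ω.innerEdges := by
    rintro k hk e rfl
    have := hperm.mem_iff.1 hk
    simp only [List.mem_append, List.mem_map, Finset.mem_toList, Sum.inl.injEq, exists_eq_right,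
      reduceCtorEq, and_false, exists_false, or_false] at this
    exact hS this
  rw [h₁, (hperm.map (keyOp sec ν)).prod_eq', List.map_append, List.prod_append, List.map_map,
    List.map_map]
  · rfl
  · rw [List.pairwise_map]
    refine List.Pairwise.imp_of_mem (R := fun _ _ => True) ?_
      (List.pairwise_of_forall fun _ _ => trivial)
    intro k k' hk hk' _
    exact keyOp_commute sec ν k k' (hin k hk) (hin k' hk')

end Links

end

section

open DoubleCover MarkedPoints

variable {Ω : DiscreteDomain} {C : DoubleCover Ω} {n : ℕ} {P : MarkedPoints Ω n} {S : Config}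

/-! ### The sign of a decomposition -/

theorem linked_of_mem_visitLinks {l : List Visit}
    (h : l.IsChain fun x y => Linked P S x.outDart y.inDart) :
    ∀ p ∈ visitLinks l, Linked P S p.1 p.2 := by
  induction l with
  | nil => intro p hp; simp [visitLinks] at hp
  | cons x l ih =>
    cases l with
    | nil => intro p hp; simp [visitLinks] at hp
    | cons y l =>
      rw [List.isChain_cons_cons] at h
      intro p hp
      rcases List.mem_cons.1 hp with rfl | hp
      · exact h.1
      · exact ih h.2 p hp

theorem linked_of_mem_loopLinks {l : List Visit}
    (h : l.IsChain fun x y => Linked P S x.outDart y.inDart)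
    (hc : ∀ x ∈ l.head?, ∀ y ∈ l.getLast?, Linked P S y.outDart x.inDart) :
    ∀ p ∈ loopLinks l, Linked P S p.1 p.2 := by
  cases l with
  | nil => intro p hp; simp [loopLinks] at hp
  | cons x l =>
    intro p hp
    rcases List.mem_append.1 hp with hp | hp
    · exact linked_of_mem_visitLinks h p hp
    · rw [List.mem_singleton.1 hp]
      exact hc x rfl _ (List.getLast?_eq_some_getLast (List.cons_ne_nil x l))

/-- The set of occupied darts of a configuration. -/
def Config.darts (S : Config) : Finset Dart := symmDiff (dartSet S.1) S.2

theorem mem_conf {P : MarkedPoints Ω n} (hS : S ∈ P.conf) :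
    S.1 ⊆ Ω.innerEdges ∧ S.2 = Finset.univ.image P.pt := by
  simp only [MarkedPoints.conf, DiscreteDomain.conf, Finset.mem_filter, Finset.mem_product,
    Finset.mem_powerset] at hS
  exact ⟨hS.1.1.1, hS.2⟩

theorem mem_darts_iff (hS : S ∈ P.conf) (x : Dart) : x ∈ S.darts ↔ S.Occupied x := by
  obtain ⟨h₁, h₂⟩ := mem_conf hS
  rw [Config.darts, Finset.mem_symmDiff, mem_dartSet, Config.Occupied]
  have : x ∈ S.2 → x.edge ∉ S.1 := by
    rw [h₂, Finset.mem_image]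
    rintro ⟨i, -, rfl⟩ h
    exact P.edge_pt_notMem i (h₁ h)
  tauto

namespace Decomposition

variable (D : Decomposition P S)

/-- The total sign of a decomposition. -/
def totalSign (D : Decomposition P S) (sec : ℤ × ℤ → C.Vert) (ν : Arcs C P) : ℤ :=
  IsingSpinor.totalSign (linkFactor sec ν) D.loops D.path

theorem path_eq_cons : ∃ x l, D.path = x :: l ∧ x.inDart = P.a ∧
    ((x :: l).getLast (List.cons_ne_nil x l)).outDart = P.b := by
  have h₁ := D.path_start
  have h₂ := D.path_end
  cases h : D.path with
  | nil => rw [h] at h₁; simp at h₁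
  | cons x l =>
    rw [h] at h₁ h₂
    refine ⟨x, l, rfl, by simpa using h₁, ?_⟩
    rw [List.getLast?_eq_some_getLast (List.cons_ne_nil x l)] at h₂
    simpa using h₂

theorem visitDarts_perm : (visitDarts (D.loops.flatten ++ D.path)).Perm
    (visitDarts (D.path ++ D.loops.flatten)) :=
  List.Perm.flatMap_right _ List.perm_append_comm

theorem visitDarts_nodup : (visitDarts (D.loops.flatten ++ D.path)).Nodup :=
  D.visitDarts_perm.nodup_iff.2 D.darts_nodup

theorem mem_visitDarts (x : Dart) :
    x ∈ visitDarts (D.loops.flatten ++ D.path) ↔ S.Occupied x :=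
  D.visitDarts_perm.mem_iff.trans (D.mem_darts x)

theorem linked_of_mem_allLinks : ∀ p ∈ allLinks D.loops D.path, Linked P S p.1 p.2 := by
  intro p hp
  rcases List.mem_append.1 hp with hp | hp
  · obtain ⟨l, hl, hp⟩ := List.mem_flatMap.1 hp
    exact linked_of_mem_loopLinks (D.loops_chain l hl) (D.loops_closed l hl) p hp
  · exact linked_of_mem_visitLinks D.path_chain p hp

theorem linkDarts_perm : (P.a :: P.b :: linkDarts (allLinks D.loops D.path)).Perm
    (visitDarts (D.loops.flatten ++ D.path)) := by
  obtain ⟨x, l, hp, ha, hb⟩ := D.path_eq_cons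
  have h₁ : (linkDarts (D.loops.flatMap loopLinks)).Perm (visitDarts D.loops.flatten) := by
    induction D.loops with
    | nil => exact List.Perm.refl _
    | cons c L ih =>
      rw [List.flatMap_cons, linkDarts_append, List.flatten_cons, visitDarts_append]
      exact linkDarts_loopLinks_perm.append ih
  rw [hp, allLinks, linkDarts_append, visitDarts_append, visitDarts_eq_linkDarts, ha, hb]
  refine List.Perm.trans ?_ (h₁.append_right _)
  rw [List.perm_iff_count]
  intro y
  simp only [List.count_cons, List.count_append, List.count_nil]
  omega

theorem linkDarts_nodup : (linkDarts (allLinks D.loops D.path)).Nodup :=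
  ((D.linkDarts_perm.nodup_iff.2 D.visitDarts_nodup).of_cons).of_cons

theorem mem_linkDarts {x : Dart} (hx : S.Occupied x) (ha : x ≠ P.a) (hb : x ≠ P.b) :
    x ∈ linkDarts (allLinks D.loops D.path) := by
  have := D.linkDarts_perm.mem_iff.2 ((D.mem_visitDarts x).2 hx)
  simpa [ha, hb] using this

theorem totalSign_sq (sec : ℤ × ℤ → C.Vert) (ν : Arcs C P) :
    D.totalSign sec ν * D.totalSign sec ν = 1 := by
  have hw : ∀ L, linkWeight (linkFactor sec ν) L * linkWeight (linkFactor sec ν) L = 1 := fun L =>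
    prod_map_sq L _ fun p _ => linkFactor_sq sec ν p.1 p.2
  have hv := fun l => visitWeight_sq l
  have hlw : ∀ l L, (visitWeight l * linkWeight (linkFactor sec ν) L) *
      (visitWeight l * linkWeight (linkFactor sec ν) L) = 1 := by
    intro l L
    linear_combination (visitWeight l * visitWeight l) * hw L + hv l
  rw [totalSign, IsingSpinor.totalSign, mul_mul_mul_comm, hlw, mul_one]
  exact prod_map_sq _ _ fun l _ => by rw [neg_mul_neg]; exact hlw _ _

/-- The total sign of a decomposition is the sign with which the product of the operators of the
edges of the configuration creates it. -/
theorem edgeProd_ket (hS : S ∈ P.conf) (sec : ℤ × ℤ → C.Vert) (ν : Arcs C P) :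
    edgeProd (edgeSign sec) S.1 (arcProd sec ν (pairOp P.a P.b (ket ∅))) =
      D.totalSign sec ν • ket S.darts ∧ EvenAtVertices S.darts := by
  obtain ⟨hS₁, hS₂⟩ := mem_conf hS
  obtain ⟨x, l, hp, ha, hb⟩ := D.path_eq_cons
  have hnc : ∀ y ∈ D.loops.flatten ++ D.path, y.dout = y.din + 2 →
      (y.vert, y.din + 1) ∉ visitDarts (D.loops.flatten ++ D.path) ∧
        (y.vert, y.din + 3) ∉ visitDarts (D.loops.flatten ++ D.path) := by
    intro y hy hd
    rw [D.mem_visitDarts, D.mem_visitDarts]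
    exact D.noncrossing y (List.perm_append_comm.mem_iff.1 hy) hd
  obtain ⟨h₁, h₂⟩ := prod_visit_op_ket D.visitDarts_nodup hnc
  have hset : (visitDarts (D.loops.flatten ++ D.path)).toFinset = S.darts := by
    ext y
    rw [List.mem_toFinset, D.mem_visitDarts, mem_darts_iff hS]
  rw [hset] at h₁ h₂
  refine ⟨?_, h₂⟩
  have hnd := D.visitDarts_nodup
  have h₃ := prod_linkOp_eq hS₁ hS₂ sec ν D.linked_of_mem_allLinks D.linkDarts_nodup
    fun y hy h h' => D.mem_linkDarts hy h h'
  have hsq := D.totalSign_sq sec ν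
  rw [totalSign] at hsq ⊢
  rw [hp] at h₁ hnd h₃ hsq ⊢
  rw [prod_visit_op_all (ω := linkFactor sec ν) D.loops_ne_nil
    (fun p _ => linkFactor_sq sec ν p.1 p.2) hnd, h₃, ha, hb] at h₁
  rw [← h₁, LinearMap.smul_apply, smul_smul, hsq, one_smul]
  rfl

end Decomposition

/-- All decompositions of all configurations have the same total sign. -/
theorem totalSign_eq {sec : ℤ × ℤ → C.Vert} (hsec : ∀ v ∈ Ω.verts, C.proj (sec v) = v)
    (hC : ∀ K : Ω.BoundaryComponent, K.IsInner → (C.BranchesAround K ↔ Odd (P.countOn K)))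
    (ν : Arcs C P) {S' : Config} (hS : S ∈ P.conf) (hS' : S' ∈ P.conf) (D : Decomposition P S)
    (D' : Decomposition P S') : D.totalSign sec ν = D'.totalSign sec ν := by
  obtain ⟨h₁, h₂⟩ := mem_conf hS
  obtain ⟨h₁', h₂'⟩ := mem_conf hS'
  obtain ⟨k₁, k₂⟩ := D.edgeProd_ket hS sec ν
  obtain ⟨k₁', k₂'⟩ := D'.edgeProd_ket hS' sec ν
  have hTin : symmDiff S.1 S'.1 ⊆ Ω.innerEdges := by
    intro e he
    rcases Finset.mem_symmDiff.1 he with h | h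
    · exact h₁ h.1
    · exact h₁' h.1
  -- Both sets of darts are even and contain the same marked half-edges, which cancel in the
  -- difference.
  have hT : EvenDegrees (symmDiff S.1 S'.1) := by
    have h : symmDiff S.darts S'.darts = dartSet (symmDiff S.1 S'.1) := by
      rw [Config.darts, Config.darts, h₂, h₂', dartSet_symmDiff, symmDiff_symmDiff_symmDiff_comm,
        symmDiff_self]
      exact symmDiff_bot _
    have h' := k₂.symmDiff k₂'
    rw [h] at h'
    intro v
    simpa only [ind_dartSet] using h' v
  obtain ⟨U, hU⟩ := exists_eq_faceBoundary (fun e he => Ω.innerEdges_lattice e (hTin he)) hT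
  have hS'U : S'.1 = symmDiff S.1 (faceBoundary U) := by
    rw [← hU, symmDiff_symmDiff_cancel_left]
  -- The starting vector, made from the arcs and the pair a, b, does not depend on the
  -- configuration, so k₁ and k₁' can be compared.
  have key := edgeProd_symmDiff_faceBoundary (edgeSign sec) (edgeSign_sq sec) S.2 S.1 _ _ k₂ k₁ U
  -- An edge with no domain face on either side is not interior, hence not in the difference; so U
  -- cannot separate its two faces.
  have hmon := prod_faceMonodromy_mul hC hsec U fun x hl hr => by
    have hx : x.edge ∉ faceBoundary U := fun h => by
      rcases Ω.face_of_edge x (hTin (hU ▸ h)) with h | h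
      · exact hl h
      · exact hr h
    rw [edge_mem_faceBoundary] at hx
    tauto
  have hM : ∏ m ∈ S.2, ind U m.leftFace = ∏ i, ind U (P.pt i).leftFace := by
    rw [h₂, Finset.prod_image fun i _ j _ h => P.pt_injective h]
  have hσ : ∏ f ∈ U, ∏ e ∈ faceEdges f, edgeSign sec e = ∏ f ∈ U, faceMonodromy sec f := rfl
  rw [hM, hσ, hmon, mul_one, ← hS'U, k₁', Config.darts, h₂, ← h₂'] at key
  exact (smul_ket_injective _ key).symm

end

section

open DoubleCover MarkedPoints

/-! ### The phase of a decomposition -/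

/-- The factor `exp (-i θ / 2)` of the winding `θ = k π / 2`. -/
def windingFactor (k : ℤ) : ℂ := Complex.exp (-(Complex.I / 2) * (k * (Real.pi / 2) : ℝ))

theorem windingFactor_add (k m : ℤ) :
    windingFactor (k + m) = windingFactor k * windingFactor m := by
  rw [windingFactor, windingFactor, windingFactor, ← Complex.exp_add]
  congr 1
  push_cast
  ring

theorem windingFactor_zero : windingFactor 0 = 1 := by simp [windingFactor]

theorem windingFactor_two : windingFactor 2 = -Complex.I := by
  have : -(Complex.I / 2) * (((2 : ℤ) : ℝ) * (Real.pi / 2) : ℝ) = -(Real.pi / 2 * Complex.I) := by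
    push_cast; ring
  rw [windingFactor, this, Complex.exp_neg, Complex.exp_pi_div_two_mul_I, Complex.inv_I]

theorem windingFactor_neg_two : windingFactor (-2) = Complex.I := by
  have h := windingFactor_add (-2) 2
  rw [windingFactor_two, show (-2 : ℤ) + 2 = 0 from rfl, windingFactor_zero] at h
  linear_combination windingFactor (-2) * Complex.I_mul_I - Complex.I * h

theorem windingFactor_eq_one_iff {k : ℤ} : windingFactor k = 1 ↔ 8 ∣ k := by
  rw [windingFactor, Complex.exp_eq_one_iff]
  have hpi : (Real.pi : ℂ) ≠ 0 := Complex.ofReal_ne_zero.2 Real.pi_ne_zero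
  constructor
  · rintro ⟨m, hm⟩
    refine ⟨-m, ?_⟩
    have h₁ : (Complex.I * Real.pi) * ((k : ℂ) + 8 * m) = 0 := by
      push_cast at hm
      linear_combination -4 * hm
    have h₂ := (mul_eq_zero.1 h₁).resolve_left (mul_ne_zero Complex.I_ne_zero hpi)
    have h₃ : k + 8 * m = 0 := by exact_mod_cast h₂
    omega
  · rintro ⟨m, rfl⟩
    refine ⟨-m, ?_⟩
    push_cast
    ring

theorem windingFactor_of_sign {s : ℤ} (hs : s * s = 1) :
    windingFactor (-2 * s) = Complex.I * s ∧ windingFactor (2 * s) = -Complex.I * s := by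
  rcases mul_self_eq_one_iff.1 hs with rfl | rfl
  · simp [windingFactor_two, windingFactor_neg_two]
  · simp [windingFactor_two, windingFactor_neg_two]

theorem windingFactor_visit {x : Visit} (h : x.din ≠ x.dout) :
    windingFactor x.turn =
      windingFactor ((x.dout.val : ℤ) - x.din.val) * (Complex.I * x.sign) := by
  rw [Visit.turn_eq h, ← (windingFactor_of_sign x.sign_sq).1, ← windingFactor_add]
  congr 1
  ring

variable {Ω : DiscreteDomain} {C : DoubleCover Ω} {n : ℕ} {P : MarkedPoints Ω n} {S : Config}

/-- A link contributes -i times its sign where a visit contributes i times its sign, so matched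
visits and links leave only real signs besides the direction differences. -/
theorem windingFactor_link (hS : S.1 ⊆ Ω.innerEdges) (ν : Arcs C P) {o i : Dart}
    (h : Linked P S o i) :
    windingFactor (linkTurns ν o i) =
      windingFactor ((i.2.val : ℤ) - o.2.val) * (-Complex.I * linkSign ν o i) := by
  obtain ⟨k, hk⟩ := linkTurns_emod hS ν h
  rw [← (windingFactor_of_sign (linkSign_sq ν o i)).2, ← windingFactor_add,
    show linkTurns ν o i = ((i.2.val : ℤ) - o.2.val + 2 * linkSign ν o i) + 8 * k by omega,
    windingFactor_add _ (8 * k), windingFactor_eq_one_iff.2 ⟨k, rfl⟩, mul_one]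

theorem din_ne_dout {l : List Visit} (h : (visitDarts l).Nodup) : ∀ x ∈ l, x.din ≠ x.dout := by
  induction l with
  | nil => simp
  | cons y l ih =>
    rw [visitDarts_cons, List.nodup_cons, List.nodup_cons] at h
    intro x hx
    rcases List.mem_cons.1 hx with rfl | hx
    · intro hd
      exact h.1 (List.mem_cons.2 (Or.inl (Prod.ext rfl hd)))
    · exact ih h.2.2 x hx

/-- Direction differences telescope to those of the two ends. An open curve has one visit more than
links, which leaves a single factor i. -/
theorem windingFactor_curve (hS : S.1 ⊆ Ω.innerEdges) (ν : Arcs C P) (x : Visit) (l : List Visit)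
    (hl : ∀ y ∈ x :: l, y.din ≠ y.dout)
    (hc : (x :: l).IsChain fun x y => Linked P S x.outDart y.inDart) :
    windingFactor (curveTurns ν (x :: l)) =
      windingFactor ((((x :: l).getLast (List.cons_ne_nil x l)).dout.val : ℤ) - x.din.val) *
        (Complex.I * visitWeight (x :: l) * (linkWeight (linkSign ν) (visitLinks (x :: l)) : ℤ)) := by
  induction l generalizing x with
  | nil =>
    have := windingFactor_visit (hl x List.mem_cons_self)
    simpa [curveTurns, visitWeight, linkWeight, visitLinks] using this
  | cons y l ih =>
    rw [List.isChain_cons_cons] at hc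
    have h₁ := ih y (fun z hz => hl z (List.mem_cons_of_mem _ hz)) hc.2
    have h₂ := windingFactor_visit (hl x List.mem_cons_self)
    have h₃ := windingFactor_link hS ν hc.1
    have hv : visitWeight (x :: y :: l) = x.sign * visitWeight (y :: l) := rfl
    have hw : linkWeight (linkSign ν) (visitLinks (x :: y :: l)) =
      linkSign ν x.outDart y.inDart * linkWeight (linkSign ν) (visitLinks (y :: l)) := rfl
    rw [curveTurns, windingFactor_add, windingFactor_add, h₁, h₂, h₃, hv, hw,
      List.getLast_cons (List.cons_ne_nil y l)]
    have h₄ : ∀ a b c d : ℤ, windingFactor (d - a) =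
        windingFactor (b - a) * windingFactor (c - b) * windingFactor (d - c) := by
      intro a b c d
      rw [← windingFactor_add, ← windingFactor_add]
      congr 1
      ring
    generalize (y :: l).getLast (List.cons_ne_nil y l) = z
    rw [h₄ x.din.val x.dout.val y.din.val z.dout.val]
    have e₁ : x.outDart.2 = x.dout := rfl
    have e₂ : y.inDart.2 = y.din := rfl
    rw [e₁, e₂]
    push_cast
    generalize windingFactor ((x.dout.val : ℤ) - x.din.val) = α
    generalize windingFactor ((y.din.val : ℤ) - x.dout.val) = β
    generalize windingFactor _ = γ
    linear_combination (-α * β * γ * x.sign * linkSign ν x.outDart y.inDart * Complex.I *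
      visitWeight (y :: l) * linkWeight (linkSign ν) (visitLinks (y :: l))) * Complex.I_mul_I

/-- The closing link cancels both the remaining direction difference and the remaining i. The value
is therefore ±1, and it is 1 exactly when the winding vanishes modulo 4π
(`windingFactor_eq_one_iff`). -/
theorem windingFactor_loop (hS : S.1 ⊆ Ω.innerEdges) (ν : Arcs C P) {l : List Visit} (hne : l ≠ [])
    (hl : ∀ y ∈ l, y.din ≠ y.dout)
    (hc : l.IsChain fun x y => Linked P S x.outDart y.inDart)
    (hcl : ∀ x ∈ l.head?, ∀ y ∈ l.getLast?, Linked P S y.outDart x.inDart) :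
    windingFactor (loopTurns ν l) =
      (visitWeight l * linkWeight (linkSign ν) (loopLinks l) : ℤ) := by
  cases l with
  | nil => exact absurd rfl hne
  | cons x l =>
    have h := hcl x rfl _ (List.getLast?_eq_some_getLast (List.cons_ne_nil x l))
    rw [loopTurns, windingFactor_add, windingFactor_curve hS ν x l hl hc, windingFactor_link hS ν h,
      loopLinks, linkWeight_append]
    generalize (x :: l).getLast (List.cons_ne_nil x l) = z
    have h₁ : windingFactor ((z.dout.val : ℤ) - x.din.val) *
        windingFactor ((x.inDart.2.val : ℤ) - z.outDart.2.val) = 1 := by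
      rw [← windingFactor_add, ← windingFactor_zero]
      congr 1
      show (z.dout.val : ℤ) - x.din.val + (x.din.val - z.dout.val) = 0
      ring
    have h₂ : linkWeight (linkSign ν) [(z.outDart, x.inDart)] = linkSign ν z.outDart x.inDart := by
      simp [linkWeight]
    rw [h₂]
    push_cast
    linear_combination (-Complex.I * Complex.I * visitWeight (x :: l) *
      linkWeight (linkSign ν) (visitLinks (x :: l)) * linkSign ν z.outDart x.inDart) * h₁ -
      (visitWeight (x :: l) * linkWeight (linkSign ν) (visitLinks (x :: l)) *
        linkSign ν z.outDart x.inDart : ℂ) * Complex.I_mul_I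

theorem exists_sheet_eq {sec : ℤ × ℤ → C.Vert} (hsec : ∀ v ∈ Ω.verts, C.proj (sec v) = v)
    {v : ℤ × ℤ} (hv : v ∈ Ω.verts) {s : ℤ} (hs : s * s = 1) :
    ∃ u, C.proj u = v ∧ sheet sec u = s := by
  rcases mul_self_eq_one_iff.1 hs with rfl | rfl
  · exact ⟨sec v, hsec v hv, sheet_section hsec hv⟩
  · obtain ⟨x, y, hxy, h⟩ := Set.ncard_eq_two.1 (C.two_to_one v hv)
    have hx : x ∈ {w | C.proj w = v} := h ▸ Set.mem_insert x {y}
    have hy : y ∈ {w | C.proj w = v} := h ▸ Set.mem_insert_of_mem x rfl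
    by_contra hne
    push Not at hne
    have h₁ := (mul_self_eq_one_iff.1 (sheet_sq sec x)).resolve_right (hne x hx)
    have h₂ := (mul_self_eq_one_iff.1 (sheet_sq sec y)).resolve_right (hne y hy)
    exact hxy (eq_of_sheet_eq hsec (Eq.trans hx (Eq.symm hy)) (h₁.trans h₂.symm))

theorem Linked.mem_verts (hS : S.1 ⊆ Ω.innerEdges) {o i : Dart} (h : Linked P S o i) :
    o.1 ∈ Ω.verts ∧ i.1 ∈ Ω.verts := by
  rcases h with ⟨ho, rfl⟩ | ⟨s, ⟨rfl, rfl⟩ | ⟨rfl, rfl⟩⟩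
  · exact ⟨Ω.vert_of_edge o (hS ho), Ω.vert_of_edge o.rev (by rw [Dart.edge_rev]; exact hS ho)⟩
  · exact ⟨Ω.vert_of_halfEdge _ (P.pt_mem _), Ω.vert_of_halfEdge _ (P.pt_mem _)⟩
  · exact ⟨Ω.vert_of_halfEdge _ (P.pt_mem _), Ω.vert_of_halfEdge _ (P.pt_mem _)⟩

theorem linkWeight_linkSheet_sq (sec : ℤ × ℤ → C.Vert) (ν : Arcs C P) (L : List (Dart × Dart)) :
    linkWeight (linkSheet sec ν) L * linkWeight (linkSheet sec ν) L = 1 :=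
  prod_map_sq L _ fun p _ => linkSheet_sq sec ν p.1 p.2

/-- Sheet signs multiply along the curve; intermediate points of the lift exist because each fibre
contains both sheets. -/
theorem curveLifts_iff (hS : S.1 ⊆ Ω.innerEdges) {sec : ℤ × ℤ → C.Vert}
    (hsec : ∀ v ∈ Ω.verts, C.proj (sec v) = v) (ν : Arcs C P) (x : Visit) (l : List Visit)
    (hc : (x :: l).IsChain fun x y => Linked P S x.outDart y.inDart) (w w' : C.Vert) :
    CurveLifts ν (x :: l) w w' ↔ C.proj w = x.vert ∧
      C.proj w' = ((x :: l).getLast (List.cons_ne_nil x l)).vert ∧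
      sheet sec w' = sheet sec w * linkWeight (linkSheet sec ν) (visitLinks (x :: l)) := by
  induction l generalizing x w with
  | nil =>
    simp only [CurveLifts, visitLinks, linkWeight, List.map_nil, List.prod_nil, mul_one,
      List.getLast_singleton]
    constructor
    · rintro ⟨rfl, h⟩; exact ⟨h, h, rfl⟩
    · rintro ⟨h₁, h₂, h₃⟩
      exact ⟨(eq_of_sheet_eq hsec (h₂.trans h₁.symm) h₃).symm, h₁⟩
  | cons y l ih =>
    rw [List.isChain_cons_cons] at hc
    have hw : linkWeight (linkSheet sec ν) (visitLinks (x :: y :: l)) =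
      linkSheet sec ν x.outDart y.inDart * linkWeight (linkSheet sec ν) (visitLinks (y :: l)) := rfl
    rw [CurveLifts, List.getLast_cons (List.cons_ne_nil y l), hw]
    simp only [ih y hc.2, linkLifts_iff hS hsec ν hc.1]
    constructor
    · rintro ⟨h₁, u, ⟨-, -, h₂⟩, -, h₃, h₄⟩
      exact ⟨h₁, h₃, by rw [h₄, h₂, mul_assoc]⟩
    · rintro ⟨h₁, h₂, h₃⟩
      obtain ⟨u, hu, hu'⟩ := exists_sheet_eq hsec (hc.1.mem_verts hS).2
        (s := sheet sec w * linkSheet sec ν x.outDart y.inDart) (by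
          linear_combination linkSheet sec ν x.outDart y.inDart *
            linkSheet sec ν x.outDart y.inDart * sheet_sq sec w +
            linkSheet_sq sec ν x.outDart y.inDart)
      exact ⟨h₁, u, ⟨h₁, hu, hu'⟩, hu, h₂, by rw [h₃, hu', mul_assoc]⟩

theorem visitLinks_append_singleton (x y : Visit) (l : List Visit) :
    visitLinks (x :: (l ++ [y])) = visitLinks (x :: l) ++
      [(((x :: l).getLast (List.cons_ne_nil x l)).outDart, y.inDart)] := by
  induction l generalizing x with
  | nil => rfl
  | cons z l ih =>
    rw [List.cons_append, visitLinks, ih z, visitLinks, List.getLast_cons (List.cons_ne_nil z l)]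
    rfl

theorem loopNontrivial_iff (hS : S.1 ⊆ Ω.innerEdges) {sec : ℤ × ℤ → C.Vert}
    (hsec : ∀ v ∈ Ω.verts, C.proj (sec v) = v) (ν : Arcs C P) {l : List Visit} (hne : l ≠ [])
    (hc : l.IsChain fun x y => Linked P S x.outDart y.inDart)
    (hcl : ∀ x ∈ l.head?, ∀ y ∈ l.getLast?, Linked P S y.outDart x.inDart) :
    LoopNontrivial ν l ↔ linkWeight (linkSheet sec ν) (loopLinks l) = -1 := by
  cases l with
  | nil => exact absurd rfl hne
  | cons x l =>
    have h := hcl x rfl _ (List.getLast?_eq_some_getLast (List.cons_ne_nil x l))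
    have hchain : (x :: (l ++ [x])).IsChain fun x y => Linked P S x.outDart y.inDart := by
      rw [← List.cons_append]
      refine List.IsChain.append hc (List.isChain_singleton x) fun y hy z hz => ?_
      simp only [List.head?_cons, Option.mem_def, Option.some.injEq] at hz
      subst hz
      exact hcl x rfl y hy
    have hlast : (x :: (l ++ [x])).getLast (List.cons_ne_nil _ _) = x := by simp
    have hsq := linkWeight_linkSheet_sq sec ν (loopLinks (x :: l))
    rw [LoopNontrivial]
    simp only [curveLifts_iff hS hsec ν x _ hchain, hlast, visitLinks_append_singleton]
    show (¬ ∃ w, C.proj w = x.vert ∧ C.proj w = x.vert ∧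
      sheet sec w = sheet sec w * linkWeight (linkSheet sec ν) (loopLinks (x :: l))) ↔ _
    constructor
    · intro h'
      refine (mul_self_eq_one_iff.1 hsq).resolve_left fun h₁ => h' ?_
      have hx : C.proj (sec x.vert) = x.vert := hsec _ (h.mem_verts hS).2
      exact ⟨sec x.vert, hx, hx, by rw [h₁, mul_one]⟩
    · rintro h' ⟨w, -, -, hw⟩
      have := sheet_sq sec w
      rw [h'] at hw
      have h₀ : sheet sec w = 0 := by omega
      rw [h₀] at this
      norm_num at this

theorem neg_one_pow_filter {α : Type*} (L : List α) (p : α → Prop) [DecidablePred p] :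
    (-1 : ℤ) ^ (L.filter fun x => decide (p x)).length =
      (L.map fun x => if p x then (-1 : ℤ) else 1).prod := by
  induction L with
  | nil => rfl
  | cons x L ih =>
    rw [List.map_cons, List.prod_cons, ← ih, List.filter_cons]
    simp only [decide_eq_true_eq]
    split_ifs
    · rw [List.length_cons, pow_succ, mul_comm]
    · rw [one_mul]

theorem linkWeight_mul (ω ω' : Dart → Dart → ℤ) (L : List (Dart × Dart)) :
    linkWeight (fun o i => ω o i * ω' o i) L = linkWeight ω L * linkWeight ω' L := by
  rw [linkWeight, linkWeight, linkWeight, List.prod_map_mul]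

/-- The phase of a decomposition is its total sign, up to a constant. -/
theorem Decomposition.phase_eq (hS : S ∈ P.conf) {sec : ℤ × ℤ → C.Vert}
    (hsec : ∀ v ∈ Ω.verts, C.proj (sec v) = v) (ν : Arcs C P) {a' b' : C.Vert}
    (ha' : C.proj a' = P.a.1) (hb' : C.proj b' = P.b.1) (D : Decomposition P S) :
    D.phase ν a' b' = windingFactor ((P.b.2.val : ℤ) - P.a.2.val) * Complex.I *
      (sheet sec a' * sheet sec b' : ℤ) * (D.totalSign sec ν : ℤ) := by
  have hS₁ := (mem_conf hS).1
  obtain ⟨x, l, hp, ha, hb⟩ := D.path_eq_cons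
  have hne := din_ne_dout D.visitDarts_nodup
  have hcw := windingFactor_curve hS₁ ν x l
    (fun y hy => hne y (List.mem_append_right _ (hp ▸ hy))) (hp ▸ D.path_chain)
  have hw : Complex.exp (-(Complex.I / 2) * (D.wind ν : ℂ)) =
      windingFactor ((P.b.2.val : ℤ) - P.a.2.val) *
        (Complex.I * visitWeight D.path * (linkWeight (linkSign ν) (visitLinks D.path) : ℤ)) := by
    rw [Decomposition.wind, hp, ← ha, ← hb]
    exact hcw
  have hsheet : D.sheetSign ν a' b' =
      (sheet sec a' * sheet sec b' * linkWeight (linkSheet sec ν) (visitLinks D.path) : ℤ) := by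
    have h₁ := curveLifts_iff hS₁ hsec ν x l (hp ▸ D.path_chain) a' b'
    have h₂ : C.proj a' = x.vert := ha'.trans (by rw [← ha]; rfl)
    have h₃ : C.proj b' = ((x :: l).getLast (List.cons_ne_nil x l)).vert :=
      hb'.trans (by rw [← hb]; rfl)
    rw [Decomposition.sheetSign, hp]
    simp only [h₁, h₂, h₃, true_and]
    rcases mul_self_eq_one_iff.1 (sheet_sq sec a') with a | a <;>
    rcases mul_self_eq_one_iff.1 (sheet_sq sec b') with b | b <;>
    rcases mul_self_eq_one_iff.1 (linkWeight_linkSheet_sq sec ν (visitLinks (x :: l))) with c | c <;>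
    simp [a, b, c]
  have hloops : (-1 : ℤ) ^ D.numNontrivial ν * (-1) ^ D.numZeroWinding ν =
      (D.loops.map fun l =>
        -(visitWeight l * linkWeight (linkFactor sec ν) (loopLinks l))).prod := by
    rw [Decomposition.numNontrivial, Decomposition.numZeroWinding, neg_one_pow_filter,
      neg_one_pow_filter, ← List.prod_map_mul]
    congr 1
    -- Loop by loop: zero winding means that visit signs and link signs multiply to 1, so with the
    -- loop's minus sign it counts as -1; non-triviality is the sheet product being -1.
    refine List.map_congr_left fun c hc => ?_
    have h₁ := loopNontrivial_iff hS₁ hsec ν (D.loops_ne_nil c hc) (D.loops_chain c hc)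
      (D.loops_closed c hc)
    have h₂ := windingFactor_loop hS₁ ν (D.loops_ne_nil c hc)
      (fun y hy => hne y (List.mem_append_left _ (List.mem_flatten.2 ⟨c, hc, hy⟩)))
      (D.loops_chain c hc) (D.loops_closed c hc)
    have h₃ : (8 : ℤ) ∣ loopTurns ν c ↔
        visitWeight c * linkWeight (linkSign ν) (loopLinks c) = 1 := by
      rw [← windingFactor_eq_one_iff, h₂]
      exact_mod_cast Iff.rfl
    have h₄ : linkWeight (linkFactor sec ν) (loopLinks c) =
        linkWeight (linkSign ν) (loopLinks c) * linkWeight (linkSheet sec ν) (loopLinks c) :=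
      linkWeight_mul _ _ _
    have hsq : linkWeight (linkSign ν) (loopLinks c) * linkWeight (linkSign ν) (loopLinks c) = 1 :=
      prod_map_sq _ _ fun p _ => linkSign_sq ν p.1 p.2
    simp only [h₁, h₃, h₄]
    rcases mul_self_eq_one_iff.1 (visitWeight_sq c) with a | a <;>
    rcases mul_self_eq_one_iff.1 hsq with b | b <;>
    rcases mul_self_eq_one_iff.1 (linkWeight_linkSheet_sq sec ν (loopLinks c)) with d | d <;>
    simp [a, b, d]
  have hloops' := congrArg (fun k : ℤ => (k : ℂ)) hloops
  push_cast at hloops'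
  have hpath : linkWeight (linkFactor sec ν) (visitLinks D.path) =
      linkWeight (linkSign ν) (visitLinks D.path) * linkWeight (linkSheet sec ν) (visitLinks D.path) :=
    linkWeight_mul _ _ _
  rw [Decomposition.phase, hw, hsheet, Decomposition.totalSign, IsingSpinor.totalSign, hpath]
  push_cast
  rw [← hloops']
  ring

/-! ### Comparison of the constant phase with the etas -/

theorem dirC_eq (d : Fin 4) : dirC d = windingFactor (-2 * d.val) := by
  fin_cases d
  · simp [dirC, windingFactor_zero]
  · simp [dirC, windingFactor_neg_two]
  · have : windingFactor (-2 * 2) = windingFactor (-2) * windingFactor (-2) := by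
      rw [← windingFactor_add]; rfl
    rw [windingFactor_neg_two, Complex.I_mul_I] at this
    simpa [dirC] using this.symm
  · have : windingFactor (-2 * 3) = windingFactor (-2) * windingFactor (-2) * windingFactor (-2) := by
      rw [← windingFactor_add, ← windingFactor_add]; rfl
    rw [windingFactor_neg_two, Complex.I_mul_I] at this
    simpa [dirC] using this.symm

/-- Squares suffice, since both etas are defined only up to sign. The squared winding factor between
the ends converts the direction of x into that of y, and the two factors i have fourth power 1. -/
theorem eta_sq_eq {x y : Dart} {ηx ηy : ℂ} (hx : IsEta x ηx) (hy : IsEta y ηy) {s : ℤ}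
    (hs : s * s = 1) :
    (Complex.I * ηx * (windingFactor ((y.2.val : ℤ) - x.2.val) * Complex.I * s)) ^ 2 = ηy ^ 2 := by
  have hs' : (s : ℂ) * s = 1 := by exact_mod_cast hs
  have hI : Complex.I ^ 4 = 1 := Complex.I_pow_four
  have h₁ : windingFactor ((y.2.val : ℤ) - x.2.val) ^ 2 * windingFactor (-2 * y.2.val) =
      windingFactor (-2 * x.2.val) := by
    rw [sq, ← windingFactor_add, ← windingFactor_add]
    congr 1
    ring
  have n : ∀ k, windingFactor k ≠ 0 := fun k => Complex.exp_ne_zero _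
  have hx' := hx
  have hy' := hy
  rw [IsEta, dirC_eq] at hx' hy'
  have nx := n (-2 * x.2.val)
  have ny := n (-2 * y.2.val)
  have : (Complex.I * ηx * (windingFactor ((y.2.val : ℤ) - x.2.val) * Complex.I * s)) ^ 2 =
      Complex.I ^ 4 * ηx ^ 2 * windingFactor ((y.2.val : ℤ) - x.2.val) ^ 2 * (s * s) := by ring
  rw [this, hI, hs', one_mul, mul_one, hx', hy', mul_inv, mul_inv, mul_assoc]
  congr 1
  rw [← h₁]
  field_simp
  exact div_self (n _)

end

section

open MarkedPoints

/-! ### Alternating cycles of two involutions -/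

section Involutions

variable {α : Type*} {τ σ : α → α}

/-- The dihedral relation: conjugating στ by τ inverts it. -/
theorem iterate_alternate (hτ : Function.Involutive τ) (hσ : Function.Involutive σ) (y : α)
    (i : ℕ) : (σ ∘ τ)^[i] (τ ((σ ∘ τ)^[i] y)) = τ y := by
  induction i with
  | zero => rfl
  | succ i ih =>
    rw [Function.iterate_succ_apply, Function.iterate_succ_apply']
    have : (σ ∘ τ) (τ ((σ ∘ τ) ((σ ∘ τ)^[i] y))) = τ ((σ ∘ τ)^[i] y) := by
      simp only [Function.comp_apply]
      rw [hτ, hσ]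
    rw [this, ih]

/-- An alternating cycle is never traversed in both directions. By the dihedral relation, a
coincidence would produce a fixed point of τ or of σ at its midpoint, according to the parity of i +
j. -/
theorem alternate_ne (hτ : Function.Involutive τ) (hσ : Function.Involutive σ)
    (hτ' : ∀ x, τ x ≠ x) (hσ' : ∀ x, σ x ≠ x) (y : α) (i j : ℕ) :
    τ ((σ ∘ τ)^[i] y) ≠ (σ ∘ τ)^[j] y := by
  intro h
  have hinj : Function.Injective (σ ∘ τ) := hσ.injective.comp hτ.injective
  have h₁ : τ y = (σ ∘ τ)^[i + j] y := by
    rw [← iterate_alternate hτ hσ y i, h, Function.iterate_add_apply]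
  rcases Nat.even_or_odd (i + j) with ⟨r, hr⟩ | ⟨r, hr⟩
  · rw [hr, Function.iterate_add_apply, ← iterate_alternate hτ hσ y r] at h₁
    exact hτ' _ (hinj.iterate r h₁)
  · rw [show i + j = r + (r + 1) by omega, Function.iterate_add_apply,
      ← iterate_alternate hτ hσ y r] at h₁
    have h₂ := hinj.iterate r h₁
    rw [Function.iterate_succ_apply'] at h₂
    exact hσ' _ h₂.symm

/-- The first `k` points of the orbit of `y` under `f`. -/
def orbitList (f : α → α) (y : α) (k : ℕ) : List α := (List.range k).map fun i => f^[i] y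

/-- A list of points together with their images under `τ`. -/
def withPartners (τ : α → α) (l : List α) : List α := l.flatMap fun z => [z, τ z]

theorem mem_withPartners {l : List α} {x : α} :
    x ∈ withPartners τ l ↔ ∃ z ∈ l, x = z ∨ x = τ z := by
  simp [withPartners]

theorem withPartners_append (l l' : List α) :
    withPartners τ (l ++ l') = withPartners τ l ++ withPartners τ l' := List.flatMap_append

theorem withPartners_nodup {l : List α} (hτ : Function.Involutive τ) (hl : l.Nodup)
    (h : ∀ x ∈ l, ∀ y ∈ l, τ x ≠ y) : (withPartners τ l).Nodup := by
  induction l with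
  | nil => simp [withPartners]
  | cons z l ih =>
    rw [List.nodup_cons] at hl
    have h₁ : withPartners τ (z :: l) = z :: τ z :: withPartners τ l := rfl
    rw [h₁, List.nodup_cons, List.nodup_cons, List.mem_cons, not_or]
    simp only [mem_withPartners, not_exists, not_and, not_or]
    have hz := List.mem_cons_self (a := z) (l := l)
    refine ⟨⟨(h z hz z hz).symm, fun x hx => ⟨?_, ?_⟩⟩, fun x hx => ⟨?_, ?_⟩,
      ih hl.2 fun x hx y hy => h x (List.mem_cons_of_mem _ hx) y (List.mem_cons_of_mem _ hy)⟩
    · rintro rfl; exact hl.1 hx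
    · exact (h x (List.mem_cons_of_mem _ hx) z hz).symm
    · exact h z hz x (List.mem_cons_of_mem _ hx)
    · intro h'
      exact hl.1 (hτ.injective h' ▸ hx)

/-- The orbit supplies the darts of arrival and its τ-images those of departure; by `alternate_ne`
the two families are disjoint, so every dart is used once. -/
theorem exists_orbit [Finite α] (hτ : Function.Involutive τ) (hσ : Function.Involutive σ)
    (hτ' : ∀ x, τ x ≠ x) (hσ' : ∀ x, σ x ≠ x) (y : α) :
    ∃ k, 0 < k ∧ (σ ∘ τ)^[k] y = y ∧ (∀ i, 0 < i → i < k → (σ ∘ τ)^[i] y ≠ y) ∧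
      (withPartners τ (orbitList (σ ∘ τ) y k)).Nodup ∧
      (∀ x, x ∈ withPartners τ (orbitList (σ ∘ τ) y k) →
        τ x ∈ withPartners τ (orbitList (σ ∘ τ) y k) ∧
        σ x ∈ withPartners τ (orbitList (σ ∘ τ) y k)) := by
  have hinj : Function.Injective (σ ∘ τ) := hσ.injective.comp hτ.injective
  have hper := hinj.mem_periodicPts y
  set k := Function.minimalPeriod (σ ∘ τ) y with hk
  have hk₀ : 0 < k := Function.minimalPeriod_pos_of_mem_periodicPts hper
  have hkk : (σ ∘ τ)^[k] y = y := Function.iterate_minimalPeriod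
  refine ⟨k, hk₀, hkk, ?_, ?_, ?_⟩
  · intro i hi hik h
    exact absurd (Function.IsPeriodicPt.minimalPeriod_le hi h) (not_le.2 hik)
  · refine withPartners_nodup hτ ?_ ?_
    · refine List.Nodup.map_on ?_ List.nodup_range
      intro i hi j hj h
      exact Function.iterate_injOn_Iio_minimalPeriod (List.mem_range.1 hi) (List.mem_range.1 hj) h
    · intro x hx z hz
      obtain ⟨i, -, rfl⟩ := List.mem_map.1 hx
      obtain ⟨j, -, rfl⟩ := List.mem_map.1 hz
      exact alternate_ne hτ hσ hτ' hσ' y i j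
  · have mem : ∀ i, (σ ∘ τ)^[i] y ∈ orbitList (σ ∘ τ) y k := by
      intro i
      refine List.mem_map.2 ⟨i % k, List.mem_range.2 (Nat.mod_lt _ hk₀), ?_⟩
      exact Function.iterate_mod_minimalPeriod_eq
    intro x hx
    simp only [mem_withPartners] at hx ⊢
    obtain ⟨z, hz, hx⟩ := hx
    obtain ⟨i, hi, rfl⟩ := List.mem_map.1 hz
    rcases hx with rfl | rfl
    · refine ⟨⟨_, hz, Or.inr rfl⟩, ?_⟩
      have h₁ : (σ ∘ τ)^[i] y = σ (τ ((σ ∘ τ)^[i + k - 1] y)) := by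
        have : (σ ∘ τ)^[i] y = (σ ∘ τ)^[(i + k - 1) + 1] y := by
          rw [show i + k - 1 + 1 = i + k by omega, Function.iterate_add_apply, hkk]
        rw [this, Function.iterate_succ_apply']
        rfl
      exact ⟨_, mem (i + k - 1), Or.inr (by rw [h₁, hσ])⟩
    · refine ⟨⟨_, hz, Or.inl (hτ _)⟩, ⟨_, mem (i + 1), Or.inl ?_⟩⟩
      rw [Function.iterate_succ_apply']; rfl

theorem orbitList_isChain (f : α → α) (y : α) (k : ℕ) :
    (orbitList f y k).IsChain fun x z => z = f x := by
  rw [List.isChain_iff_getElem]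
  intro i hi
  simp only [orbitList, List.getElem_map, List.getElem_range]
  exact Function.iterate_succ_apply' f i y

theorem orbitList_head? (f : α → α) (y : α) {k : ℕ} (hk : 0 < k) :
    (orbitList f y k).head? = some y := by
  obtain ⟨m, rfl⟩ : ∃ m, k = m + 1 := ⟨k - 1, by omega⟩
  simp [orbitList, List.range_succ_eq_map]

theorem orbitList_getLast? (f : α → α) (y : α) (m : ℕ) :
    (orbitList f y (m + 1)).getLast? = some (f^[m] y) := by
  simp [orbitList, List.range_succ]

/-- A finite set closed under two involutions without fixed points decomposes into alternating
cycles. -/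
theorem exists_cycles [Finite α] (hτ : Function.Involutive τ) (hσ : Function.Involutive σ)
    (hτ' : ∀ x, τ x ≠ x) (hσ' : ∀ x, σ x ≠ x) (Y : Finset α)
    (hY : ∀ x ∈ Y, τ x ∈ Y ∧ σ x ∈ Y) :
    ∃ L : List (List α), (∀ l ∈ L, l ≠ []) ∧
      (∀ l ∈ L, l.IsChain fun x z => z = σ (τ x)) ∧
      (∀ l ∈ L, ∀ x ∈ l.head?, ∀ z ∈ l.getLast?, x = σ (τ z)) ∧
      (withPartners τ L.flatten).Nodup ∧ ∀ x, x ∈ withPartners τ L.flatten ↔ x ∈ Y := by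
  induction hk : Y.card using Nat.strong_induction_on generalizing Y with
  | _ n ih =>
    rcases Y.eq_empty_or_nonempty with rfl | ⟨y, hy⟩
    · exact ⟨[], by simp, by simp, by simp, by simp [withPartners], by simp [withPartners]⟩
    · obtain ⟨k, hk₀, hkk, -, hnd, hcl⟩ := exists_orbit hτ hσ hτ' hσ' y
      set c := orbitList (σ ∘ τ) y k with hc
      have hyc : y ∈ withPartners τ c := mem_withPartners.2
        ⟨y, List.mem_map.2 ⟨0, List.mem_range.2 hk₀, rfl⟩, Or.inl rfl⟩
      have hcY : ∀ x ∈ withPartners τ c, x ∈ Y := by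
        have h₁ : ∀ i, (σ ∘ τ)^[i] y ∈ Y := by
          intro i
          induction i with
          | zero => exact hy
          | succ i ih =>
            rw [Function.iterate_succ_apply']
            exact (hY _ (hY _ ih).1).2
        intro x hx
        obtain ⟨z, hz, hx⟩ := mem_withPartners.1 hx
        obtain ⟨i, -, rfl⟩ := List.mem_map.1 hz
        rcases hx with rfl | rfl
        · exact h₁ i
        · exact (hY _ (h₁ i)).1
      set Y' := Y.filter fun x => x ∉ withPartners τ c with hY'
      have hlt : Y'.card < n := by
        rw [← hk]
        refine Finset.card_lt_card (Finset.filter_ssubset.2 ⟨y, hy, by simpa using hyc⟩)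
      obtain ⟨L, h₁, h₂, h₃, h₄, h₅⟩ := ih _ hlt Y' (fun x hx => by
        simp only [hY', Finset.mem_filter] at hx ⊢
        refine ⟨⟨(hY x hx.1).1, fun h => hx.2 ?_⟩, ⟨(hY x hx.1).2, fun h => hx.2 ?_⟩⟩
        · have := (hcl _ h).1
          rwa [hτ] at this
        · have := (hcl _ h).2
          rwa [hσ] at this) rfl
      obtain ⟨m, rfl⟩ : ∃ m, k = m + 1 := ⟨k - 1, by omega⟩
      refine ⟨c :: L, ?_, ?_, ?_, ?_, ?_⟩
      · intro l hl
        rcases List.mem_cons.1 hl with rfl | hl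
        · intro h
          rw [h] at hyc
          simp [withPartners] at hyc
        · exact h₁ l hl
      · intro l hl
        rcases List.mem_cons.1 hl with rfl | hl
        · exact orbitList_isChain _ _ _
        · exact h₂ l hl
      · intro l hl
        rcases List.mem_cons.1 hl with rfl | hl
        · intro x hx z hz
          rw [hc, orbitList_head? _ _ hk₀] at hx
          rw [hc, orbitList_getLast?] at hz
          obtain rfl := Option.some.inj hx
          obtain rfl := Option.some.inj hz
          rw [Function.iterate_succ_apply'] at hkk
          exact hkk.symm
        · exact h₃ l hl
      · rw [List.flatten_cons, withPartners_append, List.nodup_append]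
        refine ⟨hnd, h₄, fun x hx z hz => ?_⟩
        rintro rfl
        exact (Finset.mem_filter.1 ((h₅ x).1 hz)).2 hx
      · intro x
        rw [List.flatten_cons, withPartners_append, List.mem_append, h₅, hY', Finset.mem_filter]
        have := hcY x
        tauto

end Involutions

/-! ### Existence of decompositions -/

theorem exists_noncrossing_pairing (D : Finset (Fin 4)) (hD : Even D.card) :
    ∃ t : Fin 4 → Fin 4, ∀ d ∈ D, t d ∈ D ∧ t d ≠ d ∧ t (t d) = d ∧
      (t d = d + 2 → d + 1 ∉ D ∧ d + 3 ∉ D) := by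
  -- Four occupied directions are paired as neighbours, 0 with 1 and 2 with 3; two occupied
  -- directions are paired with each other. Only the latter can go straight.
  refine ⟨fun d => if D = Finset.univ then ![1, 0, 3, 2] d else
    if d + 1 ∈ D then d + 1 else if d + 2 ∈ D then d + 2 else d + 3, ?_⟩
  revert D
  decide

section Existence

variable {Ω : DiscreteDomain} {n : ℕ} {P : MarkedPoints Ω n} {S : Config}

theorem Config.occupied_pt (hS : S ∈ P.conf) (i : Fin (2 * n + 2)) : S.Occupied (P.pt i) :=
  Or.inr (by rw [(mem_conf hS).2]; exact Finset.mem_image_of_mem _ (Finset.mem_univ i))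

theorem exists_vertex_pairing (hS : S ∈ P.conf) : ∃ τ : Dart → Dart, ∀ x, S.Occupied x →
    (τ x).1 = x.1 ∧ S.Occupied (τ x) ∧ τ x ≠ x ∧ τ (τ x) = x ∧
      ((τ x).2 = x.2 + 2 → ¬ S.Occupied (x.1, x.2 + 1) ∧ ¬ S.Occupied (x.1, x.2 + 3)) := by
  have hv : ∀ x, S.Occupied x → x.1 ∈ Ω.verts := by
    rintro x (h | h)
    · exact Ω.vert_of_edge x ((mem_conf hS).1 h)
    · rw [(mem_conf hS).2, Finset.mem_image] at h
      obtain ⟨i, -, rfl⟩ := h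
      exact Ω.vert_of_halfEdge _ (P.pt_mem i)
  have hE : ∀ v, ∃ t : Fin 4 → Fin 4, ∀ d, S.Occupied (v, d) → S.Occupied (v, t d) ∧ t d ≠ d ∧
      t (t d) = d ∧ (t d = d + 2 → ¬ S.Occupied (v, d + 1) ∧ ¬ S.Occupied (v, d + 3)) := by
    intro v
    by_cases hvΩ : v ∈ Ω.verts
    · have hconf : S ∈ Ω.conf := (Finset.mem_filter.1 hS).1
      have h₁ := (Finset.mem_filter.1 hconf).2 v hvΩ
      obtain ⟨t, ht⟩ := exists_noncrossing_pairing _ h₁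
      refine ⟨t, fun d hd => ?_⟩
      simpa only [Finset.mem_filter, Finset.mem_univ, true_and] using
        ht d (Finset.mem_filter.2 ⟨Finset.mem_univ d, hd⟩)
    · exact ⟨id, fun d hd => absurd (hv _ hd) hvΩ⟩
  choose t ht using hE
  refine ⟨fun x => (x.1, t x.1 x.2), fun x hx => ?_⟩
  obtain ⟨h₁, h₂, h₃, h₄⟩ := ht x.1 x.2 hx
  exact ⟨rfl, h₁, fun h => h₂ (Prod.ext_iff.1 h).2, Prod.ext rfl h₃, h₄⟩

theorem exists_link_pairing (hS : S ∈ P.conf) : ∃ σ : Dart → Dart, σ P.a = P.b ∧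
    ∀ x, S.Occupied x → S.Occupied (σ x) ∧ σ x ≠ x ∧ σ (σ x) = x ∧
      (x ≠ P.a → x ≠ P.b → Linked P S x (σ x)) := by
  obtain ⟨hS₁, hS₂⟩ := mem_conf hS
  -- A fictitious link joins a and b, so that σ has no fixed point on occupied darts; the final
  -- default x is never reached there.
  let σ : Dart → Dart := fun x =>
    if x.edge ∈ S.1 then x.rev else if x = P.a then P.b else if x = P.b then P.a else
      if h : ∃ s, x = P.arcStart s then P.arcEnd h.choose else
        if h : ∃ s, x = P.arcEnd s then P.arcStart h.choose else x
  have npt : ∀ i, (P.pt i).edge ∉ S.1 := fun i h => P.edge_pt_notMem i (hS₁ h)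
  have se : ∀ x : Dart, x.edge ∈ S.1 → σ x = x.rev := fun x hx => if_pos hx
  have na : P.a.edge ∉ S.1 := npt 0
  have nb : P.b.edge ∉ S.1 := npt (Fin.last _)
  have ns : ∀ s, (P.arcStart s).edge ∉ S.1 := fun s => npt _
  have nt : ∀ s, (P.arcEnd s).edge ∉ S.1 := fun s => npt _
  have sa : σ P.a = P.b := (if_neg na).trans (if_pos rfl)
  have sb : σ P.b = P.a := (if_neg nb).trans ((if_neg P.a_ne_b.symm).trans (if_pos rfl))
  have ss : ∀ s, σ (P.arcStart s) = P.arcEnd s := by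
    intro s
    have h : ∃ t, P.arcStart s = P.arcStart t := ⟨s, rfl⟩
    refine (if_neg (ns s)).trans ((if_neg (P.arcStart_ne_a s)).trans
      ((if_neg (P.arcStart_ne_b s)).trans ((dif_pos h).trans ?_)))
    rw [P.arcStart_injective h.choose_spec.symm]
  have st : ∀ s, σ (P.arcEnd s) = P.arcStart s := by
    intro s
    have h : ∃ t, P.arcEnd s = P.arcEnd t := ⟨s, rfl⟩
    have h' : ¬ ∃ t, P.arcEnd s = P.arcStart t := fun ⟨t, ht⟩ => P.arcStart_ne_arcEnd t s ht.symm
    refine (if_neg (nt s)).trans ((if_neg (P.arcEnd_ne_a s)).trans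
      ((if_neg (P.arcEnd_ne_b s)).trans ((dif_neg h').trans ((dif_pos h).trans ?_))))
    rw [P.arcEnd_injective h.choose_spec.symm]
  refine ⟨σ, sa, fun x hx => ?_⟩
  rcases hx with hx | hx
  · rw [se x hx]
    have hx' : x.rev.edge ∈ S.1 := by rwa [Dart.edge_rev]
    exact ⟨Or.inl hx', x.rev_ne, by rw [se _ hx', Dart.rev_rev], fun _ _ => Or.inl ⟨hx, rfl⟩⟩
  · rw [hS₂, Finset.mem_image] at hx
    obtain ⟨i, -, rfl⟩ := hx
    rcases P.pt_cases i with h | h | ⟨s, h | h⟩ <;> rw [h]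
    · rw [sa]
      exact ⟨Config.occupied_pt hS _, P.a_ne_b.symm, sb, fun h' => absurd rfl h'⟩
    · rw [sb]
      exact ⟨Config.occupied_pt hS _, P.a_ne_b, sa, fun _ h' => absurd rfl h'⟩
    · rw [ss]
      exact ⟨Config.occupied_pt hS _, (P.arcStart_ne_arcEnd s s).symm, st s,
        fun _ _ => Or.inr ⟨s, Or.inl ⟨rfl, rfl⟩⟩⟩
    · rw [st]
      exact ⟨Config.occupied_pt hS _, P.arcStart_ne_arcEnd s s, ss s,
        fun _ _ => Or.inr ⟨s, Or.inr ⟨rfl, rfl⟩⟩⟩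

/-- Every configuration has a decomposition. -/
theorem exists_decomposition (hS : S ∈ P.conf) : Nonempty (Decomposition P S) := by
  obtain ⟨τ₀, hτ₀⟩ := exists_vertex_pairing hS
  obtain ⟨σ₀, hσa, hσ₀⟩ := exists_link_pairing hS
  let α := {x : Dart // S.Occupied x}
  have hfin : Finite α := (S.darts.finite_toSet.subset fun x hx => (mem_darts_iff hS x).2 hx :
    Set.Finite {x | S.Occupied x})
  let τ : α → α := fun x => ⟨τ₀ x.1, (hτ₀ x.1 x.2).2.1⟩
  let σ : α → α := fun x => ⟨σ₀ x.1, (hσ₀ x.1 x.2).1⟩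
  have hτ : Function.Involutive τ := fun x => Subtype.ext (hτ₀ x.1 x.2).2.2.2.1
  have hσ : Function.Involutive σ := fun x => Subtype.ext (hσ₀ x.1 x.2).2.2.1
  have hτ' : ∀ x, τ x ≠ x := fun x h => (hτ₀ x.1 x.2).2.2.1 (congrArg Subtype.val h)
  have hσ' : ∀ x, σ x ≠ x := fun x h => (hσ₀ x.1 x.2).2.1 (congrArg Subtype.val h)
  let a : α := ⟨P.a, Config.occupied_pt hS 0⟩
  let b : α := ⟨P.b, Config.occupied_pt hS (Fin.last _)⟩
  have hab : σ a = b := Subtype.ext hσa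
  have hba : σ b = a := by rw [← hab, hσ]
  have hlink : ∀ x : α, τ x ≠ a → τ x ≠ b → Linked P S (τ x).1 (σ (τ x)).1 := fun x ha hb =>
    (hσ₀ _ (τ x).2).2.2.2 (fun h => ha (Subtype.ext h)) fun h => hb (Subtype.ext h)
  -- The alternating cycle through a, cut at the fictitious link from b to a, is the path. The
  -- remaining darts split into loops.
  obtain ⟨k, hk₀, hkk, hkmin, hnd, hcl⟩ := exists_orbit hτ hσ hτ' hσ' a
  obtain ⟨m, rfl⟩ : ∃ m, k = m + 1 := ⟨k - 1, by omega⟩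
  set p := orbitList (σ ∘ τ) a (m + 1) with hp
  have hap : a ∈ withPartners τ p := mem_withPartners.2
    ⟨a, List.mem_map.2 ⟨0, List.mem_range.2 hk₀, rfl⟩, Or.inl rfl⟩
  have hfinset : Set.Finite {x : α | x ∉ withPartners τ p} := Set.toFinite _
  obtain ⟨L, hL₁, hL₂, hL₃, hL₄, hL₅⟩ := exists_cycles hτ hσ hτ' hσ' hfinset.toFinset
    (fun x hx => by
    simp only [Set.Finite.mem_toFinset, Set.mem_ofPred_eq] at hx ⊢
    refine ⟨fun h => hx ?_, fun h => hx ?_⟩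
    · have := (hcl _ h).1
      rwa [hτ] at this
    · have := (hcl _ h).2
      rwa [hσ] at this)
  simp only [Set.Finite.mem_toFinset, Set.mem_ofPred_eq] at hL₅
  let toVisit : α → Visit := fun x => ⟨x.1.1, x.1.2, (τ x).1.2⟩
  have hin : ∀ x, (toVisit x).inDart = x.1 := fun x => rfl
  have hout : ∀ x, (toVisit x).outDart = (τ x).1 := fun x => Prod.ext (hτ₀ x.1 x.2).1.symm rfl
  have hall : p.map toVisit ++ (L.map fun l => l.map toVisit).flatten =
      (p ++ L.flatten).map toVisit := by
    rw [List.map_append, List.map_flatten]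
  have hdarts : ((p ++ L.flatten).map toVisit).flatMap (fun x => [x.inDart, x.outDart]) =
      (withPartners τ (p ++ L.flatten)).map Subtype.val := by
    rw [withPartners, List.flatMap_map, List.map_flatMap]
    simp only [hin, hout]
    rfl
  have hloop : ∀ l ∈ L, ∀ x ∈ l, Linked P S (τ x).1 (σ (τ x)).1 := by
    intro l hl x hx
    have hmem : ∀ y, y = a ∨ y = b → y ∈ withPartners τ p := by
      rintro y (rfl | rfl)
      · exact hap
      · rw [← hab]; exact (hcl _ hap).2
    have hx' : τ x ∉ withPartners τ p := (hL₅ _).1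
      (mem_withPartners.2 ⟨x, List.mem_flatten.2 ⟨l, hl, hx⟩, Or.inr rfl⟩)
    exact hlink x (fun h => hx' (hmem _ (Or.inl h))) fun h => hx' (hmem _ (Or.inr h))
  refine ⟨{ path := p.map toVisit, loops := L.map fun l => l.map toVisit,
            darts_nodup := ?_, mem_darts := ?_, noncrossing := ?_, path_start := ?_,
            path_end := ?_, path_chain := ?_, loops_ne_nil := ?_, loops_chain := ?_,
            loops_closed := ?_ }⟩
  · rw [hall, hdarts]
    refine List.Nodup.map Subtype.val_injective ?_
    rw [withPartners_append, List.nodup_append]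
    refine ⟨hnd, hL₄, fun x hx z hz => ?_⟩
    rintro rfl
    exact (hL₅ x).1 hz hx
  · intro x
    rw [hall, hdarts, List.mem_map]
    constructor
    · rintro ⟨y, -, rfl⟩; exact y.2
    · intro hx
      refine ⟨⟨x, hx⟩, ?_, rfl⟩
      rw [withPartners_append, List.mem_append, hL₅]
      exact Classical.em _
  · intro x hx
    rw [hall] at hx
    obtain ⟨y, -, rfl⟩ := List.mem_map.1 hx
    exact (hτ₀ y.1 y.2).2.2.2.2
  · rw [List.head?_map, hp, orbitList_head? _ _ hk₀]
    rfl
  · rw [List.getLast?_map, hp, orbitList_getLast?]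
    simp only [Option.map_some, Option.some.injEq, hout]
    rw [Function.iterate_succ_apply'] at hkk
    have : τ ((σ ∘ τ)^[m] a) = b := by
      rw [← hab]
      exact (hσ _).symm.trans (congrArg σ hkk)
    rw [this]
  · rw [List.isChain_iff_getElem]
    intro i hi
    simp only [hp, orbitList, List.length_map, List.length_range] at hi
    simp only [hp, orbitList, List.getElem_map, List.getElem_range, hin, hout]
    rw [Function.iterate_succ_apply']
    -- An out-dart is never a, which is an in-dart of the same cycle, and it equals b only just
    -- before the cycle closes.
    refine hlink _ ?_ ?_
    · exact alternate_ne hτ hσ hτ' hσ' a i 0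
    · intro h
      refine hkmin (i + 1) (by omega) (by omega) ?_
      rw [Function.iterate_succ_apply', Function.comp_apply, h, hba]
  · intro l' hl'
    obtain ⟨l, hl, rfl⟩ := List.mem_map.1 hl'
    simpa using hL₁ l hl
  · intro l' hl'
    obtain ⟨l, hl, rfl⟩ := List.mem_map.1 hl'
    have h₁ := hL₂ l hl
    rw [List.isChain_iff_getElem] at h₁ ⊢
    intro i hi
    rw [List.length_map] at hi
    have h₂ := h₁ i hi
    simp only [List.getElem_map, hin, hout]
    rw [h₂]
    exact hloop l hl _ (List.getElem_mem _)
  · intro l' hl'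
    obtain ⟨l, hl, rfl⟩ := List.mem_map.1 hl'
    intro x' hx' z' hz'
    rw [List.head?_map] at hx'
    rw [List.getLast?_map] at hz'
    obtain ⟨x, hx, rfl⟩ := Option.map_eq_some_iff.1 hx'
    obtain ⟨z, hz, rfl⟩ := Option.map_eq_some_iff.1 hz'
    rw [hin, hout, hL₃ l hl x hx z hz]
    exact hloop l hl _ (List.mem_of_getLast? hz)

/-- The phase of every decomposition is determined by `η_a` and `η_b`, up to one common sign. -/
theorem exists_sign_phase_eq {C : DoubleCover Ω}
    (hC : ∀ K : Ω.BoundaryComponent, K.IsInner → (C.BranchesAround K ↔ Odd (P.countOn K)))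
    (ν : Arcs C P) {a' b' : C.Vert} (ha' : C.proj a' = P.a.1) (hb' : C.proj b' = P.b.1)
    {ηa ηb : ℂ} (hηa : IsEta P.a ηa) (hηb : IsEta P.b ηb) :
    ∃ ε : ℂ, (ε = 1 ∨ ε = -1) ∧ ∀ S ∈ P.conf, ∀ D : Decomposition P S,
      Complex.I * ηa * D.phase ν a' b' = ε * ηb := by
  obtain ⟨sec, hsec⟩ := C.exists_section
  by_cases hne : P.conf.Nonempty
  · obtain ⟨S₀, hS₀⟩ := hne
    obtain ⟨D₀⟩ := exists_decomposition hS₀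
    have hs : (DoubleCover.sheet sec a' * DoubleCover.sheet sec b' * D₀.totalSign sec ν) *
        (DoubleCover.sheet sec a' * DoubleCover.sheet sec b' * D₀.totalSign sec ν) = 1 := by
      have h₁ := DoubleCover.sheet_sq sec a'
      have h₂ := DoubleCover.sheet_sq sec b'
      have h₃ := D₀.totalSign_sq sec ν
      calc _ = (DoubleCover.sheet sec a' * DoubleCover.sheet sec a') *
            (DoubleCover.sheet sec b' * DoubleCover.sheet sec b') *
            (D₀.totalSign sec ν * D₀.totalSign sec ν) := by ring
        _ = 1 := by rw [h₁, h₂, h₃]; rfl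
    have hsq := sq_eq_sq_iff_eq_or_eq_neg.1 (eta_sq_eq hηa hηb hs)
    have hval : ∀ S ∈ P.conf, ∀ D : Decomposition P S, Complex.I * ηa * D.phase ν a' b' =
        Complex.I * ηa * (windingFactor ((P.b.2.val : ℤ) - P.a.2.val) * Complex.I *
          ((DoubleCover.sheet sec a' * DoubleCover.sheet sec b' * D₀.totalSign sec ν : ℤ) : ℂ)) := by
      intro S hS D
      rw [D.phase_eq hS hsec ν ha' hb', totalSign_eq hsec hC ν hS hS₀ D D₀]
      push_cast
      ring
    rcases hsq with h | h
    · exact ⟨1, Or.inl rfl, fun S hS D => by rw [hval S hS D, h, one_mul]⟩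
    · exact ⟨-1, Or.inr rfl, fun S hS D => by rw [hval S hS D, h, neg_one_mul]⟩
  · exact ⟨1, Or.inl rfl, fun S hS => absurd ⟨S, hS⟩ hne⟩

end Existence

end

end IsingSpinor

end

theorem mainTheorem9 (Ω : IsingSpinor.DiscreteDomain) (n : ℕ) (P : IsingSpinor.MarkedPoints Ω n)
    (C : IsingSpinor.DoubleCover Ω)
    (hC : ∀ K : Ω.BoundaryComponent, K.IsInner → (C.BranchesAround K ↔ Odd (P.countOn K)))
    (ν : IsingSpinor.Arcs C P)
    (a' b' : C.Vert) (ha' : C.proj a' = P.a.1) (hb' : C.proj b' = P.b.1)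
    (ηa ηb : ℂ) (hηa : IsingSpinor.IsEta P.a ηa) (hηb : IsingSpinor.IsEta P.b ηb) :
    ∃ ε : ℂ, (ε = 1 ∨ ε = -1) ∧
      (∀ S ∈ P.conf, ∀ D : IsingSpinor.Decomposition P S,
        Complex.I * ηa * D.phase ν a' b' = ε * ηb) ∧
      IsingSpinor.observable ν a' b' ηa = ε * ηb * (P.Z : ℂ) := by
  obtain ⟨ε, hε, h⟩ := IsingSpinor.exists_sign_phase_eq hC ν ha' hb' hηa hηb
  refine ⟨ε, hε, h, ?_⟩
  rw [IsingSpinor.observable, IsingSpinor.MarkedPoints.Z, Complex.ofReal_sum,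
    Finset.mul_sum, Finset.mul_sum]
  refine Finset.sum_congr rfl fun S hS => ?_
  -- Existence rules out the default value 0 of `complexPhase`; the statement for every
  -- decomposition then covers the chosen one.
  have hD := IsingSpinor.exists_decomposition hS
  rw [IsingSpinor.complexPhase, dif_pos hD, ← mul_assoc, h S hS, Complex.ofReal_pow]
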